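/- Let $R$ be a commutative ring, $a\in R$, and let $0\le i\le n$ be integers. **Notation.** $\mathrm{TL}(m,k)$ is the free $R$-module on planar diagrams with $m$ nodes on a left bar and $k$ nodes on a right bar; composition glues diagrams and replaces each closed loop by a factor $a$; $\mathrm{TL}_{2n}=\mathrm{TL}(2n,2n)$. Nodes are labelled $1,2,\dots$ from bottom to top. Suppose that for each $m$ we have an $R$-module $M(m)$, on which the morphisms of $\mathrm{TL}$ act from the left. Write $D(M)$ for the chain complex with $D(M)_0=M(0)$ and $D(M)_q=\mathrm{TL}(0,2n)\otimes_R \mathrm{TL}_{2n}^{\otimes (q-1)}\otimes_R M(2n)$ for $q>0$, and with differential $(D_0|\dots|D_q)\mapsto\sum_{j=0}^{q-1}(-1)^j(D_0|\dots|D_jD_{j+1}|\dots|D_q)$; for $n=0$, $D(M)=M(0)$ is concentrated in degree $0$. The dga of planar loops is $L(2n)=D(\mathrm{TL}(-,0))$, with product $(D_0|\dots|D_p)\cdot(E_0|\dots|E_q)=(D_0|\dots|D_pE_0|\dots|E_q)$; the same formula makes each $D(M)$ a left dg-$L(2n)$-module. The cell module $\mathrm{S}(m,2i)$ is $\mathrm{TL}(m,2i)$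 modulo diagrams with a right cup (an arc joining two nodes of the right bar), and the derived cell module is $\mathrm{DS}(2n,2i)=D(\mathrm{S}(-,2i))$. $\mathrm{Inn}_p(m,2i)$ is the free module on the diagrams in $\mathrm{TL}(m,2i)$ together with a choice of $p$ "dashed" innermost right cups (right cups joining neighbouring nodes); composition keeps the dashed cups. The map $\delta\colon \mathrm{Inn}_p\to\mathrm{Inn}_{p-1}$ is the alternating sum of un-dashing the dashed cups, taken from bottom to top with first sign $+$. Write $\mathrm{DInn}_p(2n,2i)=D(\mathrm{Inn}_p(-,2i))$, and let $T(2n,2i)=[\mathrm{DInn}_0(2n,2i)\leftarrow\dots\leftarrow\mathrm{DInn}_i(2n,2i)]$ be the totalisation, with differential $\delta+(-1)^pd$ on $\mathrm{DInn}_p$ and the action of $r\in L(2n)$ on $\mathrm{DInn}_p$ twisted by $(-1)^{p|r|}$. **Weights.** If $R=\bigoplus_{j\ge 0}R_j$ is a graded ring and $a\in R_1$, an element $r\cdot x$, with $r\in R_j$ and $x$ a basis tensor of diagrams, has weight $j+\ell$, where $\ell$ is the number of loops formed by $x$ after un-dashing all cups and gluing on the right (for modules built from diagrams with $2i$ right nodes)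 the diagram $L_{\max}\in\mathrm{TL}(2i,0)$ joining $2k+1$ to $2k+2$ for $0\le k<i$. **Hook maps.** Let $R_1\in\mathrm{TL}(2n,2n+2)$ be the diagram whose only cup is the right cup joining $1$ and $2$, and $L_2\in \mathrm{TL}(2n+2,2n)$ the one whose only cup is the left cup joining $2$ and $3$. The hook map $h\colon D(M)\to D(M)$ from height $2n$ to height $2n+2$ is the identity of $M(0)$ in degree $0$ and is $(D_0|D_1|\dots|D_{q-1}|x)\mapsto(D_0R_1|L_2D_1R_1|\dots|L_2D_{q-1}R_1|L_2x)$ in degree $q>0$. This defines $h$ on $L$, on $\mathrm{DS}(-,2i)$ and on $T(-,2i)$. **Statement.** There is a preferred equivalence of left dg-$L(2n)$-modules $$\Sigma^iL(2n)\simeq\mathrm{DS}(2n,2i),$$ namely the zig-zag $$\Sigma^iL(2n)\;\longleftarrow\; T(2n,2i)\;\longrightarrow\;\mathrm{DS}(2n,2i),$$ in which the right-hand map is induced by the quotient maps $\mathrm{Inn}_0(m,2i)=\mathrm{TL}(m,2i)\to\mathrm{S}(m,2i)$ and vanishes on $\mathrm{DInn}_p(2n,2i)$ for $p>0$, and the left-hand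 map is the projection to $\mathrm{DInn}_i(2n,2i)$ followed by the isomorphism with $L(2n)$ that deletes the $i$ dashed cups. Both maps are quasi-isomorphisms of left dg-$L(2n)$-modules. If $R$ is graded with $a\in R_1$, both maps preserve weights when the weight on $L(2n)$ is raised by $i$, all these objects are differential bigraded modules over $L(2n)$, and the maps are isomorphisms on homology in each bidegree, so that one gets a preferred equivalence $\Sigma^{i,i}L(2n)\simeq\mathrm{DS}(2n,2i)$ of differential bigraded $L(2n)$-modules. These equivalences are compatible with the hook maps: the hook maps $\Sigma^ih$ on $\Sigma^iL(2n)$ and $h$ on $T(2n,2i)$ and $\mathrm{DS}(2n,2i)$, with values in the corresponding objects for $2n+2$, are maps of dg-$L(2n)$-modules (the targets being $L(2n)$-modules through $h\colon L(2n)\to L(2n+2)$), they preserve weights when these are defined, and they commute with both maps of the zig-zag. -/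

import Mathlib

namespace PlanarLoops

/-! ### Temperley-Lieb diagrams -/

/-- The position of a node of an `(m, n)`-diagram on the boundary of the strip between the two
bars: the left bar from bottom to top, followed by the right bar from top to bottom.
On each bar the nodes are numbered `0, 1, 2, …` from bottom to top. -/
def bpos {m n : ℕ} : Fin m ⊕ Fin n → ℕ
  | Sum.inl j => j
  | Sum.inr j => m + (n - 1 - j)

/-- A Temperley-Lieb `(m, n)`-diagram, up to isotopy: a perfect matching of the `m` nodes of the
left bar and the `n` nodes of the right bar such that no two arcs cross in the strip
between the bars. -/
@[ext]
structure Diagram (m n : ℕ) where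
  partner : Fin m ⊕ Fin n → Fin m ⊕ Fin n
  partner_partner : ∀ x, partner (partner x) = x
  partner_ne : ∀ x, partner x ≠ x
  noncrossing : ∀ x y, ¬ (bpos x < bpos y ∧ bpos y < bpos (partner x) ∧
    bpos (partner x) < bpos (partner y))

theorem bpos_injective {m n : ℕ} : Function.Injective (bpos : Fin m ⊕ Fin n → ℕ) := by
  rintro (x | x) (y | y) h <;> simp only [bpos] at h
  · congr 1; exact Fin.ext h
  · have := x.2; omega
  · have := y.2; omega
  · congr 1; apply Fin.ext; have := x.2; have := y.2; omega

section Glue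

variable {l m n : ℕ}

/-- The nodes of the two diagrams glued along the middle bar. -/
abbrev Glued (l m n : ℕ) : Type := Fin l ⊕ Fin m ⊕ Fin n

/-- The nodes of the first diagram inside the glued picture. -/
def inFirst : Fin l ⊕ Fin m → Glued l m n
  | Sum.inl j => Sum.inl j
  | Sum.inr j => Sum.inr (Sum.inl j)

/-- The nodes on the two outer bars inside the glued picture. -/
def outer : Fin l ⊕ Fin n → Glued l m n
  | Sum.inl j => Sum.inl j
  | Sum.inr j => Sum.inr (Sum.inr j)

/-- Walk along the arc of `D`; nodes not on `D` stay put. -/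
def stepFirst (D : Diagram l m) : Glued l m n → Glued l m n
  | Sum.inl j => inFirst (D.partner (Sum.inl j))
  | Sum.inr (Sum.inl j) => inFirst (D.partner (Sum.inr j))
  | Sum.inr (Sum.inr j) => Sum.inr (Sum.inr j)

/-- Walk along the arc of `E`; nodes not on `E` stay put. -/
def stepSecond (E : Diagram m n) : Glued l m n → Glued l m n
  | Sum.inl j => Sum.inl j
  | Sum.inr x => Sum.inr (E.partner x)

/-- The equivalence relation "joined by a path of arcs" on the glued picture. -/
def joined (D : Diagram l m) (E : Diagram m n) : Setoid (Glued l m n) :=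
  Relation.EqvGen.setoid fun u v => v = stepFirst D u ∨ v = stepSecond E u

theorem inFirst_injective : Function.Injective (inFirst : Fin l ⊕ Fin m → Glued l m n) := by
  rintro (x | x) (y | y) h <;> simp_all [inFirst]

theorem outer_injective : Function.Injective (outer : Fin l ⊕ Fin n → Glued l m n) := by
  rintro (x | x) (y | y) h <;> simp_all [outer]

theorem stepFirst_inFirst (D : Diagram l m) (x : Fin l ⊕ Fin m) :
    stepFirst (n := n) D (inFirst x) = inFirst (D.partner x) := by
  rcases x with x | x <;> rfl

theorem stepFirst_invol (D : Diagram l m) :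
    Function.Involutive (stepFirst D : Glued l m n → Glued l m n) := by
  rintro (x | x | x)
  · change stepFirst D (inFirst _) = _
    rw [stepFirst_inFirst, D.partner_partner]; rfl
  · change stepFirst D (inFirst _) = _
    rw [stepFirst_inFirst, D.partner_partner]; rfl
  · rfl

theorem stepSecond_invol (E : Diagram m n) :
    Function.Involutive (stepSecond E : Glued l m n → Glued l m n) := by
  rintro (x | x)
  · rfl
  · simp [stepSecond, E.partner_partner]

theorem stepFirst_eq_self (D : Diagram l m) (u : Glued l m n) :
    stepFirst D u = u ↔ ∃ j, u = Sum.inr (Sum.inr j) := by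
  rcases u with x | x | x
  · have := D.partner_ne (Sum.inl x)
    refine ⟨fun h => absurd (inFirst_injective (n := n) (?_ : inFirst _ = inFirst _)) this, ?_⟩
    · exact h
    · rintro ⟨j, hj⟩; simp at hj
  · have := D.partner_ne (Sum.inr x)
    refine ⟨fun h => absurd (inFirst_injective (n := n) (?_ : inFirst _ = inFirst _)) this, ?_⟩
    · exact h
    · rintro ⟨j, hj⟩; simp at hj
  · simp [stepFirst]

theorem stepSecond_eq_self (E : Diagram m n) (u : Glued l m n) :
    stepSecond E u = u ↔ ∃ j, u = Sum.inl j := by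
  rcases u with x | x
  · simp [stepSecond]
  · simp [stepSecond, E.partner_ne]

end Glue

/-- Two involutions on a finite set: the orbit of a point fixed by exactly one of them contains
exactly one further point fixed by one of them. -/
theorem existsUnique_other_end_aux {N : Type} [Finite N] (s t : N → N)
    (hs : Function.Involutive s) (ht : Function.Involutive t) (x : N) (hx : s x = x)
    (hx' : t x ≠ x) :
    ∃! y, y ≠ x ∧ (s y = y ∨ t y = y) ∧
      Relation.EqvGen (fun u v => v = s u ∨ v = t u) x y := by
  let σ : Equiv.Perm N := hs.toPerm
  let τ : Equiv.Perm N := ht.toPerm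
  let π : Equiv.Perm N := τ * σ
  have hσσ : σ * σ = 1 := by ext u; exact hs u
  have hττ : τ * τ = 1 := by ext u; exact ht u
  have hσi : σ⁻¹ = σ := inv_eq_of_mul_eq_one_left hσσ
  have hτi : τ⁻¹ = τ := inv_eq_of_mul_eq_one_left hττ
  have hconj : σ * π * σ⁻¹ = π⁻¹ := by
    simp only [π, mul_inv_rev, hσi, hτi]
    rw [mul_assoc, mul_assoc, hσσ, mul_one]
  have hσπ : ∀ k : ℤ, σ ((π ^ k) x) = (π ^ (-k)) x := by
    intro k
    have h1 : σ * π ^ k = π ^ (-k) * σ := by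
      have : σ * π ^ k * σ⁻¹ = (σ * π * σ⁻¹) ^ k := (conj_zpow).symm
      rw [hconj, inv_zpow, ← zpow_neg] at this
      rw [← this, inv_mul_cancel_right]
    have := congrArg (fun p : Equiv.Perm N => p x) h1
    simp only [Equiv.Perm.mul_apply] at this
    rw [this]; congr 1
  have hτeq : τ = π * σ := by simp only [π]; rw [mul_assoc, hσσ, mul_one]
  have hτπ : ∀ k : ℤ, τ ((π ^ k) x) = (π ^ (1 - k)) x := by
    intro k
    rw [hτeq, Equiv.Perm.mul_apply, hσπ, ← Equiv.Perm.mul_apply, sub_eq_add_neg, zpow_add,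
      zpow_one]
  set c := Function.minimalPeriod (fun y => π • y) x with hc
  have hper : ∀ k : ℤ, (π ^ k) x = x ↔ (c : ℤ) ∣ k := fun k =>
    MulAction.zpow_smul_eq_iff_minimalPeriod_dvd (a := π) (b := x) (n := k)
  have hper2 : ∀ j k : ℤ, (π ^ j) x = (π ^ k) x ↔ (c : ℤ) ∣ j - k := by
    intro j k
    rw [← hper, sub_eq_neg_add, zpow_add, Equiv.Perm.mul_apply, zpow_neg, Equiv.Perm.inv_eq_iff_eq]
  have hcpos : 0 < c := by
    have h : x ∈ Function.periodicPts (fun y => π • y) :=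
      (Function.Injective.mem_periodicPts (MulAction.injective π)) x
    exact Function.minimalPeriod_pos_of_mem_periodicPts h
  have hπx : π x = t x := by change t (s x) = t x; rw [hx]
  have hc1 : c ≠ 1 := by
    intro h
    have := (hper 1).2 (by rw [h]; norm_num)
    rw [zpow_one, hπx] at this
    exact hx' this
  -- the class of `x`
  have hcl : ∀ y, Relation.EqvGen (fun u v => v = s u ∨ v = t u) x y ↔
      ∃ k : ℤ, y = (π ^ k) x := by
    intro y
    constructor
    · intro h
      have key : ∀ u v, Relation.EqvGen (fun u v => v = s u ∨ v = t u) u v →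
          ((∃ k : ℤ, u = (π ^ k) x) ↔ ∃ k : ℤ, v = (π ^ k) x) := by
        intro u v huv
        induction huv with
        | rel u v h =>
          rcases h with rfl | rfl
          · constructor
            · rintro ⟨k, rfl⟩; exact ⟨-k, hσπ k⟩
            · rintro ⟨k, hk⟩
              refine ⟨-k, ?_⟩
              rw [← hσπ k, ← hk]; exact (hs u).symm
          · constructor
            · rintro ⟨k, rfl⟩; exact ⟨1 - k, hτπ k⟩
            · rintro ⟨k, hk⟩
              refine ⟨1 - k, ?_⟩
              rw [← hτπ k, ← hk]; exact (ht u).symm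
        | refl u => exact Iff.rfl
        | symm u v _ ih => exact ih.symm
        | trans u v w _ _ ih1 ih2 => exact ih1.trans ih2
      exact (key x y h).1 ⟨0, by simp⟩
    · rintro ⟨k, rfl⟩
      have hst : ∀ u, Relation.EqvGen (fun u v => v = s u ∨ v = t u) u (π u) := fun u =>
        Relation.EqvGen.trans _ (s u) _ (Relation.EqvGen.rel _ _ (Or.inl rfl))
          (Relation.EqvGen.rel _ _ (Or.inr rfl))
      induction k with
      | zero => simpa using Relation.EqvGen.refl x
      | succ k ih =>
        refine Relation.EqvGen.trans _ _ _ ih ?_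
        rw [add_comm, zpow_add, zpow_one, Equiv.Perm.mul_apply]
        exact hst _
      | pred k ih =>
        refine Relation.EqvGen.trans _ _ _ ih (Relation.EqvGen.symm _ _ ?_)
        have h := hst ((π ^ (-(k : ℤ) - 1)) x)
        rwa [← Equiv.Perm.mul_apply, ← zpow_one_add,
          show (1 : ℤ) + (-(k : ℤ) - 1) = -k by ring] at h
  have hsfix : ∀ k : ℤ, s ((π ^ k) x) = (π ^ k) x ↔ (c : ℤ) ∣ 2 * k := by
    intro k
    have : s ((π ^ k) x) = (π ^ (-k)) x := hσπ k
    rw [this, hper2, show -k - k = -(2 * k) by ring, dvd_neg]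
  have htfix : ∀ k : ℤ, t ((π ^ k) x) = (π ^ k) x ↔ (c : ℤ) ∣ 1 - 2 * k := by
    intro k
    have : t ((π ^ k) x) = (π ^ (1 - k)) x := hτπ k
    rw [this, hper2, show 1 - k - k = 1 - 2 * k by ring]
  rcases Nat.even_or_odd' c with ⟨q, hq | hq⟩
  · refine ⟨(π ^ (q : ℤ)) x, ⟨?_, Or.inl ((hsfix _).2 ?_), (hcl _).2 ⟨_, rfl⟩⟩, ?_⟩
    · rw [Ne, hper]
      intro h
      have h := Nat.le_of_dvd (by omega) (Int.natCast_dvd_natCast.1 h)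
      omega
    · rw [hq]; push_cast; exact dvd_refl _
    · rintro y ⟨hy, hfix, hxy⟩
      obtain ⟨k, rfl⟩ := (hcl y).1 hxy
      rw [hsfix, htfix] at hfix
      rw [Ne, hper] at hy
      rw [hper2]
      rw [hq] at hfix hy ⊢
      push_cast at hfix hy ⊢
      rcases hfix with ⟨e, he⟩ | ⟨e, he⟩
      · have hk : k = q * e := by linarith
        rcases Int.even_or_odd' e with ⟨f, hf | hf⟩
        · exact absurd ⟨f, by rw [hk, hf]; ring⟩ hy
        · exact ⟨f, by rw [hk, hf]; ring⟩
      · exfalso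
        have : (2 : ℤ) ∣ 1 := ⟨k + q * e, by linarith⟩
        omega
  · refine ⟨(π ^ ((q : ℤ) + 1)) x, ⟨?_, Or.inr ((htfix _).2 ?_), (hcl _).2 ⟨_, rfl⟩⟩, ?_⟩
    · rw [Ne, hper]
      intro h
      have h' : c ∣ q + 1 := by exact_mod_cast h
      have h := Nat.le_of_dvd (by omega) h'
      omega
    · rw [hq]; push_cast; exact ⟨-1, by ring⟩
    · rintro y ⟨hy, hfix, hxy⟩
      obtain ⟨k, rfl⟩ := (hcl y).1 hxy
      rw [hsfix, htfix] at hfix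
      rw [Ne, hper] at hy
      rw [hper2]
      rw [hq] at hfix hy ⊢
      have hcop : IsCoprime ((2 * q + 1 : ℕ) : ℤ) 2 := ⟨1, -q, by push_cast; ring⟩
      rcases hfix with h | ⟨e, he⟩
      · exact absurd (hcop.dvd_of_dvd_mul_left h) hy
      · refine hcop.dvd_of_dvd_mul_left ⟨-e - 1, ?_⟩
        push_cast at he ⊢
        linarith

section Comp

variable {l m n : ℕ}

theorem step_eq_self_iff (D : Diagram l m) (E : Diagram m n) (u : Glued l m n) :
    (stepFirst D u = u ∨ stepSecond E u = u) ↔ ∃ y, u = outer y := by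
  rw [stepFirst_eq_self, stepSecond_eq_self]
  constructor
  · rintro (⟨j, rfl⟩ | ⟨j, rfl⟩)
    · exact ⟨Sum.inr j, rfl⟩
    · exact ⟨Sum.inl j, rfl⟩
  · rintro ⟨y | y, rfl⟩
    · exact Or.inr ⟨y, rfl⟩
    · exact Or.inl ⟨y, rfl⟩

/-- Every path starting on an outer bar ends at exactly one other node of the outer bars. -/
theorem existsUnique_other_end (D : Diagram l m) (E : Diagram m n) (x : Fin l ⊕ Fin n) :
    ∃! y, y ≠ x ∧ (joined D E) (outer x) (outer y) := by
  have main : ∃! u : Glued l m n, u ≠ outer x ∧ (stepFirst D u = u ∨ stepSecond E u = u) ∧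
      (joined D E) (outer x) u := by
    rcases x with x | x
    · have := existsUnique_other_end_aux (stepSecond E : Glued l m n → Glued l m n) (stepFirst D)
        (stepSecond_invol E) (stepFirst_invol D) (outer (Sum.inl x)) rfl
        (by rw [Ne, stepFirst_eq_self]; rintro ⟨j, hj⟩; simp [outer] at hj)
      simp only [or_comm (a := stepFirst D _ = _)]
      convert this using 6
      change Relation.EqvGen _ _ _ ↔ _
      simp only [or_comm]
    · exact existsUnique_other_end_aux (stepFirst D : Glued l m n → Glued l m n) (stepSecond E)
        (stepFirst_invol D) (stepSecond_invol E) (outer (Sum.inr x)) rfl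
        (by rw [Ne, stepSecond_eq_self]; rintro ⟨j, hj⟩; simp [outer] at hj)
  obtain ⟨u, ⟨h1, h2, h3⟩, h4⟩ := main
  obtain ⟨y, rfl⟩ := (step_eq_self_iff D E u).1 h2
  refine ⟨y, ⟨fun h => h1 (by rw [h]), h3⟩, ?_⟩
  rintro z ⟨hz, hxz⟩
  exact outer_injective (h4 _ ⟨fun h => hz (outer_injective h),
    (step_eq_self_iff D E _).2 ⟨z, rfl⟩, hxz⟩)

/-- The other end of the path that starts at a node of the outer bars. -/
noncomputable def compPartner (D : Diagram l m) (E : Diagram m n) (x : Fin l ⊕ Fin n) :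
    Fin l ⊕ Fin n :=
  (existsUnique_other_end D E x).choose

theorem compPartner_eq_iff (D : Diagram l m) (E : Diagram m n) (x y : Fin l ⊕ Fin n) :
    compPartner D E x = y ↔ y ≠ x ∧ (joined D E) (outer x) (outer y) := by
  have h := (existsUnique_other_end D E x).choose_spec
  constructor
  · rintro rfl; exact h.1
  · intro hy; exact (h.2 y hy).symm

open Classical in
/-- A set of arcs of a planar diagram separates the two ends of any other arc an even number of
times. -/
theorem count_parity (D : Diagram l m) (S : Set (Fin l ⊕ Fin m))
    (hS : ∀ x ∈ S, D.partner x ∈ S) (v : Fin l ⊕ Fin m) (hv : v ∉ S) :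
    (((Finset.univ.filter fun x => x ∈ S ∧ bpos x < bpos v).card : ℕ) : ZMod 2) =
      (((Finset.univ.filter fun x => x ∈ S ∧ bpos x < bpos (D.partner v)).card : ℕ) : ZMod 2) := by
  have hS' : ∀ x, D.partner x ∈ S → x ∈ S := fun x hx => by
    have := hS _ hx; rwa [D.partner_partner] at this
  wlog hlt : bpos v < bpos (D.partner v) generalizing v with H
  · have hne : bpos v ≠ bpos (D.partner v) := fun h => D.partner_ne v (bpos_injective h).symm
    have := H (D.partner v) (fun h => hv (hS' v h))
      (by rw [D.partner_partner]; omega)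
    rw [D.partner_partner] at this
    exact this.symm
  have hpv : D.partner v ∉ S := fun h => hv (hS' v h)
  have hsplit : (Finset.univ.filter fun x => x ∈ S ∧ bpos x < bpos (D.partner v)) =
      (Finset.univ.filter fun x => x ∈ S ∧ bpos x < bpos v) ∪
      (Finset.univ.filter fun x => x ∈ S ∧ bpos v < bpos x ∧ bpos x < bpos (D.partner v)) := by
    ext x
    simp only [Finset.mem_filter, Finset.mem_univ, true_and, Finset.mem_union]
    constructor
    · rintro ⟨hx, h⟩
      have : bpos x ≠ bpos v := fun h => hv (bpos_injective h ▸ hx)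
      rcases lt_or_gt_of_ne this with h' | h'
      · exact Or.inl ⟨hx, h'⟩
      · exact Or.inr ⟨hx, h', h⟩
    · rintro (⟨hx, h⟩ | ⟨hx, h, h'⟩)
      · exact ⟨hx, by omega⟩
      · exact ⟨hx, h'⟩
  rw [hsplit, Finset.card_union_of_disjoint, Nat.cast_add, left_eq_add]
  · rw [Finset.card_eq_sum_ones, Nat.cast_sum]
    refine Finset.sum_involution (fun x _ => D.partner x) ?_ ?_ ?_ ?_
    · intro x _; decide
    · intro x _ _; exact D.partner_ne x
    · intro x hx
      simp only [Finset.mem_filter, Finset.mem_univ, true_and] at hx ⊢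
      obtain ⟨hx, h1, h2⟩ := hx
      have hpx := hS x hx
      have n1 : bpos (D.partner x) ≠ bpos v := fun h => hv (bpos_injective h ▸ hpx)
      have n2 : bpos (D.partner x) ≠ bpos (D.partner v) := fun h => hpv (bpos_injective h ▸ hpx)
      have c1 := D.noncrossing v x
      have c2 := D.noncrossing (D.partner x) v
      rw [D.partner_partner] at c2
      refine ⟨hpx, ?_, ?_⟩ <;> by_contra hcon
      · exact c2 ⟨by omega, by omega, by omega⟩
      · exact c1 ⟨by omega, by omega, by omega⟩
    · intro x _; exact D.partner_partner x
  · rw [Finset.disjoint_left]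
    intro x hx hx'
    simp only [Finset.mem_filter, Finset.mem_univ, true_and] at hx hx'
    omega

open Classical in
theorem comp_noncrossing (D : Diagram l m) (E : Diagram m n) (x y : Fin l ⊕ Fin n) :
    ¬ (bpos x < bpos y ∧ bpos y < bpos (compPartner D E x) ∧
      bpos (compPartner D E x) < bpos (compPartner D E y)) := by
  rintro ⟨h1, h2, h3⟩
  set x' := compPartner D E x with hx'
  set y' := compPartner D E y with hy'
  obtain ⟨-, hxx⟩ := (compPartner_eq_iff D E x x').1 hx'.symm
  obtain ⟨-, hyy⟩ := (compPartner_eq_iff D E y y').1 hy'.symm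
  let r := joined D E
  let S : Set (Glued l m n) := {u | r (outer x) u}
  have hS1 : ∀ u, stepFirst D u ∈ S ↔ u ∈ S := fun u =>
    ⟨fun h => r.trans h (r.symm (Relation.EqvGen.rel _ _ (Or.inl rfl))),
      fun h => r.trans h (Relation.EqvGen.rel _ _ (Or.inl rfl))⟩
  have hS2 : ∀ u, stepSecond E u ∈ S ↔ u ∈ S := fun u =>
    ⟨fun h => r.trans h (r.symm (Relation.EqvGen.rel _ _ (Or.inr rfl))),
      fun h => r.trans h (Relation.EqvGen.rel _ _ (Or.inr rfl))⟩
  have hSout : ∀ z, outer z ∈ S ↔ z = x ∨ z = x' := by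
    intro z
    constructor
    · intro h
      by_cases hz : z = x
      · exact Or.inl hz
      · exact Or.inr ((compPartner_eq_iff D E x z).2 ⟨hz, h⟩).symm
    · rintro (rfl | rfl)
      · exact r.refl _
      · exact hxx
  -- the parity of the number of nodes of the path before a given node
  let cD : Fin l ⊕ Fin m → ZMod 2 := fun v =>
    (((Finset.univ.filter fun z => z ∈ inFirst ⁻¹' S ∧ bpos z < bpos v).card : ℕ) : ZMod 2)
  let cE : Fin m ⊕ Fin n → ZMod 2 := fun v =>
    (((Finset.univ.filter fun z => z ∈ Sum.inr ⁻¹' S ∧ bpos z < bpos v).card : ℕ) : ZMod 2)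
  have hD : ∀ v, inFirst v ∉ S → cD v = cD (D.partner v) := fun v hv =>
    count_parity D (inFirst ⁻¹' S) (fun z hz => by
      have := (hS1 (inFirst z)).2 hz
      rwa [stepFirst_inFirst] at this) v hv
  have hE : ∀ v, Sum.inr v ∉ S → cE v = cE (E.partner v) := fun v hv =>
    count_parity E (Sum.inr ⁻¹' S) (fun z hz => (hS2 (Sum.inr z)).2 hz) v hv
  let kL : ZMod 2 := (((Finset.univ.filter fun j : Fin l => Sum.inl j ∈ S).card : ℕ) : ZMod 2)
  let kM : ZMod 2 :=
    (((Finset.univ.filter fun j : Fin m => Sum.inr (Sum.inl j) ∈ S).card : ℕ) : ZMod 2)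
  have cast_sum : ∀ {α β : Type} [Fintype α] [Fintype β] (p : α ⊕ β → Prop) [DecidablePred p],
      (((Finset.univ.filter p).card : ℕ) : ZMod 2) =
        (((Finset.univ.filter fun j : α => p (Sum.inl j)).card : ℕ) : ZMod 2) +
        (((Finset.univ.filter fun j : β => p (Sum.inr j)).card : ℕ) : ZMod 2) := by
    intro α β _ _ p _
    simp only [Finset.card_filter, Fintype.sum_sum_type]
    push_cast
    rfl
  have two : ∀ z : ZMod 2, z + z = 0 := by decide
  have hmid : ∀ j : Fin m, Sum.inr (Sum.inl j) ∉ S →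
      cD (Sum.inr j) = cE (Sum.inl j) + (kL + kM) := by
    intro j hj
    simp only [cD, cE]
    rw [cast_sum, cast_sum]
    have e1 : (Finset.univ.filter fun a : Fin l => (Sum.inl a : Fin l ⊕ Fin m) ∈ inFirst ⁻¹' S ∧
        bpos (Sum.inl a : Fin l ⊕ Fin m) < bpos (Sum.inr j : Fin l ⊕ Fin m)) =
        Finset.univ.filter fun a : Fin l => Sum.inl a ∈ S := by
      ext a
      simp only [Finset.mem_filter, Finset.mem_univ, true_and, Set.mem_preimage]
      simp only [inFirst, bpos]
      have := a.2
      exact ⟨fun h => h.1, fun h => ⟨h, by omega⟩⟩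
    have e2 : (Finset.univ.filter fun b : Fin n => (Sum.inr b : Fin m ⊕ Fin n) ∈ Sum.inr ⁻¹' S ∧
        bpos (Sum.inr b : Fin m ⊕ Fin n) < bpos (Sum.inl j : Fin m ⊕ Fin n)) = ∅ := by
      ext b
      simp only [Finset.mem_filter, Finset.mem_univ, true_and, Finset.notMem_empty,
        iff_false, not_and]
      have := j.2
      intro _
      simp only [bpos]
      omega
    have e3 : kM = (((Finset.univ.filter fun b : Fin m =>
          (Sum.inr b : Fin l ⊕ Fin m) ∈ inFirst ⁻¹' S ∧
          bpos (Sum.inr b : Fin l ⊕ Fin m) < bpos (Sum.inr j : Fin l ⊕ Fin m)).card : ℕ) : ZMod 2)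
        + (((Finset.univ.filter fun b : Fin m =>
          (Sum.inl b : Fin m ⊕ Fin n) ∈ Sum.inr ⁻¹' S ∧
          bpos (Sum.inl b : Fin m ⊕ Fin n) < bpos (Sum.inl j : Fin m ⊕ Fin n)).card : ℕ) :
            ZMod 2) := by
      rw [← Nat.cast_add, ← Finset.card_union_of_disjoint]
      · simp only [kM]
        congr 2
        ext b
        simp only [Finset.mem_filter, Finset.mem_univ, true_and, Finset.mem_union,
          Set.mem_preimage]
        simp only [inFirst, bpos]
        have hb := b.2
        have hj' := j.2
        constructor
        · intro hb'
          have : (b : ℕ) ≠ j := fun h => hj (Fin.ext h ▸ hb')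
          by_cases hlt : (b : ℕ) < j
          · exact Or.inr ⟨hb', hlt⟩
          · exact Or.inl ⟨hb', by omega⟩
        · rintro (h | h) <;> exact h.1
      · rw [Finset.disjoint_left]
        intro b hb hb'
        simp only [Finset.mem_filter, Finset.mem_univ, true_and] at hb hb'
        simp only [bpos] at hb hb'
        have := b.2; have := j.2
        omega
    rw [e1, e2, e3]
    simp only [Finset.card_empty, Nat.cast_zero, add_zero]
    generalize (((Finset.univ.filter fun b : Fin m =>
          (Sum.inl b : Fin m ⊕ Fin n) ∈ Sum.inr ⁻¹' S ∧
          bpos (Sum.inl b : Fin m ⊕ Fin n) < bpos (Sum.inl j : Fin m ⊕ Fin n)).card : ℕ) :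
            ZMod 2) = B
    generalize (((Finset.univ.filter fun b : Fin m =>
          (Sum.inr b : Fin l ⊕ Fin m) ∈ inFirst ⁻¹' S ∧
          bpos (Sum.inr b : Fin l ⊕ Fin m) < bpos (Sum.inr j : Fin l ⊕ Fin m)).card : ℕ) :
            ZMod 2) = A
    change kL + A = B + (kL + (A + B))
    have := two B
    linear_combination -this
  let χ : Glued l m n → ZMod 2 := fun u => match u with
    | Sum.inl j => cD (Sum.inl j)
    | Sum.inr (Sum.inl j) => cD (Sum.inr j)
    | Sum.inr (Sum.inr j) => cE (Sum.inr j) + (kL + kM)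
  have hχD : ∀ v, χ (inFirst v) = cD v := by rintro (v | v) <;> rfl
  have hχE : ∀ v, Sum.inr v ∉ S → χ (Sum.inr v) = cE v + (kL + kM) := by
    rintro (v | v) hv
    · exact hmid v hv
    · rfl
  have hχ1 : ∀ u, u ∉ S → χ (stepFirst D u) = χ u := by
    rintro (u | u | u) hu
    · change χ (inFirst _) = _
      exact (hχD _).trans (hD (Sum.inl u) hu).symm
    · change χ (inFirst _) = _
      exact (hχD _).trans (hD (Sum.inr u) hu).symm
    · rfl
  have hχ2 : ∀ u, u ∉ S → χ (stepSecond E u) = χ u := by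
    rintro (u | u) hu
    · rfl
    · have hu' : Sum.inr (E.partner u) ∉ S := fun h => hu ((hS2 (Sum.inr u)).1 h)
      change χ (Sum.inr (E.partner u)) = _
      rw [hχE _ hu', hχE _ hu, ← hE _ hu]
  have hχ : ∀ u v, Relation.EqvGen (fun u v => v = stepFirst D u ∨ v = stepSecond E u) u v →
      (u ∈ S ↔ v ∈ S) ∧ (u ∉ S → χ u = χ v) := by
    intro u v h
    induction h with
    | rel u v h =>
      rcases h with rfl | rfl
      · exact ⟨(hS1 u).symm, fun hu => (hχ1 u hu).symm⟩
      · exact ⟨(hS2 u).symm, fun hu => (hχ2 u hu).symm⟩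
    | refl u => exact ⟨Iff.rfl, fun _ => rfl⟩
    | symm u v _ ih => exact ⟨ih.1.symm, fun hv => (ih.2 (fun hu => hv (ih.1.1 hu))).symm⟩
    | trans u v w _ _ ih1 ih2 =>
      exact ⟨ih1.1.trans ih2.1, fun hu => (ih1.2 hu).trans (ih2.2 fun hv => hu (ih1.1.2 hv))⟩
  have hyS : outer y ∉ S := by
    rw [hSout]; rintro (rfl | h)
    · omega
    · rw [h] at h2; omega
  have heq := (hχ _ _ hyy).2 hyS
  -- `χ` on the outer bars
  have hout : ∀ z : Fin l ⊕ Fin n, χ (outer z) =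
      (((Finset.univ.filter fun w : Fin l ⊕ Fin n => outer w ∈ S ∧ bpos w < bpos z).card : ℕ) :
        ZMod 2) := by
    rintro (z | z)
    · change cD (Sum.inl z) = _
      simp only [cD]
      rw [cast_sum, cast_sum]
      have := z.2
      refine congrArg₂ (· + ·) rfl (Eq.trans (b := 0) ?_ (Eq.symm ?_)) <;>
      · rw [Finset.filter_false_of_mem, Finset.card_empty, Nat.cast_zero]
        rintro j - ⟨_, h⟩
        simp only [bpos] at h
        omega
    · change cE (Sum.inr z) + (kL + kM) = _
      simp only [cE]
      rw [cast_sum, cast_sum]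
      have e1 : (Finset.univ.filter fun b : Fin m =>
          (Sum.inl b : Fin m ⊕ Fin n) ∈ Sum.inr ⁻¹' S ∧
          bpos (Sum.inl b : Fin m ⊕ Fin n) < bpos (Sum.inr z : Fin m ⊕ Fin n)) =
          Finset.univ.filter fun b : Fin m => Sum.inr (Sum.inl b) ∈ S := by
        ext b
        simp only [Finset.mem_filter, Finset.mem_univ, true_and, Set.mem_preimage]
        simp only [bpos]
        have := b.2
        exact ⟨fun h => h.1, fun h => ⟨h, by omega⟩⟩
      have e2 : (Finset.univ.filter fun b : Fin l => (outer (Sum.inl b : Fin l ⊕ Fin n)) ∈ S ∧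
          bpos (Sum.inl b : Fin l ⊕ Fin n) < bpos (Sum.inr z : Fin l ⊕ Fin n)) =
          Finset.univ.filter fun b : Fin l => Sum.inl b ∈ S := by
        ext b
        simp only [Finset.mem_filter, Finset.mem_univ, true_and]
        simp only [outer, bpos]
        have := b.2
        exact ⟨fun h => h.1, fun h => ⟨h, by omega⟩⟩
      have e3 : (Finset.univ.filter fun b : Fin n =>
          (Sum.inr b : Fin m ⊕ Fin n) ∈ Sum.inr ⁻¹' S ∧
          bpos (Sum.inr b : Fin m ⊕ Fin n) < bpos (Sum.inr z : Fin m ⊕ Fin n)) =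
          (Finset.univ.filter fun b : Fin n => (outer (Sum.inr b : Fin l ⊕ Fin n)) ∈ S ∧
          bpos (Sum.inr b : Fin l ⊕ Fin n) < bpos (Sum.inr z : Fin l ⊕ Fin n)) := by
        ext b
        simp only [Finset.mem_filter, Finset.mem_univ, true_and, Set.mem_preimage]
        simp only [outer, bpos, add_lt_add_iff_left]
      rw [e1, e2, e3]
      generalize (((Finset.univ.filter fun b : Fin n => (outer (Sum.inr b : Fin l ⊕ Fin n)) ∈ S ∧
          bpos (Sum.inr b : Fin l ⊕ Fin n) < bpos (Sum.inr z : Fin l ⊕ Fin n)).card : ℕ) :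
          ZMod 2) = A
      change kM + A + (kL + kM) = kL + A
      have := two kM
      linear_combination this
  rw [hout, hout] at heq
  have f1 : (Finset.univ.filter fun w : Fin l ⊕ Fin n => outer w ∈ S ∧ bpos w < bpos y) = {x} := by
    ext w
    simp only [Finset.mem_filter, Finset.mem_univ, true_and, Finset.mem_singleton, hSout]
    constructor
    · rintro ⟨rfl | rfl, h⟩
      · rfl
      · omega
    · rintro rfl; exact ⟨Or.inl rfl, h1⟩
  have f2 : (Finset.univ.filter fun w : Fin l ⊕ Fin n => outer w ∈ S ∧ bpos w < bpos y') =
      {x, x'} := by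
    ext w
    simp only [Finset.mem_filter, Finset.mem_univ, true_and, Finset.mem_singleton, hSout,
      Finset.mem_insert]
    constructor
    · exact fun h => h.1
    · rintro (rfl | rfl)
      · exact ⟨Or.inl rfl, by omega⟩
      · exact ⟨Or.inr rfl, h3⟩
  have hne : x ≠ x' := fun h => by rw [← h] at h2; omega
  rw [f1, f2, Finset.card_singleton, Finset.card_pair hne] at heq
  revert heq
  decide

end Comp

namespace Diagram

variable {k l m n : ℕ}

/-- The `(l, n)`-diagram `[D ∘ E]`: glue along the middle bar, join the arcs, drop closed loops. -/
noncomputable def comp (D : Diagram l m) (E : Diagram m n) : Diagram l n where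
  partner := compPartner D E
  partner_partner x := by
    obtain ⟨h1, h2⟩ := (compPartner_eq_iff D E x _).1 rfl
    exact (compPartner_eq_iff D E _ x).2 ⟨h1.symm, (joined D E).symm h2⟩
  partner_ne x := ((compPartner_eq_iff D E x _).1 rfl).1
  noncrossing := comp_noncrossing D E

/-- The number of closed loops created when gluing `D` and `E`: the number of connected components
of the glued picture that do not meet the outer bars. -/
noncomputable def loops (D : Diagram l m) (E : Diagram m n) : ℕ :=
  Nat.card {c : Quotient (joined D E) // ∀ x, c ≠ Quotient.mk (joined D E) (outer x)}

/-- The mirror image. -/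
def mirror (D : Diagram m n) : Diagram n m where
  partner x := (D.partner x.swap).swap
  partner_partner x := by simp [D.partner_partner]
  partner_ne x h := D.partner_ne x.swap (by rw [← Sum.swap_swap (D.partner _), h])
  noncrossing := by
    have hs : ∀ x : Fin m ⊕ Fin n, bpos x.swap + bpos x + 1 = m + n := by
      rintro (x | x) <;> have := x.2 <;> simp only [Sum.swap_inl, Sum.swap_inr, bpos] <;> omega
    intro x y ⟨h1, h2, h3⟩
    have a1 := hs x.swap
    have a2 := hs y.swap
    have a3 := hs (D.partner x.swap)
    have a4 := hs (D.partner y.swap)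
    rw [Sum.swap_swap] at a1 a2
    have := D.noncrossing (D.partner y.swap) (D.partner x.swap)
    rw [D.partner_partner, D.partner_partner] at this
    exact this ⟨by omega, by omega, by omega⟩

/-- The diagram whose only cup is the left cup joining the nodes `j` and `j + 1`
(nodes numbered from `0`); it is `L_{j + 1}` when nodes are numbered from `1`. -/
def leftCup (m j : ℕ) (hj : j ≤ m) : Diagram (m + 2) m where
  partner
    | Sum.inl x =>
      if h1 : (x : ℕ) < j then Sum.inr ⟨x, by omega⟩
      else if h2 : (x : ℕ) = j then Sum.inl ⟨j + 1, by omega⟩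
      else if h3 : (x : ℕ) = j + 1 then Sum.inl ⟨j, by omega⟩
      else Sum.inr ⟨x - 2, by omega⟩
    | Sum.inr x =>
      if (x : ℕ) < j then Sum.inl ⟨x, by omega⟩ else Sum.inl ⟨x + 2, by omega⟩
  partner_partner := by
    rintro (x | x) <;> dsimp only <;> split_ifs <;> dsimp only <;> split_ifs <;>
      first
        | omega
        | (simp only [Sum.inl.injEq, Sum.inr.injEq, Fin.ext_iff]; omega)
        | rfl
  partner_ne := by
    rintro (x | x) <;> dsimp only <;> split_ifs <;>
      simp only [ne_eq, Sum.inl.injEq, Fin.ext_iff, reduceCtorEq, not_false_eq_true] <;> omega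
  noncrossing := by
    rintro (x | x) (y | y) <;> dsimp only <;> split_ifs <;> simp only [bpos] <;> omega

/-- `R_{j + 1}`, the mirror image of `L_{j + 1}`. -/
def rightCup (m j : ℕ) (hj : j ≤ m) : Diagram m (m + 2) := (leftCup m j hj).mirror

/-- `L_max`: the `(2 i, 0)`-diagram joining `0` to `1`, `2` to `3`, and so on. -/
def leftMax (i : ℕ) : Diagram (2 * i) 0 where
  partner
    | Sum.inl x =>
      if h : (x : ℕ) % 2 = 0 then Sum.inl ⟨x + 1, by omega⟩ else Sum.inl ⟨x - 1, by omega⟩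
    | Sum.inr x => x.elim0
  partner_partner := by
    rintro (x | x)
    · dsimp only; split_ifs <;> dsimp only <;> split_ifs <;>
        simp only [Sum.inl.injEq, Fin.ext_iff] <;> omega
    · exact x.elim0
  partner_ne := by
    rintro (x | x)
    · dsimp only; split_ifs <;> simp only [ne_eq, Sum.inl.injEq, Fin.ext_iff] <;> omega
    · exact x.elim0
  noncrossing := by
    rintro (x | x) (y | y)
    · dsimp only; split_ifs <;> simp only [bpos] <;> omega
    · exact y.elim0
    · exact x.elim0
    · exact x.elim0

/-- The nodes `j` and `j + 1` of the right bar are joined by a (necessarily innermost) cup. -/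
def IsInnermostRightCup (D : Diagram m n) (j : Fin n) : Prop :=
  ∃ h : (j : ℕ) + 1 < n, D.partner (Sum.inr j) = Sum.inr ⟨j + 1, h⟩

/-- No two nodes of the right bar are joined. -/
def NoRightCup (D : Diagram m n) : Prop :=
  ∀ j k, D.partner (Sum.inr j) ≠ Sum.inr k

theorem comp_partner_inr (D : Diagram l m) (E : Diagram m n) {j k : Fin n}
    (h : E.partner (Sum.inr j) = Sum.inr k) : (D.comp E).partner (Sum.inr j) = Sum.inr k := by
  refine (compPartner_eq_iff D E _ _).2 ⟨fun h' => E.partner_ne (Sum.inr j) ?_, ?_⟩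
  · rw [h, Sum.inr.inj h']
  · refine Relation.EqvGen.rel _ _ (Or.inr ?_)
    simp [outer, stepSecond, h]

theorem IsInnermostRightCup.comp (D : Diagram l m) {E : Diagram m n} {j : Fin n}
    (h : E.IsInnermostRightCup j) : (D.comp E).IsInnermostRightCup j :=
  ⟨h.1, comp_partner_inr D E h.2⟩

end Diagram

/-! ### Modules over the Temperley-Lieb category -/

section Modules

variable (R : Type*) [CommRing R]

/-- Data of a free left module over the Temperley-Lieb category: a basis `B m` for every object
`m`, the action of diagrams on basis elements, and, for the weight grading, a way of closing a
basis element off on the right, together with the number of closed loops that this creates. -/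
structure TLData where
  B : ℕ → Type
  act : ∀ {k m : ℕ}, Diagram k m → B m → (B k →₀ R)
  close : ∀ {m : ℕ}, B m → Diagram m 0
  closeLoops : ∀ {m : ℕ}, B m → ℕ

variable {R} (a : R)

/-- `m ↦ TL(m, 0)`. -/
noncomputable def emptyData : TLData R where
  B m := Diagram m 0
  act D E := Finsupp.single (D.comp E) (a ^ D.loops E)
  close E := E
  closeLoops _ := 0

/-- Diagrams in `TL(m, 2i)` with a set of dashed innermost right cups. A cup is recorded by its
lower node. -/
def Dashed (i m : ℕ) : Type :=
  {x : Diagram m (2 * i) × Finset (Fin (2 * i)) // ∀ j ∈ x.2, x.1.IsInnermostRightCup j}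

/-- The underlying diagram. -/
def Dashed.diagram {i m : ℕ} (x : Dashed i m) : Diagram m (2 * i) := x.1.1

/-- The set of dashed cups. -/
def Dashed.dashes {i m : ℕ} (x : Dashed i m) : Finset (Fin (2 * i)) := x.1.2

/-- `m ↦ ⨁_p Inn_p(m, 2i)`, where `Inn_p(m, 2i)` is spanned by the diagrams with `p` dashed
innermost right cups; composition keeps the dashed cups. -/
noncomputable def innData (i : ℕ) : TLData R where
  B := Dashed i
  act D x := Finsupp.single
    ⟨(D.comp x.diagram, x.dashes), fun j hj => (x.2 j hj).comp D⟩ (a ^ D.loops x.diagram)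
  close x := x.diagram.comp (Diagram.leftMax i)
  closeLoops x := x.diagram.loops (Diagram.leftMax i)

/-- The basis of the cell module `S(m, 2i)`: the diagrams in `TL(m, 2i)` without right cups. -/
def CellBasis (i m : ℕ) : Type := {D : Diagram m (2 * i) // D.NoRightCup}

open Classical in
/-- `m ↦ S(m, 2i)`, the quotient of `TL(m, 2i)` by the span of the diagrams with a right cup. -/
noncomputable def cellData (i : ℕ) : TLData R where
  B := CellBasis i
  act D x := if h : (D.comp x.1).NoRightCup then Finsupp.single ⟨_, h⟩ (a ^ D.loops x.1) else 0
  close x := x.1.comp (Diagram.leftMax i)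
  closeLoops x := x.1.loops (Diagram.leftMax i)

/-- The differential of the complex of innermost cups: the alternating sum over the dashed cups,
from bottom to top, of un-dashing. -/
noncomputable def undash {i m : ℕ} (x : Dashed i m) : Dashed i m →₀ R :=
  ∑ j ∈ x.dashes, Finsupp.single
    ⟨(x.diagram, x.dashes.erase j), fun k hk => x.2 k (Finset.mem_of_mem_erase hk)⟩
    ((-1) ^ (x.dashes.filter (· < j)).card)

end Modules

/-! ### The augmented bar construction -/

/-- The basis of the augmented bar construction `D(X, Y)` for `X = M(2n)`, `Y = M(0)`:
`base y` is in degree `0`, and `bar D [D₁, …, D_{q-1}] x`, which stands for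
`(D | D₁ | … | D_{q-1} | x)`, is in degree `q > 0`. For `n = 0` there is nothing in positive
degrees, so that `L(0) = TL(0, 0)` is concentrated in degree `0`. -/
inductive Chain (B : ℕ → Type) (n : ℕ) : Type
  | base (y : B 0) : Chain B n
  | bar (hn : 0 < n) (D : Diagram 0 (2 * n)) (w : List (Diagram (2 * n) (2 * n)))
      (x : B (2 * n)) : Chain B n

/-- The homological degree. -/
def Chain.deg {B : ℕ → Type} {n : ℕ} : Chain B n → ℕ
  | .base _ => 0
  | .bar _ _ w _ => w.length + 1

/-- The basis of the dga of planar loops `L(2n)`: systems of pinned planar loops. -/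
abbrev LoopBasis (n : ℕ) : Type := Chain (fun m => Diagram m 0) n

/-- The number of closed loops formed by `(D | D₁ | … | D_{q-1} | E)`. -/
noncomputable def loopsAlong {n : ℕ} :
    Diagram 0 (2 * n) → List (Diagram (2 * n) (2 * n)) → Diagram (2 * n) 0 → ℕ
  | D, [], E => D.loops E
  | D, A :: w, E => D.loops A + loopsAlong (D.comp A) w E

section Bar

variable {R : Type*} [CommRing R] (a : R)

/-- The number of loops formed by a basis element after closing it off on the right. -/
noncomputable def Chain.wt (M : TLData R) {n : ℕ} : Chain M.B n → ℕ
  | .base y => M.closeLoops y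
  | .bar _ D w x => M.closeLoops x + loopsAlong D w (M.close x)

/-- On `(D₁ | … | D_{q-1} | x)`, the alternating sum (starting with `+`) of the face maps that
multiply two neighbours. -/
noncomputable def tailD (M : TLData R) {n : ℕ} :
    List (Diagram (2 * n) (2 * n)) → M.B (2 * n) →
      (List (Diagram (2 * n) (2 * n)) × M.B (2 * n) →₀ R)
  | [], _ => 0
  | [A], x => (M.act A x).mapDomain fun y => ([], y)
  | A :: A' :: w, x =>
      Finsupp.single (A.comp A' :: w, x) (a ^ A.loops A') -
        (tailD M (A' :: w) x).mapDomain fun p => (A :: p.1, p.2)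

/-- The differential on basis elements:
`(D₀ | … | D_q) ↦ ∑_{0 ≤ j < q} (-1)^j (D₀ | … | D_j D_{j+1} | … | D_q)`. -/
noncomputable def chainD (M : TLData R) {n : ℕ} : Chain M.B n → (Chain M.B n →₀ R)
  | .base _ => 0
  | .bar _ D [] x => (M.act D x).mapDomain .base
  | .bar hn D (A :: w) x =>
      Finsupp.single (.bar hn (D.comp A) w x) (a ^ D.loops A) -
        (tailD a M (A :: w) x).mapDomain fun p => .bar hn D p.1 p.2

/-- The action of `L(2n)` on basis elements: juxtaposition, multiplying the two neighbours
`TL(2n, 0) ⊗ TL(0, 2n) → TL(2n, 2n)`, respectively `TL(2n, 0) ⊗ M(0) → M(2n)`. In degree `0` the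
algebra `L(2n)` is `TL(0, 0)`, spanned by the empty diagram, which acts as the identity. -/
noncomputable def chainAct (M : TLData R) {n : ℕ} :
    LoopBasis n → Chain M.B n → (Chain M.B n →₀ R)
  | .base _, y => Finsupp.single y 1
  | .bar hn D w E, .base y => (M.act E y).mapDomain (.bar hn D w)
  | .bar hn D w E, .bar _ D' w' x =>
      Finsupp.single (.bar hn D (w ++ E.comp D' :: w') x) (a ^ E.loops D')

/-- The map of augmented bar constructions induced by a map of coefficients. -/
noncomputable def chainMap {B B' : ℕ → Type} (n : ℕ) (f : ∀ m, B m → (B' m →₀ R)) :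
    Chain B n → (Chain B' n →₀ R)
  | .base y => (f 0 y).mapDomain .base
  | .bar hn D w x => (f (2 * n) x).mapDomain (.bar hn D w)

/-- The hook map on basis elements:
`(D₀ | D₁ | … | D_{q-1} | x) ↦ (D₀ R₁ | L₂ D₁ R₁ | … | L₂ D_{q-1} R₁ | L₂ x)`. -/
noncomputable def chainHook (M : TLData R) {n : ℕ} :
    Chain M.B n → (Chain M.B (n + 1) →₀ R)
  | .base y => Finsupp.single (.base y) 1
  | .bar hn D w x =>
      let R₁ : Diagram (2 * n) (2 * (n + 1)) := Diagram.rightCup (2 * n) 0 (Nat.zero_le _)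
      let L₂ : Diagram (2 * (n + 1)) (2 * n) := Diagram.leftCup (2 * n) 1 (by omega)
      a ^ (D.loops R₁ + (w.map fun A => L₂.loops A + (L₂.comp A).loops R₁).sum) •
        (M.act L₂ x).mapDomain
          (.bar (Nat.succ_pos n) (D.comp R₁) (w.map fun A => (L₂.comp A).comp R₁))

end Bar

/-! ### Differential bigraded modules over the dga of planar loops -/

section DG

variable (R : Type*) [CommRing R]

/-- The data of a differential graded `L(2n)`-module that is free over `R` on a basis of elements
with a homological degree and a number of loops. -/
structure DGData (n : ℕ) where
  Basis : Type
  deg : Basis → ℕ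
  wt : Basis → ℕ
  d : (Basis →₀ R) →ₗ[R] (Basis →₀ R)
  act : (LoopBasis n →₀ R) →ₗ[R] (Basis →₀ R) →ₗ[R] (Basis →₀ R)

variable {R}

/-- The underlying `R`-module. -/
abbrev DGData.Carrier {n : ℕ} (M : DGData R n) : Type _ := M.Basis →₀ R

/-- The elements that are homogeneous of degree `k`. -/
noncomputable def DGData.degPart {n : ℕ} (M : DGData R n) (k : ℕ) : AddSubgroup M.Carrier :=
  (Finsupp.supported R R {b | M.deg b = k}).toAddSubgroup

/-- The elements that are homogeneous of weight `w`, for a ring `R` that is graded by `𝒜`: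
a basis element with `ℓ` loops times a scalar of rank `j` has weight `j + ℓ`. -/
noncomputable def DGData.wtPart {n : ℕ} (M : DGData R n) (𝒜 : ℕ → AddSubgroup R) (w : ℕ) :
    AddSubgroup M.Carrier :=
  AddSubgroup.closure {x | ∃ b j, ∃ r ∈ 𝒜 j, j + M.wt b = w ∧ x = Finsupp.single b r}

/-- The augmented bar construction applied to a module over the Temperley-Lieb category. -/
noncomputable def barDG (a : R) (M : TLData R) (n : ℕ) : DGData R n where
  Basis := Chain M.B n
  deg := Chain.deg
  wt := Chain.wt M
  d := Finsupp.linearCombination R (chainD a M)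
  act := Finsupp.linearCombination R fun r => Finsupp.linearCombination R (chainAct a M r)

/-- The dga of planar loops `L(2n)` as a module over itself. -/
noncomputable def loopDG (a : R) (n : ℕ) : DGData R n := barDG a (emptyData a) n

/-- The derived cell module `DS(2n, 2i)`. -/
noncomputable def cellDG (a : R) (n i : ℕ) : DGData R n := barDG a (cellData a i) n

/-- The bigraded suspension `Σ^{i,i}`. The degree is raised by `i`, with the signs `(-1)^i` in the
differential and `(-1)^(i |r|)` in the action of `r`, and the weight is raised by `i`. Disregarding
weights this is `Σ^i`. -/
noncomputable def DGData.susp {n : ℕ} (i : ℕ) (M : DGData R n) : DGData R n where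
  Basis := M.Basis
  deg b := M.deg b + i
  wt b := M.wt b + i
  d := (-1 : R) ^ i • M.d
  act := Finsupp.linearCombination R fun r =>
    (-1 : R) ^ (i * r.deg) • M.act (Finsupp.single r 1)

/-- The number `p` of dashed cups of a basis element of `⨁_p DInn_p(2n, 2i)`. -/
def dashCount {i n : ℕ} : Chain (Dashed i) n → ℕ
  | .base y => y.dashes.card
  | .bar _ _ _ x => x.dashes.card

/-- The totalisation `[DInn_0(2n, 2i) ← DInn_1(2n, 2i) ← ⋯ ← DInn_i(2n, 2i)]` of the derived complex
of innermost cups: on `DInn_p` the differential is `δ + (-1)^p d`, and the action of `r`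
carries the sign `(-1)^(p |r|)`. -/
noncomputable def innDG (a : R) (n i : ℕ) : DGData R n where
  Basis := Chain (innData a i).B n
  deg b := b.deg + dashCount b
  wt := Chain.wt (innData a i)
  d := Finsupp.linearCombination R fun b =>
    chainMap (B' := (innData a i).B) n (fun _ => undash) b +
      (-1 : R) ^ dashCount b • chainD a (innData a i) b
  act := Finsupp.linearCombination R fun r => Finsupp.linearCombination R fun b =>
    (-1 : R) ^ (dashCount b * r.deg) • chainAct a (innData a i) r b

open Classical in
/-- The augmentation: a diagram without dashed cups goes to its class in the cell module, diagrams
with dashed cups go to `0`. -/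
noncomputable def toCell (a : R) (n i : ℕ) :
    (innDG a n i).Carrier →ₗ[R] (cellDG a n i).Carrier :=
  Finsupp.linearCombination R <| chainMap (B := Dashed i) (B' := CellBasis i) n fun _ x =>
    if h : x.dashes = ∅ ∧ x.diagram.NoRightCup then Finsupp.single ⟨x.diagram, h.2⟩ 1 else 0

/-- The projection onto `DInn_i(2n, 2i)`, followed by the identification of `Inn_i(m, 2i)` with
`TL(m, 0)` that deletes the `i` dashed cups (joining all these cups to `L_max` turns them into
closed loops, which `comp` drops). -/
noncomputable def toSusp (a : R) (n i : ℕ) :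
    (innDG a n i).Carrier →ₗ[R] ((loopDG a n).susp i).Carrier :=
  Finsupp.linearCombination R <|
    chainMap (B := Dashed i) (B' := fun m => Diagram m 0) n fun _ x =>
      if x.dashes.card = i then Finsupp.single (x.diagram.comp (Diagram.leftMax i)) 1 else 0

/-- The hook map `L(2n) → L(2n+2)`, which is also the map underlying `Σ^{i,i} h`. -/
noncomputable def loopHook (a : R) (n : ℕ) :
    (loopDG a n).Carrier →ₗ[R] (loopDG a (n + 1)).Carrier :=
  Finsupp.linearCombination R (chainHook a (emptyData a))

/-- The suspended hook map `Σ^{i,i} L(2n) → Σ^{i,i} L(2n+2)`. -/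
noncomputable def suspHook (a : R) (n i : ℕ) :
    ((loopDG a n).susp i).Carrier →ₗ[R] ((loopDG a (n + 1)).susp i).Carrier :=
  loopHook a n

/-- The hook map `DS(2n, 2i) → DS(2n+2, 2i)`. -/
noncomputable def cellHook (a : R) (n i : ℕ) :
    (cellDG a n i).Carrier →ₗ[R] (cellDG a (n + 1) i).Carrier :=
  Finsupp.linearCombination R (chainHook a (cellData a i))

/-- The hook map on the totalised derived complexes of innermost cups; dashed cups are kept. -/
noncomputable def innHook (a : R) (n i : ℕ) :
    (innDG a n i).Carrier →ₗ[R] (innDG a (n + 1) i).Carrier :=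
  Finsupp.linearCombination R (chainHook a (innData a i))

/-- `M` is a differential graded left module over the dga `L(2n)`. For `M = L(2n)` this contains the
laws of the dga. -/
structure IsDGModule (a : R) {n : ℕ} (M : DGData R n) : Prop where
  d_deg : ∀ k, ∀ x ∈ M.degPart (k + 1), M.d x ∈ M.degPart k
  d_deg_zero : ∀ x ∈ M.degPart 0, M.d x = 0
  d_d : ∀ x, M.d (M.d x) = 0
  act_deg : ∀ j k, ∀ r ∈ (loopDG a n).degPart j, ∀ x ∈ M.degPart k, M.act r x ∈ M.degPart (j + k)
  one_act : ∀ (e : Diagram 0 0) (x), M.act (Finsupp.single (.base e) 1) x = x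
  mul_act : ∀ r s x, M.act ((loopDG a n).act r s) x = M.act r (M.act s x)
  leibniz : ∀ j, ∀ r ∈ (loopDG a n).degPart j, ∀ x,
    M.d (M.act r x) = M.act ((loopDG a n).d r) x + (-1 : R) ^ j • M.act r (M.d x)

/-- The differential preserves weights and the action of `L(2n)` adds them. -/
structure IsBigradedDGModule (a : R) (𝒜 : ℕ → AddSubgroup R) {n : ℕ} (M : DGData R n) : Prop
    extends IsDGModule a M where
  d_wt : ∀ w, ∀ x ∈ M.wtPart 𝒜 w, M.d x ∈ M.wtPart 𝒜 w
  act_wt : ∀ v w, ∀ r ∈ (loopDG a n).wtPart 𝒜 v, ∀ x ∈ M.wtPart 𝒜 w,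
    M.act r x ∈ M.wtPart 𝒜 (v + w)

/-- Given subgroups of cycles-to-be `S` and boundaries-to-be `S'` in the source, and `T`, `T'` in
the target: `f` induces a bijection from `{x ∈ S | dx = 0} / {dc ∈ S | c ∈ S'}` to
`{y ∈ T | dy = 0} / {db ∈ T | b ∈ T'}`. -/
def HomologyBijective {n : ℕ} {M N : DGData R n} (f : M.Carrier →ₗ[R] N.Carrier)
    (S S' : AddSubgroup M.Carrier) (T T' : AddSubgroup N.Carrier) : Prop :=
  (∀ x ∈ S, M.d x = 0 → (∃ b ∈ T', N.d b = f x) → ∃ c ∈ S', M.d c = x) ∧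
  (∀ y ∈ T, N.d y = 0 → ∃ x ∈ S, M.d x = 0 ∧ ∃ b ∈ T', N.d b = y - f x)

/-- `f` is a quasi-isomorphism of differential graded `L(2n)`-modules. -/
structure IsQuasiIso {n : ℕ} {M N : DGData R n} (f : M.Carrier →ₗ[R] N.Carrier) : Prop where
  map_deg : ∀ k, ∀ x ∈ M.degPart k, f x ∈ N.degPart k
  map_d : ∀ x, f (M.d x) = N.d (f x)
  map_act : ∀ r x, f (M.act r x) = N.act r (f x)
  homology : ∀ k, HomologyBijective f (M.degPart k) (M.degPart (k + 1))
    (N.degPart k) (N.degPart (k + 1))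

/-- `f` is a quasi-isomorphism of differential bigraded `L(2n)`-modules. -/
structure IsBigradedQuasiIso (𝒜 : ℕ → AddSubgroup R) {n : ℕ} {M N : DGData R n}
    (f : M.Carrier →ₗ[R] N.Carrier) : Prop extends IsQuasiIso f where
  map_wt : ∀ w, ∀ x ∈ M.wtPart 𝒜 w, f x ∈ N.wtPart 𝒜 w
  homology_wt : ∀ k w, HomologyBijective f
    (M.degPart k ⊓ M.wtPart 𝒜 w) (M.degPart (k + 1) ⊓ M.wtPart 𝒜 w)
    (N.degPart k ⊓ N.wtPart 𝒜 w) (N.degPart (k + 1) ⊓ N.wtPart 𝒜 w)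

/-- `f` is a map of differential graded modules along the hook map `L(2n) → L(2n+2)`, that is, a map
of `L(2n)`-modules to the restriction of the target along the hook map. -/
structure IsHookLinear (a : R) {n : ℕ} {M : DGData R n} {N : DGData R (n + 1)}
    (f : M.Carrier →ₗ[R] N.Carrier) : Prop where
  map_deg : ∀ k, ∀ x ∈ M.degPart k, f x ∈ N.degPart k
  map_d : ∀ x, f (M.d x) = N.d (f x)
  map_act : ∀ r x, f (M.act r x) = N.act (loopHook a n r) (f x)

/-- Moreover, `f` preserves weights. -/
structure IsBigradedHookLinear (a : R) (𝒜 : ℕ → AddSubgroup R) {n : ℕ} {M : DGData R n}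
    {N : DGData R (n + 1)} (f : M.Carrier →ₗ[R] N.Carrier) : Prop extends IsHookLinear a f where
  map_wt : ∀ w, ∀ x ∈ M.wtPart 𝒜 w, f x ∈ N.wtPart 𝒜 w

end DG

end PlanarLoops

open PlanarLoops

/-! `T(2n, 2i)` is a double complex: one direction is the number `p` of dashed cups with the
differential `δ`, the other the bar degree with the differential `d`. The two maps of the zig-zag
are its edge maps, and each is an equivalence because the complex is exact in one of the directions.

Direction `δ`: the part of `Inn_*(m, 2i)` that belongs to a fixed diagram is the augmented chain
complex of the full simplex on its innermost right cups. It is contractible as soon as there is such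
a cup, and by planarity a diagram with any right cup has an innermost one. Hence `Inn_*(m, 2i)`
resolves the cell module (`undash_dashFirst`).

Direction `d`: fewer than `i` dashed cups leave some of the `2i` nodes off the dashed cups, and next
to such a node cups can be straightened. This yields diagrams `U` and `V`, depending only on the set
of dashes, with `x = (xU)V` and without loops (`exists_splitting`); they pass through `2n` nodes,
which is where `i ≤ n` enters. The operator `(D₀|…|x) ↦ ±(D₀|…|xU|V)` contracts `DInn_p` for `p < i`
(`barDiff_barSplit`). For `p = i` the dashed cups are forced to be the mirror image of `L_max`;
deleting them identifies `DInn_i` with `L(2n)`, and the `i` loops that they form with `L_max`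
account for the shift of weights.

In place of a spectral sequence there is a reduction lemma (`exists_primitive`): given `Dh + hD = 1
- sf - e` where `f` is a chain map, `fs = 1`, `fh = 0` and `e` strictly lowers a filtration, `f` is
bijective on homology. The filtration is the bar degree for the cell module and the number of dashes
for the suspension. Since the maps and differentials are homogeneous, projecting to a bidegree gives
the bigraded statement.

The algebra rests on associativity of composition and on the cocycle identity for numbers of loops,
both read off from three diagrams glued together (`Diagram.comp_assoc`, `loops_cocycle`). The three
modules are special cases of one twisted bar construction, so their signs are checked only once. The
hook maps respect everything because the zig-zag `R₁L₂` straightens to the identity. -/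

namespace PlanarLoops

/-! ### Gluing along a common boundary -/

section Amalgam

/-- The components of `V` with respect to `q`, when `V` is glued from `A` and `B` along the common
boundary `Y`, and `sA`, `sB` record which points of `A`, respectively of `B`, are connected. -/
structure IsAmalgam {V A B Y : Type} (ι : A → V) (e : B → V) (oB : Y → B) (t : Y → A)
    (q : V → V → Prop) (sA : Setoid A) (sB : Setoid B) : Prop where
  left_inj : Function.Injective ι
  right_inj : Function.Injective e
  cover : ∀ v, (∃ a, v = ι a) ∨ ∃ b, v = e b
  boundary : ∀ y, e (oB y) = ι (t y)
  overlap : ∀ a b, ι a = e b → ∃ y, b = oB y ∧ a = t y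
  of_left : ∀ a a', sA a a' → Relation.EqvGen q (ι a) (ι a')
  of_right : ∀ b b', sB b b' → Relation.EqvGen q (e b) (e b')
  gen : ∀ u v, q u v → (∃ a a', u = ι a ∧ v = ι a' ∧ sA a a') ∨
    ∃ b b', u = e b ∧ v = e b' ∧ sB b b'
  -- The condition is one-sided: connections inside `B` between boundary points are already visible
  -- in `A`. In the application `A` contains the arcs of a composite, and `B` is the picture from
  -- which this composite was computed.
  compat : ∀ y y', sB (oB y) (oB y') → sA (t y) (t y')

namespace IsAmalgam

variable {V A B Y X : Type} {ι : A → V} {e : B → V} {oB : Y → B} {t : Y → A}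
  {q : V → V → Prop} {sA : Setoid A} {sB : Setoid B}

/-- `u` is connected to the point `a` of `A`. -/
def Reach (ι : A → V) (e : B → V) (oB : Y → B) (t : Y → A) (sA : Setoid A) (sB : Setoid B)
    (u : V) (a : A) : Prop :=
  (∃ a', u = ι a' ∧ sA a' a) ∨ ∃ b y, u = e b ∧ sB b (oB y) ∧ sA (t y) a

/-- `u` lies in `B` on the component of `b`, and this component does not meet `A`. -/
def Inside (e : B → V) (oB : Y → B) (sB : Setoid B) (u : V) (b : B) : Prop :=
  ∃ b', u = e b' ∧ sB b' b ∧ ∀ y, ¬ sB b (oB y)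

variable (h : IsAmalgam ι e oB t q sA sB)
include h

theorem reach_left (a a' : A) : Reach ι e oB t sA sB (ι a) a' ↔ sA a a' := by
  constructor
  · rintro (⟨a₁, h1, h2⟩ | ⟨b, y, h1, h2, h3⟩)
    · rwa [h.left_inj h1]
    · obtain ⟨y', rfl, rfl⟩ := h.overlap _ _ h1
      exact sA.trans (h.compat _ _ h2) h3
  · exact fun h' => Or.inl ⟨a, rfl, h'⟩

theorem not_inside_left (a : A) (b : B) : ¬ Inside e oB sB (ι a) b := by
  rintro ⟨b', h1, h2, h3⟩
  obtain ⟨y', rfl, rfl⟩ := h.overlap _ _ h1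
  exact h3 _ (sB.symm h2)

theorem inside_right (b b' : B) :
    Inside e oB sB (e b) b' ↔ sB b b' ∧ ∀ y, ¬ sB b' (oB y) := by
  constructor
  · rintro ⟨b₁, h1, h2⟩
    rwa [h.right_inj h1]
  · exact fun h' => ⟨b, rfl, h'⟩

theorem reach_right (b : B) (a : A) :
    Reach ι e oB t sA sB (e b) a ↔ ∃ y, sB b (oB y) ∧ sA (t y) a := by
  constructor
  · rintro (⟨a₁, h1, h2⟩ | ⟨b', y, h1, h2, h3⟩)
    · obtain ⟨y', rfl, rfl⟩ := h.overlap _ _ h1.symm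
      exact ⟨y', sB.refl _, h2⟩
    · rw [h.right_inj h1]
      exact ⟨y, h2, h3⟩
  · rintro ⟨y, h1, h2⟩
    exact Or.inr ⟨b, y, rfl, h1, h2⟩

/-- A component of `V` either meets `A`, and is then recorded by `Reach`, or stays inside `B`, and
is then recorded by `Inside`. Since both predicates are constant along the generating relation, they
bound the generated equivalence relation from above. -/
theorem invariant {u v : V} (huv : Relation.EqvGen q u v) :
    (∀ a, Reach ι e oB t sA sB u a ↔ Reach ι e oB t sA sB v a) ∧
      ∀ b, Inside e oB sB u b ↔ Inside e oB sB v b := by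
  induction huv with
  | rel u v huv =>
    rcases h.gen u v huv with ⟨a, a', rfl, rfl, haa⟩ | ⟨b, b', rfl, rfl, hbb⟩
    · refine ⟨fun a₁ => ?_, fun b => ?_⟩
      · rw [h.reach_left, h.reach_left]
        exact ⟨fun h' => sA.trans (sA.symm haa) h', fun h' => sA.trans haa h'⟩
      · exact iff_of_false (h.not_inside_left _ _) (h.not_inside_left _ _)
    · refine ⟨fun a₁ => ?_, fun b => ?_⟩
      · rw [h.reach_right, h.reach_right]
        exact exists_congr fun y => and_congr_left fun _ =>
          ⟨fun h' => sB.trans (sB.symm hbb) h', fun h' => sB.trans hbb h'⟩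
      · rw [h.inside_right, h.inside_right]
        exact and_congr_left fun _ =>
          ⟨fun h' => sB.trans (sB.symm hbb) h', fun h' => sB.trans hbb h'⟩
  | refl u => exact ⟨fun _ => Iff.rfl, fun _ => Iff.rfl⟩
  | symm u v _ ih => exact ⟨fun a => (ih.1 a).symm, fun b => (ih.2 b).symm⟩
  | trans u v w _ _ ih1 ih2 =>
    exact ⟨fun a => (ih1.1 a).trans (ih2.1 a), fun b => (ih1.2 b).trans (ih2.2 b)⟩

/-- Detours through `B` join no new points of `A`: this is the effect of `compat`, by way of
`Reach`. -/
theorem eqvGen_left (a a' : A) : Relation.EqvGen q (ι a) (ι a') ↔ sA a a' := by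
  refine ⟨fun h' => ?_, h.of_left a a'⟩
  rw [← h.reach_left, (h.invariant h').1 a', h.reach_left]

/-- The components that do not meet a part of the boundary of `A` are those of `A` and the
components of `B` that do not meet `A`. -/
theorem card_components [Finite A] [Finite B] (o : X → A) :
    Nat.card {c : Quotient (Relation.EqvGen.setoid q) // ∀ x, c ≠ Quotient.mk _ (ι (o x))} =
      Nat.card {c : Quotient sA // ∀ x, c ≠ Quotient.mk _ (o x)} +
        Nat.card {c : Quotient sB // ∀ y, c ≠ Quotient.mk _ (oB y)} := by
  rw [← Nat.card_sum]
  have hι : ∀ c : Quotient sA, (∀ x, c ≠ Quotient.mk _ (o x)) → ∀ x,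
      Quotient.map' (s₂ := Relation.EqvGen.setoid q) ι (fun a a' h' => h.of_left a a' h') c ≠
        Quotient.mk _ (ι (o x)) := by
    intro c hc x hx
    induction c using Quotient.inductionOn with | h a => ?_
    exact hc x (Quotient.sound ((h.eqvGen_left _ _).1 (Quotient.exact hx)))
  have he : ∀ c : Quotient sB, (∀ y, c ≠ Quotient.mk _ (oB y)) → ∀ x,
      Quotient.map' (s₂ := Relation.EqvGen.setoid q) e (fun b b' h' => h.of_right b b' h') c ≠
        Quotient.mk _ (ι (o x)) := by
    intro c hc x hx
    induction c using Quotient.inductionOn with | h b => ?_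
    have h1 := (h.invariant (Quotient.exact hx)).2 b
    rw [h.inside_right] at h1
    exact h.not_inside_left _ _ (h1.1 ⟨sB.refl b, fun y hy => hc y (Quotient.sound hy)⟩)
  refine (Nat.card_congr (Equiv.ofBijective (Sum.elim (fun c => ⟨_, hι c.1 c.2⟩)
    (fun c => ⟨_, he c.1 c.2⟩)) ⟨?_, ?_⟩)).symm
  · rintro (⟨c, hc⟩ | ⟨c, hc⟩) (⟨c', hc'⟩ | ⟨c', hc'⟩) heq <;>
    induction c using Quotient.inductionOn with | h b => ?_ <;>
    induction c' using Quotient.inductionOn with | h b' => ?_ <;>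
    have heq := Quotient.exact (congrArg Subtype.val heq)
    · congr 2
      exact Quotient.sound ((h.eqvGen_left _ _).1 heq)
    · have h1 := (h.invariant heq).2 b'
      rw [h.inside_right] at h1
      exact absurd (h1.2 ⟨sB.refl _, fun y hy => hc' y (Quotient.sound hy)⟩)
        (h.not_inside_left _ _)
    · have h1 := (h.invariant heq).2 b
      rw [h.inside_right] at h1
      exact absurd (h1.1 ⟨sB.refl _, fun y hy => hc y (Quotient.sound hy)⟩)
        (h.not_inside_left _ _)
    · congr 2
      have h1 := (h.invariant heq).2 b'
      rw [h.inside_right, h.inside_right] at h1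
      exact Quotient.sound (h1.2 ⟨sB.refl _, fun y hy => hc' y (Quotient.sound hy)⟩).1
  · rintro ⟨c, hc⟩
    induction c using Quotient.inductionOn with | h v => ?_
    rcases h.cover v with ⟨a, rfl⟩ | ⟨b, rfl⟩
    · exact ⟨Sum.inl ⟨Quotient.mk _ a, fun x hx => hc x (Quotient.sound
        (h.of_left _ _ (Quotient.exact hx)))⟩, rfl⟩
    -- A component represented by a point of `B` is moved into `A` whenever it touches the common
    -- boundary; otherwise it is a component of `B` alone.
    · by_cases hb : ∃ y, sB b (oB y)
      · obtain ⟨y, hy⟩ := hb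
        have hby : Relation.EqvGen q (e b) (ι (t y)) := by
          rw [← h.boundary]
          exact h.of_right _ _ hy
        refine ⟨Sum.inl ⟨Quotient.mk _ (t y), fun x hx => hc x (Quotient.sound ?_)⟩, ?_⟩
        · exact Relation.EqvGen.trans _ _ _ hby (h.of_left _ _ (Quotient.exact hx))
        · exact Subtype.ext (Quotient.sound (Relation.EqvGen.symm _ _ hby))
      · exact ⟨Sum.inr ⟨Quotient.mk _ b, fun y hy => hb ⟨y, Quotient.exact hy⟩⟩, rfl⟩

end IsAmalgam

end Amalgam

/-! ### The Temperley-Lieb category -/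

section Category

variable {k l m n : ℕ}

theorem joined_first (D : Diagram l m) (E : Diagram m n) (x : Fin l ⊕ Fin m) :
    joined D E (inFirst x) (inFirst (D.partner x)) :=
  Relation.EqvGen.rel _ _ (Or.inl (stepFirst_inFirst D x).symm)

theorem joined_second (D : Diagram l m) (E : Diagram m n) (x : Fin m ⊕ Fin n) :
    joined D E (Sum.inr x) (Sum.inr (E.partner x)) :=
  Relation.EqvGen.rel _ _ (Or.inr rfl)

/-- The induction principle for connectedness: only the arcs have to be checked, because the walks
that stay put contribute reflexivity. -/
theorem joined_rec {D : Diagram l m} {E : Diagram m n} (r : Setoid (Glued l m n))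
    (hD : ∀ x, r (inFirst x) (inFirst (D.partner x)))
    (hE : ∀ x, r (Sum.inr x) (Sum.inr (E.partner x))) {u v : Glued l m n}
    (h : joined D E u v) : r u v := by
  induction h with
  | rel u v h =>
    rcases h with rfl | rfl
    · rcases u with u | u | u
      · exact hD (Sum.inl u)
      · exact hD (Sum.inr u)
      · exact r.refl _
    · rcases u with u | u
      · exact r.refl _
      · exact hE u
  | refl u => exact r.refl u
  | symm u v _ ih => exact r.symm ih
  | trans u v w _ _ ih1 ih2 => exact r.trans ih1 ih2

theorem joined_comp (D : Diagram l m) (E : Diagram m n) (x : Fin l ⊕ Fin n) :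
    joined D E (outer x) (outer ((D.comp E).partner x)) :=
  ((compPartner_eq_iff D E x _).1 rfl).2

theorem Diagram.comp_partner_eq_iff (D : Diagram l m) (E : Diagram m n) (x y : Fin l ⊕ Fin n) :
    (D.comp E).partner x = y ↔ y ≠ x ∧ joined D E (outer x) (outer y) :=
  compPartner_eq_iff D E x y

theorem joined_outer_iff (D : Diagram l m) (E : Diagram m n) (x y : Fin l ⊕ Fin n) :
    joined D E (outer x) (outer y) ↔ y = x ∨ (D.comp E).partner x = y := by
  rw [Diagram.comp_partner_eq_iff]
  by_cases h : y = x
  · simp [h]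
  · simp [h]

/-- The nodes of three diagrams glued along two middle bars. -/
abbrev Glued₃ (k l m n : ℕ) : Type := Fin k ⊕ Fin l ⊕ Fin m ⊕ Fin n

/-- The arcs of three diagrams glued along two middle bars. -/
def arcs₃ (D : Diagram k l) (E : Diagram l m) (F : Diagram m n) (u v : Glued₃ k l m n) : Prop :=
  (∃ x, u = Sum.map id Sum.inl x ∧ v = Sum.map id Sum.inl (D.partner x)) ∨
  (∃ x, u = Sum.inr (inFirst x) ∧ v = Sum.inr (inFirst (E.partner x))) ∨
  ∃ x, u = Sum.inr (Sum.inr x) ∧ v = Sum.inr (Sum.inr (F.partner x))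

/-- Here `D` and `E` are glued first. The picture of `D.comp E` and `F` plays the role of `A`, and
the picture of `D` and `E` is inserted along the end points of the composite. Condition `compat`
holds because a path of `D` and `E` between two end points has become a single arc of `D.comp E`. -/
theorem isAmalgam_left (D : Diagram k l) (E : Diagram l m) (F : Diagram m n) :
    IsAmalgam (V := Glued₃ k l m n) (Sum.map id Sum.inr : Glued k m n → _)
      (Sum.map id (Sum.map id Sum.inl) : Glued k l m → _) outer inFirst (arcs₃ D E F)
      (joined (D.comp E) F) (joined D E) := by
  have hB : ∀ b b', joined D E b b' → Relation.EqvGen (arcs₃ D E F)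
      (Sum.map id (Sum.map id Sum.inl) b) (Sum.map id (Sum.map id Sum.inl) b') := by
    intro b b' h
    refine joined_rec ((Relation.EqvGen.setoid (arcs₃ D E F)).comap
      (Sum.map id (Sum.map id Sum.inl))) (fun x => ?_) (fun x => ?_) h
    · refine Relation.EqvGen.rel _ _ (Or.inl ⟨x, ?_, ?_⟩)
      · rcases x with x | x <;> rfl
      · rcases D.partner x with x | x <;> rfl
    · refine Relation.EqvGen.rel _ _ (Or.inr (Or.inl ⟨x, ?_, ?_⟩))
      · rcases x with x | x <;> rfl
      · rcases E.partner x with x | x <;> rfl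
  have hob : ∀ y : Fin k ⊕ Fin m, (Sum.map id (Sum.map id Sum.inl) (outer y : Glued k l m) :
      Glued₃ k l m n) = Sum.map id Sum.inr (inFirst y : Glued k m n) := by
    rintro (y | y) <;> rfl
  refine ⟨?_, ?_, ?_, hob, ?_, ?_, hB, ?_, ?_⟩
  · exact Function.injective_id.sumMap Sum.inr_injective
  · exact Function.injective_id.sumMap (Function.injective_id.sumMap Sum.inl_injective)
  · rintro (v | v | v | v)
    · exact Or.inl ⟨Sum.inl v, rfl⟩
    · exact Or.inr ⟨Sum.inr (Sum.inl v), rfl⟩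
    · exact Or.inl ⟨Sum.inr (Sum.inl v), rfl⟩
    · exact Or.inl ⟨Sum.inr (Sum.inr v), rfl⟩
  · rintro (a | a | a) (b | b | b) h <;> simp at h
    · exact ⟨Sum.inl a, by rw [h]; rfl, rfl⟩
    · exact ⟨Sum.inr a, by rw [h]; rfl, rfl⟩
  · intro a a' h
    refine joined_rec ((Relation.EqvGen.setoid (arcs₃ D E F)).comap (Sum.map id Sum.inr))
      (fun x => ?_) (fun x => ?_) h
    · have := hB _ _ (joined_comp D E x)
      rwa [hob, hob] at this
    · exact Relation.EqvGen.rel _ _ (Or.inr (Or.inr ⟨x, rfl, rfl⟩))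
  · rintro u v (⟨x, rfl, rfl⟩ | ⟨x, rfl, rfl⟩ | ⟨x, rfl, rfl⟩)
    · refine Or.inr ⟨_, _, ?_, ?_, joined_first D E x⟩
      · rcases x with x | x <;> rfl
      · rcases D.partner x with x | x <;> rfl
    · refine Or.inr ⟨_, _, ?_, ?_, joined_second D E x⟩
      · rcases x with x | x <;> rfl
      · rcases E.partner x with x | x <;> rfl
    · exact Or.inl ⟨_, _, rfl, rfl, joined_second (D.comp E) F x⟩
  · intro y y' h
    rcases (joined_outer_iff D E y y').1 h with rfl | rfl
    · exact (joined _ _).refl _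
    · exact joined_first _ _ _

theorem isAmalgam_right (D : Diagram k l) (E : Diagram l m) (F : Diagram m n) :
    IsAmalgam (V := Glued₃ k l m n) (Sum.map id (Sum.map id Sum.inr) : Glued k l n → _)
      (Sum.inr : Glued l m n → _) outer Sum.inr (arcs₃ D E F)
      (joined D (E.comp F)) (joined E F) := by
  have hB : ∀ b b', joined E F b b' → Relation.EqvGen (arcs₃ D E F) (Sum.inr b) (Sum.inr b') := by
    intro b b' h
    refine joined_rec ((Relation.EqvGen.setoid (arcs₃ D E F)).comap Sum.inr)
      (fun x => ?_) (fun x => ?_) h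
    · exact Relation.EqvGen.rel _ _ (Or.inr (Or.inl ⟨x, rfl, rfl⟩))
    · exact Relation.EqvGen.rel _ _ (Or.inr (Or.inr ⟨x, rfl, rfl⟩))
  have hob : ∀ y : Fin l ⊕ Fin n, (Sum.inr (outer y : Glued l m n) : Glued₃ k l m n) =
      Sum.map id (Sum.map id Sum.inr) (Sum.inr y : Glued k l n) := by
    rintro (y | y) <;> rfl
  refine ⟨?_, Sum.inr_injective, ?_, hob, ?_, ?_, hB, ?_, ?_⟩
  · exact Function.injective_id.sumMap (Function.injective_id.sumMap Sum.inr_injective)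
  · rintro (v | v)
    · exact Or.inl ⟨Sum.inl v, rfl⟩
    · exact Or.inr ⟨v, rfl⟩
  · rintro (a | a | a) (b | b | b) h <;> simp at h
    · exact ⟨Sum.inl a, by rw [h]; rfl, rfl⟩
    · exact ⟨Sum.inr a, by rw [h]; rfl, rfl⟩
  · intro a a' h
    refine joined_rec ((Relation.EqvGen.setoid (arcs₃ D E F)).comap
      (Sum.map id (Sum.map id Sum.inr))) (fun x => ?_) (fun x => ?_) h
    · refine Relation.EqvGen.rel _ _ (Or.inl ⟨x, ?_, ?_⟩)
      · rcases x with x | x <;> rfl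
      · rcases D.partner x with x | x <;> rfl
    · have := hB _ _ (joined_comp E F x)
      rwa [hob, hob] at this
  · rintro u v (⟨x, rfl, rfl⟩ | ⟨x, rfl, rfl⟩ | ⟨x, rfl, rfl⟩)
    · refine Or.inl ⟨_, _, ?_, ?_, joined_first D (E.comp F) x⟩
      · rcases x with x | x <;> rfl
      · rcases D.partner x with x | x <;> rfl
    · exact Or.inr ⟨_, _, rfl, rfl, joined_first E F x⟩
    · exact Or.inr ⟨_, _, rfl, rfl, joined_second E F x⟩
  · intro y y' h
    rcases (joined_outer_iff E F y y').1 h with rfl | rfl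
    · exact (joined _ _).refl _
    · exact joined_second _ _ _

/-- Both bracketings join two outer nodes exactly when these are connected in the picture made of
all three diagrams. -/
theorem Diagram.comp_assoc (D : Diagram k l) (E : Diagram l m) (F : Diagram m n) :
    (D.comp E).comp F = D.comp (E.comp F) := by
  have ho : ∀ x : Fin k ⊕ Fin n, (Sum.map id Sum.inr (outer x : Glued k m n) : Glued₃ k l m n) =
      Sum.map id (Sum.map id Sum.inr) (outer x : Glued k l n) := by
    rintro (x | x) <;> rfl
  apply Diagram.ext
  funext x
  rw [Diagram.comp_partner_eq_iff]
  refine ⟨Diagram.partner_ne _ _, ?_⟩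
  rw [← (isAmalgam_left D E F).eqvGen_left, ho, ho, (isAmalgam_right D E F).eqvGen_left]
  exact joined_comp _ _ _

/-- Both sides count the closed components of the triple picture: those formed at the first gluing
plus those formed at the second. This identity makes the factors `a ^ loops` associative, and every
comparison of weights below comes down to it. -/
theorem loops_cocycle (D : Diagram k l) (E : Diagram l m) (F : Diagram m n) :
    D.loops E + (D.comp E).loops F = E.loops F + D.loops (E.comp F) := by
  have ho : ∀ x : Fin k ⊕ Fin n, (Sum.map id Sum.inr (outer x : Glued k m n) : Glued₃ k l m n) =
      Sum.map id (Sum.map id Sum.inr) (outer x : Glued k l n) := by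
    rintro (x | x) <;> rfl
  have h1 := (isAmalgam_left D E F).card_components outer
  have h2 := (isAmalgam_right D E F).card_components outer
  simp only [ho] at h1
  rw [add_comm, add_comm (E.loops F)]
  exact h1.symm.trans h2

end Category

/-! ### Straightening a cup against a neighbouring cup -/

section Cups

variable {k l m n : ℕ}

/-- A closed loop consists of nodes of the middle bar, so it suffices that each of them is connected
to an outer bar. -/
theorem loops_eq_zero (D : Diagram l m) (E : Diagram m n)
    (h : ∀ j, ∃ y, joined D E (Sum.inr (Sum.inl j)) (outer y)) : D.loops E = 0 := by
  rw [Diagram.loops, Nat.card_eq_zero]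
  refine Or.inl ⟨fun ⟨c, hc⟩ => ?_⟩
  induction c using Quotient.inductionOn with | h u => ?_
  rcases u with u | u | u
  · exact hc (Sum.inl u) rfl
  · obtain ⟨y, hy⟩ := h u
    exact hc y (Quotient.sound hy)
  · exact hc (Sum.inr u) rfl

theorem loops_empty_middle (D : Diagram l 0) (E : Diagram 0 n) : D.loops E = 0 :=
  loops_eq_zero D E fun j => j.elim0

theorem Diagram.comp_partner_inl (D : Diagram l m) (E : Diagram m n) {x y : Fin l}
    (h : D.partner (Sum.inl x) = Sum.inl y) : (D.comp E).partner (Sum.inl x) = Sum.inl y := by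
  rw [Diagram.comp_partner_eq_iff]
  refine ⟨fun h' => D.partner_ne (Sum.inl x) (by rw [h, Sum.inl.inj h']), ?_⟩
  have := joined_first D E (Sum.inl x)
  rwa [h] at this

theorem comp_empty (D : Diagram m 0) (e : Diagram 0 0) : D.comp e = D := by
  apply Diagram.ext
  funext x
  rcases x with x | x
  · rcases h : D.partner (Sum.inl x) with y | y
    · exact D.comp_partner_inl e h
    · exact y.elim0
  · exact x.elim0

theorem empty_comp (e : Diagram 0 0) (D : Diagram 0 m) : e.comp D = D := by
  apply Diagram.ext
  funext x
  rcases x with x | x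
  · exact x.elim0
  · rcases h : D.partner (Sum.inr x) with y | y
    · exact y.elim0
    · exact e.comp_partner_inr D h

/-- The inclusion of the nodes of a bar that leaves out the nodes `j` and `j + 1`. -/
def skip (k j : ℕ) (x : Fin k) : Fin (k + 2) :=
  if (x : ℕ) < j then ⟨x, by omega⟩ else ⟨x + 2, by omega⟩

theorem skip_injective (k j : ℕ) : Function.Injective (skip k j) := by
  intro x y h
  simp only [skip] at h
  split_ifs at h <;> simp only [Fin.mk.injEq] at h <;> apply Fin.ext <;> omega

/-- The inclusion of the nodes of an `(m, k)`-diagram that leaves out the nodes `j` and `j + 1` on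
the right. -/
abbrev skipNode (m k j : ℕ) : Fin m ⊕ Fin k → Fin m ⊕ Fin (k + 2) := Sum.map id (skip k j)

theorem skipNode_injective (m k j : ℕ) : Function.Injective (skipNode m k j) :=
  Function.injective_id.sumMap (skip_injective k j)

theorem exists_skip_eq {k j : ℕ} (hj : j ≤ k) (x : Fin (k + 2)) :
    (x : ℕ) = j ∨ (x : ℕ) = j + 1 ∨ ∃ w, skip k j w = x := by
  by_cases h1 : (x : ℕ) < j
  · exact Or.inr (Or.inr ⟨⟨x, by omega⟩, by simp [skip, h1]⟩)
  · by_cases h2 : (x : ℕ) < j + 2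
    · omega
    · refine Or.inr (Or.inr ⟨⟨x - 2, by omega⟩, ?_⟩)
      have : ¬ (x : ℕ) - 2 < j := by omega
      apply Fin.ext
      simp only [skip, this, if_false]
      omega

/-- The nodes `j` and `j + 1` of the right bar are joined. -/
def Diagram.HasCup (D : Diagram m n) (j : ℕ) : Prop :=
  ∃ h : j + 1 < n, D.partner (Sum.inr ⟨j, by omega⟩) = Sum.inr ⟨j + 1, h⟩

theorem Diagram.HasCup.comp (D : Diagram l m) {E : Diagram m n} {j : ℕ} (h : E.HasCup j) :
    (D.comp E).HasCup j := ⟨h.1, Diagram.comp_partner_inr D E h.2⟩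

theorem Diagram.HasCup.not_succ {D : Diagram m n} {j : ℕ} (h : D.HasCup j) :
    ¬ D.HasCup (j + 1) := by
  rintro ⟨h1, h2⟩
  obtain ⟨h3, h4⟩ := h
  have := D.partner_partner (Sum.inr ⟨j, by omega⟩)
  rw [h4, h2, Sum.inr.injEq, Fin.mk.injEq] at this
  omega

theorem leftCup_partner_inr (k j : ℕ) (hj : j ≤ k) (x : Fin k) :
    (Diagram.leftCup k j hj).partner (Sum.inr x) = Sum.inl (skip k j x) := by
  simp only [Diagram.leftCup, skip]
  split_ifs <;> rfl

theorem rightCup_partner_inl (k j : ℕ) (hj : j ≤ k) (x : Fin k) :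
    (Diagram.rightCup k j hj).partner (Sum.inl x) = Sum.inr (skip k j x) := by
  simp only [Diagram.rightCup, Diagram.mirror, Sum.swap_inl, leftCup_partner_inr]

theorem leftCup_partner_inl (k j : ℕ) (hj : j ≤ k) :
    (Diagram.leftCup k j hj).partner (Sum.inl ⟨j, by omega⟩) = Sum.inl ⟨j + 1, by omega⟩ := by
  simp [Diagram.leftCup]

theorem rightCup_hasCup (k j : ℕ) (hj : j ≤ k) : (Diagram.rightCup k j hj).HasCup j :=
  ⟨by omega, by
    simp only [Diagram.rightCup, Diagram.mirror, Sum.swap_inr, leftCup_partner_inl, Sum.swap_inl]⟩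

theorem joined_rightCup (x : Diagram m k) {j : ℕ} (hj : j ≤ k) (z : Fin m ⊕ Fin k) :
    joined x (Diagram.rightCup k j hj) (inFirst z) (outer (skipNode m k j z)) := by
  rcases z with z | z
  · exact Setoid.refl' _ _
  · have := joined_second x (Diagram.rightCup k j hj) (Sum.inl z)
    rwa [rightCup_partner_inl] at this

theorem loops_rightCup (x : Diagram m k) {j : ℕ} (hj : j ≤ k) :
    x.loops (Diagram.rightCup k j hj) = 0 :=
  loops_eq_zero _ _ fun w => ⟨_, joined_rightCup x hj (Sum.inr w)⟩

theorem comp_rightCup_partner (x : Diagram m k) {j : ℕ} (hj : j ≤ k) (z : Fin m ⊕ Fin k) :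
    (x.comp (Diagram.rightCup k j hj)).partner (skipNode m k j z) =
      skipNode m k j (x.partner z) := by
  rw [Diagram.comp_partner_eq_iff]
  refine ⟨fun h => x.partner_ne z (skipNode_injective _ _ _ h), ?_⟩
  exact Setoid.trans' _ (Setoid.symm' _ (joined_rightCup x hj z))
    (Setoid.trans' _ (joined_first _ _ z) (joined_rightCup x hj _))

section Straighten

variable {x : Diagram m (k + 2)} {j j' : ℕ} (hj' : j' ≤ k)
  (hjj : j' = j + 1 ∨ j = j' + 1) (hx : x.HasCup j)
include hjj hx

/-- Leaving out `j, j + 1` and leaving out `j', j' + 1` number the remaining nodes identically,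
except for the node `min j j'`. There the path runs through a zig-zag: once along the cup of `x` and
once along the cup of the left-cup diagram. -/
theorem joined_leftCup (z : Fin m ⊕ Fin k) :
    joined x (Diagram.leftCup k j' hj') (inFirst (skipNode m k j z)) (outer z) := by
  rcases z with z | z
  · exact Setoid.refl' _ _
  · have h1 : joined x (Diagram.leftCup k j' hj') (Sum.inr (Sum.inl (skip k j' z)))
        (Sum.inr (Sum.inr z)) := by
      have := joined_second x (Diagram.leftCup k j' hj') (Sum.inr z)
      rw [leftCup_partner_inr] at this
      exact Setoid.symm' _ this
    refine Setoid.trans' _ ?_ h1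
    change joined _ _ (Sum.inr (Sum.inl (skip k j z))) _
    by_cases h : skip k j z = skip k j' z
    · rw [h]
    have h2 := joined_second x (Diagram.leftCup k j' hj') (Sum.inl ⟨j', by omega⟩)
    rw [leftCup_partner_inl] at h2
    obtain ⟨h3, h4⟩ := hx
    have h5 := joined_first x (Diagram.leftCup k j' hj') (Sum.inr ⟨j, by omega⟩)
    rw [h4] at h5
    have hz := z.2
    simp only [skip] at h ⊢
    split_ifs at h ⊢ with ha hb hb
    · exact absurd rfl h
    · have e1 : (z : ℕ) = j' := by omega
      have e2 : j = j' + 1 := by omega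
      subst e2
      simp only [← e1] at h2 h5 ⊢
      exact Setoid.trans' _ h2 h5
    · have e1 : (z : ℕ) = j := by omega
      have e2 : j' = j + 1 := by omega
      subst e2
      simp only [← e1] at h2 h5 ⊢
      exact Setoid.symm' _ (Setoid.trans' _ h5 h2)
    · exact absurd rfl h

theorem comp_leftCup_partner {z z' : Fin m ⊕ Fin k}
    (h : x.partner (skipNode m k j z) = skipNode m k j z') :
    (x.comp (Diagram.leftCup k j' hj')).partner z = z' := by
  rw [Diagram.comp_partner_eq_iff]
  refine ⟨fun h' => x.partner_ne (skipNode m k j z) (by rw [h, h']), ?_⟩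
  have h1 := joined_first x (Diagram.leftCup k j' hj') (skipNode m k j z)
  rw [h] at h1
  exact Setoid.trans' _ (Setoid.symm' _ (joined_leftCup hj' hjj hx z))
    (Setoid.trans' _ h1 (joined_leftCup hj' hjj hx z'))

/-- The nodes `j` and `j + 1` are joined by the cup of `x`, and the cup at `j'` covers only one of
them; the other one continues to the outer bar. All other nodes are treated by `joined_leftCup`. -/
theorem loops_leftCup : x.loops (Diagram.leftCup k j' hj') = 0 := by
  obtain ⟨h3, h4⟩ := hx
  have h5 := joined_first x (Diagram.leftCup k j' hj') (Sum.inr ⟨j, by omega⟩)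
  rw [h4] at h5
  have h6 : ∀ w, joined x (Diagram.leftCup k j' hj') (Sum.inr (Sum.inl (skip k j' w)))
      (outer (Sum.inr w)) := by
    intro w
    have := joined_second x (Diagram.leftCup k j' hj') (Sum.inr w)
    rw [leftCup_partner_inr] at this
    exact Setoid.symm' _ this
  have h7 : ∃ y, joined x (Diagram.leftCup k j' hj')
      (Sum.inr (Sum.inl ⟨j, by omega⟩)) (outer y) := by
    rcases hjj with rfl | rfl
    · have := h6 ⟨j, by omega⟩
      simp only [skip, Nat.lt_succ_self, if_true] at this
      exact ⟨_, this⟩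
    · have := h6 ⟨j', by omega⟩
      simp only [skip, lt_irrefl, if_false] at this
      exact ⟨_, Setoid.trans' _ h5 this⟩
  refine loops_eq_zero _ _ fun w => ?_
  rcases exists_skip_eq (show j ≤ k by omega) w with h | h | ⟨w, rfl⟩
  · obtain rfl : w = ⟨j, Nat.lt_of_succ_lt h3⟩ := Fin.ext h
    exact h7
  · obtain rfl : w = ⟨j + 1, h3⟩ := Fin.ext h
    obtain ⟨y, hy⟩ := h7
    exact ⟨y, Setoid.trans' _ (Setoid.symm' _ h5) hy⟩
  · exact ⟨_, joined_leftCup hj' hjj ⟨h3, h4⟩ (Sum.inr w)⟩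

end Straighten

/-- Cups of opposite directions at neighbouring positions form a zig-zag, which is isotopic to a
straight strand. -/
theorem comp_rightCup_leftCup (x : Diagram m k) {j j' : ℕ} (hj : j ≤ k) (hj' : j' ≤ k)
    (hjj : j' = j + 1 ∨ j = j' + 1) :
    (x.comp (Diagram.rightCup k j hj)).comp (Diagram.leftCup k j' hj') = x := by
  apply Diagram.ext
  funext z
  exact comp_leftCup_partner hj' hjj ((rightCup_hasCup k j hj).comp x)
    (comp_rightCup_partner x hj z)

theorem loops_comp_rightCup_leftCup (x : Diagram m k) {j j' : ℕ} (hj : j ≤ k) (hj' : j' ≤ k)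
    (hjj : j' = j + 1 ∨ j = j' + 1) :
    (x.comp (Diagram.rightCup k j hj)).loops (Diagram.leftCup k j' hj') = 0 :=
  loops_leftCup hj' hjj ((rightCup_hasCup k j hj).comp x)

/-- Composing with the left cup next to `j` removes the cup of `x` at `j`, and the right cup at `j`
puts it back. The remaining arcs are only renumbered in between. -/
theorem comp_leftCup_rightCup {x : Diagram m (k + 2)} {j j' : ℕ} (hj : j ≤ k) (hj' : j' ≤ k)
    (hjj : j' = j + 1 ∨ j = j' + 1) (hx : x.HasCup j) :
    (x.comp (Diagram.leftCup k j' hj')).comp (Diagram.rightCup k j hj) = x := by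
  have hcup : ∀ w : Fin (k + 2), ((w : ℕ) = j ∨ (w : ℕ) = j + 1) →
      ((x.comp (Diagram.leftCup k j' hj')).comp (Diagram.rightCup k j hj)).partner (Sum.inr w) =
        x.partner (Sum.inr w) := by
    obtain ⟨h1, h2⟩ := hx
    obtain ⟨h3, h4⟩ := (rightCup_hasCup k j hj).comp (x.comp (Diagram.leftCup k j' hj'))
    rintro w (h | h)
    · obtain rfl : w = ⟨j, Nat.lt_of_succ_lt h1⟩ := Fin.ext h
      rw [h2, h4]
    · obtain rfl : w = ⟨j + 1, h1⟩ := Fin.ext h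
      rw [← h2, x.partner_partner, h2, ← h4, Diagram.partner_partner]
  have hskip : ∀ z, (∃ z₀, skipNode m k j z₀ = z) ∨
      ∃ w : Fin (k + 2), z = Sum.inr w ∧ ((w : ℕ) = j ∨ (w : ℕ) = j + 1) := by
    rintro (z | z)
    · exact Or.inl ⟨Sum.inl z, rfl⟩
    · rcases exists_skip_eq hj z with h | h | ⟨w, rfl⟩
      · exact Or.inr ⟨z, rfl, Or.inl h⟩
      · exact Or.inr ⟨z, rfl, Or.inr h⟩
      · exact Or.inl ⟨Sum.inr w, rfl⟩
  apply Diagram.ext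
  funext z
  rcases hskip z with ⟨z₀, rfl⟩ | ⟨w, rfl, hw⟩
  · rcases hskip (x.partner (skipNode m k j z₀)) with ⟨z₁, h₁⟩ | ⟨w, h, hw⟩
    · rw [comp_rightCup_partner, comp_leftCup_partner hj' hjj hx h₁.symm, h₁]
    -- The cup nodes are joined to each other, so this case cannot occur, but it need not be
    -- excluded: both diagrams agree on cup nodes, and partners are involutive.
    · have h₂ := hcup w hw
      rw [← h, x.partner_partner] at h₂
      have h₃ := Diagram.partner_partner
        ((x.comp (Diagram.leftCup k j' hj')).comp (Diagram.rightCup k j hj))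
        (x.partner (skipNode m k j z₀))
      rwa [h₂] at h₃
  · exact hcup w hw

end Cups

/-! ### Factoring diagrams with prescribed right cups -/

section Splitting

variable {k l m n N : ℕ}

/-- The diagrams with right cups at the positions `S` are retracts along `U` and `V`. -/
structure IsSplitting (S : Finset ℕ) (U : Diagram k N) (V : Diagram N k) : Prop where
  comp_comp : ∀ (m : ℕ) (x : Diagram m k), (∀ j ∈ S, x.HasCup j) → (x.comp U).comp V = x
  loops_left : ∀ (m : ℕ) (x : Diagram m k), (∀ j ∈ S, x.HasCup j) → x.loops U = 0
  loops_right : ∀ (m : ℕ) (x : Diagram m k), (∀ j ∈ S, x.HasCup j) → (x.comp U).loops V = 0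
  hasCup : ∀ j ∈ S, V.HasCup j

theorem loops_comp_eq_zero {D : Diagram k l} {E : Diagram l m} {F : Diagram m n}
    (h1 : D.loops E = 0) (h2 : (D.comp E).loops F = 0) : D.loops (E.comp F) = 0 := by
  have := loops_cocycle D E F
  omega

/-- On a positive number of nodes `R₁` followed by `L₂` is the identity, so one can pass to two more
nodes and come back. The assumption `1 ≤ k` provides the second position needed by `L₂`. -/
theorem exists_splitting_empty (hk : 1 ≤ k) (t : ℕ) :
    ∃ (U : Diagram k (k + 2 * t)) (V : Diagram (k + 2 * t) k), IsSplitting ∅ U V := by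
  have key : ∀ {m : ℕ} {N : ℕ} (hN : 1 ≤ N) (y : Diagram m N),
      (y.comp (Diagram.rightCup N 0 (Nat.zero_le _))).comp (Diagram.leftCup N 1 hN) = y :=
    fun hN y => comp_rightCup_leftCup y _ hN (Or.inl rfl)
  have keyl : ∀ {m : ℕ} {N : ℕ} (hN : 1 ≤ N) (y : Diagram m N),
      (y.comp (Diagram.rightCup N 0 (Nat.zero_le _))).loops (Diagram.leftCup N 1 hN) = 0 :=
    fun hN y => loops_comp_rightCup_leftCup y _ hN (Or.inl rfl)
  induction t with
  | zero =>
    -- The composite of `R₁` and `L₂` acts as the identity diagram on `k` nodes.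
    let U : Diagram k k := (Diagram.rightCup k 0 (Nat.zero_le _)).comp (Diagram.leftCup k 1 hk)
    have hU : ∀ {m : ℕ} (x : Diagram m k), x.comp U = x := fun x => by
      rw [← Diagram.comp_assoc, key]
    have hUl : ∀ {m : ℕ} (x : Diagram m k), x.loops U = 0 := fun x =>
      loops_comp_eq_zero (loops_rightCup _ _) (keyl hk _)
    exact ⟨U, U, fun m x _ => by rw [hU, hU], fun m x _ => hUl x, fun m x _ => hUl _, by simp⟩
  | succ t ih =>
    obtain ⟨U, V, h⟩ := ih
    have hN : 1 ≤ k + 2 * t := by omega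
    refine ⟨U.comp (Diagram.rightCup (k + 2 * t) 0 (Nat.zero_le _)),
      (Diagram.leftCup (k + 2 * t) 1 hN).comp V, fun m x hx => ?_, fun m x hx => ?_,
      fun m x hx => ?_, by simp⟩
    · rw [← Diagram.comp_assoc x, ← Diagram.comp_assoc, key, h.comp_comp m x hx]
    · exact loops_comp_eq_zero (h.loops_left m x hx) (loops_rightCup _ _)
    · rw [← Diagram.comp_assoc]
      refine loops_comp_eq_zero (keyl _ _) ?_
      rw [key]
      exact h.loops_right m x hx

theorem Diagram.HasCup.of_comp_rightCup {x : Diagram m k} {j s : ℕ} (hj : j ≤ k) (hs : s + 1 < j) :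
    (x.comp (Diagram.rightCup k j hj)).HasCup s ↔ x.HasCup s := by
  have h1 : skip k j ⟨s, by omega⟩ = ⟨s, by omega⟩ := by
    simp [skip, show s < j by omega]
  have h2 : skip k j ⟨s + 1, by omega⟩ = ⟨s + 1, by omega⟩ := by
    simp [skip, hs]
  have h3 := comp_rightCup_partner x hj (Sum.inr ⟨s, by omega⟩)
  simp only [skipNode, Sum.map_inr, h1] at h3
  constructor
  · rintro ⟨h4, h5⟩
    rw [h3, ← h2] at h5
    exact ⟨by omega, skipNode_injective m k j h5⟩
  · rintro ⟨h4, h5⟩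
    refine ⟨by omega, ?_⟩
    rw [h3, h5, ← h2]
    rfl

/-- Cups are removed one at a time by a left cup at a neighbouring position and restored by a right
cup, until none is left and `exists_splitting_empty` applies. The inequality `2 * S.card < k` means
that some node lies on no cup of `S`, so that a neighbouring position is available until the end.
Since `U` and `V` depend on `S` alone, they serve all diagrams with these cups at once. -/
theorem exists_splitting (S : Finset ℕ) (hS : ∀ j ∈ S, j + 1 < k ∧ j + 1 ∉ S)
    (hk : 2 * S.card < k) {t : ℕ} (hN : N = k + 2 * t) :
    ∃ (U : Diagram k N) (V : Diagram N k), IsSplitting S U V := by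
  induction hc : S.card generalizing S k t with
  | zero =>
    obtain rfl := Finset.card_eq_zero.1 hc
    subst hN
    exact exists_splitting_empty (by omega) t
  | succ c ih =>
    have hne : S.Nonempty := Finset.card_pos.1 (by omega)
    -- Removing the highest cup does not renumber the nodes of the others.
    obtain ⟨j, hj, hmax⟩ : ∃ j ∈ S, ∀ s ∈ S, s ≤ j :=
      ⟨S.max' hne, S.max'_mem hne, fun s hs => S.le_max' s hs⟩
    have hjk := (hS j hj).1
    obtain ⟨k, rfl⟩ : ∃ k', k = k' + 2 := ⟨k - 2, by omega⟩
    have hlt : ∀ s ∈ S.erase j, s + 1 < j := by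
      intro s hs
      obtain ⟨hs1, hs2⟩ := Finset.mem_erase.1 hs
      have h1 := hmax s hs2
      have h2 : s + 1 ≠ j := fun h => (hS s hs2).2 (h ▸ hj)
      omega
    have hcard := Finset.card_erase_of_mem hj
    -- Without the cup there are two nodes fewer, so `t` grows by one to reach the same `N`.
    obtain ⟨U, V, h⟩ := ih (S.erase j) (k := k) (t := t + 1)
      (fun s hs => ⟨by have := hlt s hs; omega,
        fun h => (hS s (Finset.mem_of_mem_erase hs)).2 (Finset.mem_of_mem_erase h)⟩)
      (by omega) (by omega) (by omega)
    have hj' : j ≤ k := by omega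
    -- The neighbour above is used unless the cup is at the top; in that case `j - 1` exists because
    -- the cup does not cover the whole bar.
    obtain ⟨j', hjk', hjj⟩ : ∃ j', j' ≤ k ∧ (j' = j + 1 ∨ j = j' + 1) := by
      by_cases h1 : j + 1 ≤ k
      · exact ⟨j + 1, h1, Or.inl rfl⟩
      · exact ⟨j - 1, by omega, Or.inr (by omega)⟩
    have hx' : ∀ {m : ℕ} {x : Diagram m (k + 2)}, (∀ s ∈ S, x.HasCup s) →
        ∀ s ∈ S.erase j, (x.comp (Diagram.leftCup k j' hjk')).HasCup s := by
      intro m x hx s hs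
      rw [← Diagram.HasCup.of_comp_rightCup hj' (hlt s hs),
        comp_leftCup_rightCup hj' hjk' hjj (hx j hj)]
      exact hx s (Finset.mem_of_mem_erase hs)
    refine ⟨(Diagram.leftCup k j' hjk').comp U, V.comp (Diagram.rightCup k j hj'),
      fun m x hx => ?_, fun m x hx => ?_, fun m x hx => ?_, fun s hs => ?_⟩
    · rw [← Diagram.comp_assoc x, ← Diagram.comp_assoc, h.comp_comp _ _ (hx' hx),
        comp_leftCup_rightCup hj' hjk' hjj (hx j hj)]
    · exact loops_comp_eq_zero (loops_leftCup hjk' hjj (hx j hj)) (h.loops_left _ _ (hx' hx))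
    · rw [← Diagram.comp_assoc]
      exact loops_comp_eq_zero (h.loops_right _ _ (hx' hx)) (loops_rightCup _ _)
    · by_cases hsj : s = j
      · subst hsj
        exact (rightCup_hasCup k s hj').comp V
      · have hs' := Finset.mem_erase.2 ⟨hsj, hs⟩
        exact (Diagram.HasCup.of_comp_rightCup hj' (hlt s hs')).2 (h.hasCup s hs')

/-- A diagram with a right cup has an innermost one. -/
theorem Diagram.exists_innermost {D : Diagram m n} (hD : ¬ D.NoRightCup) :
    ∃ j, D.IsInnermostRightCup j := by
  -- Here `d` is the number of nodes strictly between the ends of a cup. If it is positive, the node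
  -- `j + 1` is enclosed, and planarity forces its partner to lie strictly between `j + 1` and `k`:
  -- a shorter cup.
  have key : ∀ (d : ℕ) (j k : Fin n), (k : ℕ) = j + d + 1 →
      D.partner (Sum.inr j) = Sum.inr k → ∃ j, D.IsInnermostRightCup j := by
    intro d
    induction d using Nat.strong_induction_on with | h d ih => ?_
    intro j k hjk h
    have hk := k.2
    rcases Nat.eq_zero_or_pos d with rfl | hd
    · refine ⟨j, by omega, ?_⟩
      rw [h]
      congr 1
      exact Fin.ext (by simpa using hjk)
    · have hkj : D.partner (Sum.inr k) = Sum.inr j := by rw [← h, D.partner_partner]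
      have hq : (j : ℕ) + 1 < n := by omega
      have h1 := D.noncrossing (Sum.inr k) (Sum.inr ⟨j + 1, hq⟩)
      have h2 := D.noncrossing (D.partner (Sum.inr ⟨j + 1, hq⟩)) (Sum.inr k)
      have h3 := D.partner_ne (Sum.inr ⟨j + 1, hq⟩)
      have h4 := D.partner_partner (Sum.inr ⟨j + 1, hq⟩)
      rw [D.partner_partner] at h2
      rcases hp : D.partner (Sum.inr ⟨j + 1, hq⟩) with p | p
      · rw [hp, hkj] at h2
        have hp2 := p.2
        simp only [bpos] at h2
        omega
      · rw [hp] at h1 h2 h3 h4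
        have hp2 := p.2
        simp only [hkj, bpos] at h1 h2
        have h5 : p ≠ j := by
          rintro rfl
          rw [h, Sum.inr.injEq, Fin.ext_iff] at h4
          simp only at h4
          omega
        have h6 : p ≠ k := by
          rintro rfl
          rw [hkj, Sum.inr.injEq, Fin.ext_iff] at h4
          simp only at h4
          omega
        have h7 : (p : ℕ) ≠ j + 1 := fun h => h3 (by congr 1; exact Fin.ext h)
        have h5' : (p : ℕ) ≠ j := fun h => h5 (Fin.ext h)
        have h6' : (p : ℕ) ≠ k := fun h => h6 (Fin.ext h)
        exact ih (p - (j + 1) - 1) (by omega) ⟨j + 1, hq⟩ p (by simp only; omega) hp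
  simp only [Diagram.NoRightCup, not_forall, not_not] at hD
  obtain ⟨j, k, h⟩ := hD
  have hne : (j : ℕ) ≠ k := fun h' => D.partner_ne (Sum.inr j) (by rw [h, Fin.ext h'])
  rcases lt_or_gt_of_ne hne with h' | h'
  · exact key (k - j - 1) j k (by omega) h
  · exact key (j - k - 1) k j (by omega) (by rw [← h, D.partner_partner])

end Splitting

/-! ### Diagrams with the maximal number of dashed cups -/

section MaximalCups

variable {m i : ℕ}

theorem Dashed.hasCup {x : Dashed i m} {j : Fin (2 * i)} (hj : j ∈ x.dashes) :
    x.diagram.HasCup j := x.2 j hj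

theorem Dashed.ext {x y : Dashed i m} (h1 : x.diagram = y.diagram) (h2 : x.dashes = y.dashes) :
    x = y := Subtype.ext (Prod.ext h1 h2)

/-- The lower nodes of the cups of `L_max`. -/
def evens (i : ℕ) : Finset (Fin (2 * i)) := Finset.univ.filter fun j => (j : ℕ) % 2 = 0

theorem card_evens (i : ℕ) : (evens i).card = i := by
  have : (Finset.univ : Finset (Fin i)).card = (evens i).card := by
    refine Finset.card_bij (fun s _ => ⟨2 * s, by omega⟩) ?_ ?_ ?_
    · intro s _; simp [evens]
    · intro s _ t _ h
      simp only [Fin.mk.injEq] at h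
      exact Fin.ext (by omega)
    · intro j hj
      simp only [evens, Finset.mem_filter, Finset.mem_univ, true_and] at hj
      have := j.2
      exact ⟨⟨j / 2, by omega⟩, Finset.mem_univ _, Fin.ext (by simp only; omega)⟩
  rw [← this, Finset.card_univ, Fintype.card_fin]

theorem Dashed.not_succ_mem (x : Dashed i m) {j j' : Fin (2 * i)} (hj : j ∈ x.dashes)
    (hj' : (j' : ℕ) = j + 1) : j' ∉ x.dashes := fun h =>
  (Dashed.hasCup hj).not_succ (hj' ▸ Dashed.hasCup h)

/-- Two cups share no node, so their lower nodes are never consecutive and each pair `{2s, 2s + 1}`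
contains at most one of them. This bounds the number of dashes by `i`. -/
theorem Dashed.half_injOn (x : Dashed i m) :
    Set.InjOn (fun j : Fin (2 * i) => (⟨j / 2, by omega⟩ : Fin i)) x.dashes := by
  intro j hj j' hj' h
  simp only [Fin.mk.injEq] at h
  by_contra hne
  have hne' : (j : ℕ) ≠ j' := fun h => hne (Fin.ext h)
  rcases lt_or_gt_of_ne hne' with h' | h'
  · exact x.not_succ_mem hj (j' := j') (by omega) hj'
  · exact x.not_succ_mem hj' (j' := j) (by omega) hj

theorem Dashed.card_dashes_le (x : Dashed i m) : x.dashes.card ≤ i := by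
  have := Finset.card_le_card_of_injOn (t := Finset.univ) _ (fun _ _ => Finset.mem_univ _)
    x.half_injOn
  simpa using this

/-- With `i` dashes every pair `{2s, 2s + 1}` contains the lower node of exactly one dashed cup, and
working downwards from the top pair shows that this node is always `2s`. -/
theorem Dashed.dashes_eq_evens {x : Dashed i m} (h : x.dashes.card = i) :
    x.dashes = evens i := by
  symm
  refine Finset.eq_of_subset_of_card_le (fun j hj => ?_) (by rw [h, card_evens])
  have himg : x.dashes.image (fun j : Fin (2 * i) => (⟨j / 2, by omega⟩ : Fin i)) =
      Finset.univ := by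
    rw [← Finset.card_eq_iff_eq_univ, Finset.card_image_of_injOn x.half_injOn, h, Fintype.card_fin]
  have hhalf : ∀ s < i, ∃ j ∈ x.dashes, (j : ℕ) / 2 = s := by
    intro s hs
    have : (⟨s, hs⟩ : Fin i) ∈ x.dashes.image
        (fun j : Fin (2 * i) => (⟨j / 2, by omega⟩ : Fin i)) := by
      rw [himg]; exact Finset.mem_univ _
    obtain ⟨j, hj, h⟩ := Finset.mem_image.1 this
    exact ⟨j, hj, congrArg Fin.val h⟩
  -- The number `c` counts the pairs above the pair `s`. In the top pair the upper node has no node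
  -- above it, so it cannot be a lower end; a dash at `2s + 2` excludes one at `2s + 1`.
  have key : ∀ c s : ℕ, s + c + 1 = i → ∃ j ∈ x.dashes, (j : ℕ) = 2 * s := by
    intro c
    induction c with
    | zero =>
      intro s hs
      obtain ⟨j, hj, hjs⟩ := hhalf s (by omega)
      obtain ⟨h1, -⟩ := Dashed.hasCup hj
      exact ⟨j, hj, by omega⟩
    | succ c ih =>
      intro s hs
      obtain ⟨j, hj, hjs⟩ := hhalf s (by omega)
      obtain ⟨j', hj', hjs'⟩ := ih (s + 1) (by omega)
      refine ⟨j, hj, ?_⟩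
      by_contra hne
      exact x.not_succ_mem hj (j' := j') (by omega) hj'
  have hj2 := j.2
  obtain ⟨j', hj', h'⟩ := key (i - j / 2 - 1) (j / 2) (by omega)
  simp only [evens, Finset.mem_filter, Finset.mem_univ, true_and] at hj
  obtain rfl : j' = j := Fin.ext (by omega)
  exact hj'

/-- The mirror image of `L_max`. -/
def rightMax (i : ℕ) : Diagram 0 (2 * i) := (Diagram.leftMax i).mirror

theorem rightMax_partner (i : ℕ) (j : Fin (2 * i)) (hj : (j : ℕ) % 2 = 0) :
    (rightMax i).partner (Sum.inr j) = Sum.inr ⟨j + 1, by omega⟩ := by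
  simp [rightMax, Diagram.mirror, Diagram.leftMax, hj]

theorem leftMax_partner (i : ℕ) (j : Fin (2 * i)) (hj : (j : ℕ) % 2 = 0) :
    (Diagram.leftMax i).partner (Sum.inl j) = Sum.inl ⟨j + 1, by omega⟩ := by
  simp [Diagram.leftMax, hj]

theorem comp_rightMax_leftMax (D : Diagram m 0) :
    (D.comp (rightMax i)).comp (Diagram.leftMax i) = D := by
  rw [Diagram.comp_assoc, comp_empty]

/-- All right nodes of such a diagram lie on its dashed cups, which are the arcs of `rightMax`. The
other arcs stay on the left bar and are untouched, so the deletion of the dashed cups can be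
reversed. -/
theorem comp_leftMax_rightMax {x : Dashed i m} (h : x.dashes.card = i) :
    (x.diagram.comp (Diagram.leftMax i)).comp (rightMax i) = x.diagram := by
  have heven : ∀ (j : Fin (2 * i)) (hj : (j : ℕ) % 2 = 0),
      x.diagram.partner (Sum.inr j) = Sum.inr ⟨j + 1, by omega⟩ := by
    intro j hj
    have hmem : j ∈ x.dashes := by
      rw [Dashed.dashes_eq_evens h]
      simpa [evens] using hj
    exact (Dashed.hasCup hmem).2
  have hcup : ∀ j, ∃ j', (rightMax i).partner (Sum.inr j) = Sum.inr j' ∧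
      x.diagram.partner (Sum.inr j) = Sum.inr j' := by
    intro j
    by_cases hj : (j : ℕ) % 2 = 0
    · exact ⟨_, rightMax_partner i j hj, heven j hj⟩
    · have hj2 : (j : ℕ) - 1 < 2 * i := by have := j.2; omega
      have hodd : (j : ℕ) - 1 + 1 < 2 * i := by have := j.2; omega
      have h3 : (⟨j - 1 + 1, hodd⟩ : Fin (2 * i)) = j := Fin.ext (by simp only; omega)
      have h1 := heven ⟨j - 1, hj2⟩ (by simp only; omega)
      have h2 := rightMax_partner i ⟨j - 1, hj2⟩ (by simp only; omega)
      simp only [h3] at h1 h2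
      exact ⟨⟨j - 1, hj2⟩, by rw [← h2, Diagram.partner_partner],
        by rw [← h1, Diagram.partner_partner]⟩
  apply Diagram.ext
  funext z
  rcases z with z | z
  · rcases hz : x.diagram.partner (Sum.inl z) with y | y
    · exact Diagram.comp_partner_inl _ _ (Diagram.comp_partner_inl _ _ hz)
    · obtain ⟨j', -, hj'⟩ := hcup y
      have := x.diagram.partner_partner (Sum.inl z)
      rw [hz, hj'] at this
      simp at this
  · obtain ⟨j', h1, h2⟩ := hcup z
    rw [h2]
    exact Diagram.comp_partner_inr _ _ h1

theorem loops_rightMax_leftMax (i : ℕ) : (rightMax i).loops (Diagram.leftMax i) = i := by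
  -- The function `j ↦ j / 2` is constant on components and separates them, so it numbers the loops.
  let f : Glued 0 (2 * i) 0 → ℕ := fun u => match u with
    | Sum.inr (Sum.inl j) => j / 2
    | _ => 0
  have hpair : ∀ (j : Fin (2 * i)) (y : Fin (2 * i)),
      (Diagram.leftMax i).partner (Sum.inl j) = Sum.inl y → (y : ℕ) / 2 = j / 2 := by
    intro j y h
    simp only [Diagram.leftMax] at h
    split_ifs at h <;> simp only [Sum.inl.injEq] at h <;> subst h <;> simp only <;> omega
  have hf : ∀ u v, joined (rightMax i) (Diagram.leftMax i) u v → f u = f v := by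
    intro u v h
    refine joined_rec (Setoid.ker f) (fun x => ?_) (fun x => ?_) h
    · rcases x with x | x
      · exact x.elim0
      · rcases h : (Diagram.leftMax i).partner (Sum.inl x) with y | y
        · have : (rightMax i).partner (Sum.inr x) = Sum.inr y := by
            simp [rightMax, Diagram.mirror, h]
          rw [this]
          exact (hpair x y h).symm
        · exact y.elim0
    · rcases x with x | x
      · rcases h : (Diagram.leftMax i).partner (Sum.inl x) with y | y
        · exact (hpair x y h).symm
        · exact y.elim0
      · exact x.elim0
  rw [Diagram.loops]
  refine (Nat.card_congr (Equiv.ofBijective (β := Fin i) (fun c =>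
    ⟨Quotient.lift (s := joined (rightMax i) (Diagram.leftMax i)) f hf c.1, ?_⟩) ⟨?_, ?_⟩)).trans
      (Nat.card_fin i)
  · obtain ⟨c, hc⟩ := c
    induction c using Quotient.inductionOn with | h u => ?_
    rcases u with u | u | u
    · exact u.elim0
    · change (u : ℕ) / 2 < i
      omega
    · exact u.elim0
  · rintro ⟨c, hc⟩ ⟨c', hc'⟩ h
    induction c using Quotient.inductionOn with | h u => ?_
    induction c' using Quotient.inductionOn with | h v => ?_
    congr 1
    rcases u with u | u | u
    · exact u.elim0
    · rcases v with v | v | v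
      · exact v.elim0
      · have h : (u : ℕ) / 2 = v / 2 := congrArg Fin.val h
        have hjoin : ∀ w w' : Fin (2 * i), (w : ℕ) % 2 = 0 → (w' : ℕ) = w + 1 →
            joined (rightMax i) (Diagram.leftMax i) (Sum.inr (Sum.inl w))
              (Sum.inr (Sum.inl w')) := by
          intro w w' hw hw'
          have := joined_second (rightMax i) (Diagram.leftMax i) (Sum.inl w)
          rw [leftMax_partner i w hw] at this
          have e : (⟨w + 1, by omega⟩ : Fin (2 * i)) = w' := Fin.ext hw'.symm
          rwa [e] at this
        by_cases huv : u = v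
        · rw [huv]
        · have huv' : (u : ℕ) ≠ v := fun h => huv (Fin.ext h)
          rcases lt_or_gt_of_ne huv' with h' | h'
          · exact Quotient.sound (hjoin u v (by omega) (by omega))
          · exact (Quotient.sound (hjoin v u (by omega) (by omega))).symm
      · exact v.elim0
    · exact u.elim0
  · intro s
    refine ⟨⟨Quotient.mk _ (Sum.inr (Sum.inl ⟨2 * s, by omega⟩)), ?_⟩, ?_⟩
    · rintro (x | x) <;> exact x.elim0
    · apply Fin.ext
      change 2 * (s : ℕ) / 2 = s
      omega

/-- The cocycle identity for `x.diagram.comp leftMax`, `rightMax` and `leftMax` reduces the count to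
that for `rightMax`: gluing along an empty bar creates no loops. This number is the weight shift in
`Σ^{i,i}`. -/
theorem loops_leftMax {x : Dashed i m} (h : x.dashes.card = i) :
    x.diagram.loops (Diagram.leftMax i) = i := by
  have h1 := loops_cocycle (x.diagram.comp (Diagram.leftMax i)) (rightMax i) (Diagram.leftMax i)
  rw [comp_leftMax_rightMax h, loops_empty_middle, loops_empty_middle,
    loops_rightMax_leftMax] at h1
  omega

end MaximalCups

/-! ### The bar differential as a recursion -/

section BarOperators

variable {R : Type*} [CommRing R] (a : R) (M : TLData R) {k l m n : ℕ}

/-- The action of a diagram, extended linearly. -/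
noncomputable def TLData.actMap (D : Diagram k m) : (M.B m →₀ R) →ₗ[R] (M.B k →₀ R) :=
  Finsupp.linearCombination R (M.act D)

/-- The laws of a left module over the Temperley-Lieb category. -/
structure TLData.IsModule : Prop where
  act_act : ∀ {k l m : ℕ} (D : Diagram k l) (E : Diagram l m) (x : M.B m),
    M.actMap D (M.act E x) = a ^ D.loops E • M.act (D.comp E) x
  act_empty : ∀ (e : Diagram 0 0) (x : M.B 0), M.act e x = Finsupp.single x 1

/-- Diagrams act by monomials, compatibly with the closing operations and with the labels of the
basis elements. -/
def TLData.IsWeighted (lab : ∀ m, M.B m → ℕ) : Prop :=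
  ∀ {k m : ℕ} (D : Diagram k m) (x : M.B m), M.act D x = 0 ∨
    ∃ y c, M.act D x = Finsupp.single y (a ^ c) ∧ lab k y = lab m x ∧
      M.close y = D.comp (M.close x) ∧
      c + M.closeLoops y = M.closeLoops x + D.loops (M.close x)

theorem TLData.actMap_single (D : Diagram k m) (x : M.B m) :
    M.actMap D (Finsupp.single x 1) = M.act D x := by
  simp [TLData.actMap]

variable {a M} in
theorem TLData.IsModule.actMap_actMap (h : M.IsModule a) (D : Diagram k l) (E : Diagram l m)
    (v : M.B m →₀ R) :
    M.actMap D (M.actMap E v) = a ^ D.loops E • M.actMap (D.comp E) v := by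
  have : M.actMap D ∘ₗ M.actMap E = a ^ D.loops E • M.actMap (D.comp E) := by
    ext1 x; ext1
    simp only [LinearMap.comp_apply, Finsupp.lsingle_apply, LinearMap.smul_apply,
      M.actMap_single, h.act_act]
  exact LinearMap.congr_fun this v

variable {a M} in
theorem TLData.IsModule.actMap_empty (h : M.IsModule a) (e : Diagram 0 0) (v : M.B 0 →₀ R) :
    M.actMap e v = v := by
  have : M.actMap e = LinearMap.id := by
    ext1 x; ext1
    simp only [LinearMap.comp_apply, Finsupp.lsingle_apply, LinearMap.id_apply,
      M.actMap_single, h.act_empty]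
  exact LinearMap.congr_fun this v

/-- The basis of the tails `(D₁ | … | D_{q-1} | x)` of the augmented bar construction. -/
abbrev Tail (B : ℕ → Type) (n : ℕ) : Type := List (Diagram (2 * n) (2 * n)) × B (2 * n)

variable (R) in
/-- The tails of length one. -/
noncomputable def tailNil (B : ℕ → Type) (n : ℕ) : (B (2 * n) →₀ R) →ₗ[R] (Tail B n →₀ R) :=
  Finsupp.lmapDomain R R fun x => ([], x)

variable (R) in
/-- Put a diagram in front of a tail. -/
noncomputable def tailCons {B : ℕ → Type} (A : Diagram (2 * n) (2 * n)) :
    (Tail B n →₀ R) →ₗ[R] (Tail B n →₀ R) :=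
  Finsupp.lmapDomain R R fun p => (A :: p.1, p.2)

variable (R) in
/-- The chains of degree `0`. -/
noncomputable def chainBase (B : ℕ → Type) (n : ℕ) : (B 0 →₀ R) →ₗ[R] (Chain B n →₀ R) :=
  Finsupp.lmapDomain R R .base

variable (R) in
/-- Complete a tail to a chain of positive degree. -/
noncomputable def chainCons {B : ℕ → Type} (hn : 0 < n) (D : Diagram 0 (2 * n)) :
    (Tail B n →₀ R) →ₗ[R] (Chain B n →₀ R) :=
  Finsupp.lmapDomain R R fun p => .bar hn D p.1 p.2

theorem tailNil_single {B : ℕ → Type} (x : B (2 * n)) (r : R) :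
    tailNil R B n (Finsupp.single x r) = Finsupp.single ([], x) r := by
  simp [tailNil]

theorem tailCons_single {B : ℕ → Type} (A : Diagram (2 * n) (2 * n)) (p : Tail B n) (r : R) :
    tailCons R A (Finsupp.single p r) = Finsupp.single (A :: p.1, p.2) r := by
  simp [tailCons]

theorem chainBase_single {B : ℕ → Type} (x : B 0) (r : R) :
    chainBase R B n (Finsupp.single x r) = Finsupp.single (.base x) r := by
  simp [chainBase]

theorem chainCons_single {B : ℕ → Type} (hn : 0 < n) (D : Diagram 0 (2 * n)) (p : Tail B n)
    (r : R) :
    chainCons R hn D (Finsupp.single p r) = Finsupp.single (.bar hn D p.1 p.2) r := by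
  simp [chainCons]

/-- Linear maps on tails are compared by induction on the length. -/
theorem tail_ext {B : ℕ → Type} {X : Type*} [AddCommMonoid X] [Module R X]
    {f g : (Tail B n →₀ R) →ₗ[R] X}
    (h0 : ∀ x, f (tailNil R B n (Finsupp.single x 1)) = g (tailNil R B n (Finsupp.single x 1)))
    (hc : ∀ A v, f v = g v → f (tailCons R A v) = g (tailCons R A v)) : f = g := by
  ext1 ⟨w, x⟩
  ext1
  simp only [LinearMap.comp_apply, Finsupp.lsingle_apply]
  induction w with
  | nil => simpa only [tailNil_single] using h0 x
  | cons A w ih => simpa only [tailCons_single] using hc A _ ih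

theorem chain_ext {B : ℕ → Type} {X : Type*} [AddCommMonoid X] [Module R X]
    {f g : (Chain B n →₀ R) →ₗ[R] X}
    (h0 : ∀ x, f (chainBase R B n (Finsupp.single x 1)) =
      g (chainBase R B n (Finsupp.single x 1)))
    (hc : ∀ hn D v, f (chainCons R hn D v) = g (chainCons R hn D v)) : f = g := by
  ext1 b
  ext1
  simp only [LinearMap.comp_apply, Finsupp.lsingle_apply]
  rcases b with y | ⟨hn, D, w, x⟩
  · simpa only [chainBase_single] using h0 y
  · simpa only [chainCons_single] using hc hn D (Finsupp.single (w, x) 1)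

/-- Multiply the first entry of a tail by a diagram. -/
noncomputable def tailMul (A : Diagram (2 * n) (2 * n)) :
    (Tail M.B n →₀ R) →ₗ[R] (Tail M.B n →₀ R) :=
  Finsupp.linearCombination R fun p => match p with
    | ([], x) => tailNil R M.B n (M.act A x)
    | (A' :: w, x) => Finsupp.single (A.comp A' :: w, x) (a ^ A.loops A')

/-- Multiply the first entry of a tail by a diagram in `TL(0, 2n)`. -/
noncomputable def chainMul (hn : 0 < n) (D : Diagram 0 (2 * n)) :
    (Tail M.B n →₀ R) →ₗ[R] (Chain M.B n →₀ R) :=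
  Finsupp.linearCombination R fun p => match p with
    | ([], x) => chainBase R M.B n (M.act D x)
    | (A' :: w, x) => Finsupp.single (.bar hn (D.comp A') w x) (a ^ D.loops A')

/-- The differential on tails. -/
noncomputable def tailDiff : (Tail M.B n →₀ R) →ₗ[R] (Tail M.B n →₀ R) :=
  Finsupp.linearCombination R fun p => tailD a M p.1 p.2

/-- The differential of the augmented bar construction. -/
noncomputable def barDiff : (Chain M.B n →₀ R) →ₗ[R] (Chain M.B n →₀ R) :=
  Finsupp.linearCombination R (chainD a M)

variable {M}

/-- Two linear maps agree if they agree on basis elements. -/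
theorem linear_congr {β X : Type*} [AddCommMonoid X] [Module R X] {f g : (β →₀ R) →ₗ[R] X}
    (h : ∀ b, f (Finsupp.single b 1) = g (Finsupp.single b 1)) (v : β →₀ R) : f v = g v := by
  have : f = g := by
    ext1 b; ext1
    exact h b
  rw [this]

theorem tailMul_nil (A : Diagram (2 * n) (2 * n)) (v) :
    tailMul a M A (tailNil R M.B n v) = tailNil R M.B n (M.actMap A v) :=
  linear_congr (f := tailMul a M A ∘ₗ tailNil R M.B n) (g := tailNil R M.B n ∘ₗ M.actMap A)
    (fun x => by simp [tailNil_single, tailMul, M.actMap_single]) v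

theorem tailMul_cons (A B : Diagram (2 * n) (2 * n)) (v) :
    tailMul a M A (tailCons R B v) = a ^ A.loops B • tailCons R (A.comp B) v :=
  linear_congr (f := tailMul a M A ∘ₗ tailCons R B) (g := a ^ A.loops B • tailCons R (A.comp B))
    (fun x => by simp [tailCons_single, tailMul]) v

theorem chainMul_nil (hn : 0 < n) (D : Diagram 0 (2 * n)) (v) :
    chainMul a M hn D (tailNil R M.B n v) = chainBase R M.B n (M.actMap D v) :=
  linear_congr (f := chainMul a M hn D ∘ₗ tailNil R M.B n) (g := chainBase R M.B n ∘ₗ M.actMap D)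
    (fun x => by simp [tailNil_single, chainMul, M.actMap_single]) v

theorem chainMul_cons (hn : 0 < n) (D : Diagram 0 (2 * n)) (B : Diagram (2 * n) (2 * n)) (v) :
    chainMul a M hn D (tailCons R B v) = a ^ D.loops B • chainCons R hn (D.comp B) v :=
  linear_congr (f := chainMul a M hn D ∘ₗ tailCons R B)
    (g := a ^ D.loops B • chainCons R hn (D.comp B))
    (fun x => by simp [tailCons_single, chainMul, chainCons_single]) v

theorem tailDiff_nil (v) : tailDiff a M (tailNil R M.B n v) = 0 :=
  linear_congr (f := tailDiff a M ∘ₗ tailNil R M.B n) (g := 0)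
    (fun x => by simp [tailNil_single, tailDiff, tailD]) v

/-- The first face is split off and the others are shifted by one place, which reverses their signs.
With this recursion the identities for the differential follow by induction on the length, without
sums over faces. -/
theorem tailDiff_cons (A : Diagram (2 * n) (2 * n)) (v) :
    tailDiff a M (tailCons R A v) = tailMul a M A v - tailCons R A (tailDiff a M v) :=
  linear_congr (f := tailDiff a M ∘ₗ tailCons R A)
    (g := tailMul a M A - tailCons R A ∘ₗ tailDiff a M)
    (fun ⟨w, x⟩ => by
      cases w <;>
      simp [tailDiff, tailD, tailMul, tailNil, tailCons]) v

theorem barDiff_base (v) : barDiff a M (chainBase R M.B n v) = 0 :=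
  linear_congr (f := barDiff a M ∘ₗ chainBase R M.B n) (g := 0)
    (fun x => by simp [chainBase_single, barDiff, chainD]) v

theorem barDiff_cons (hn : 0 < n) (D : Diagram 0 (2 * n)) (v) :
    barDiff a M (chainCons R hn D v) = chainMul a M hn D v - chainCons R hn D (tailDiff a M v) :=
  linear_congr (f := barDiff a M ∘ₗ chainCons R hn D)
    (g := chainMul a M hn D - chainCons R hn D ∘ₗ tailDiff a M)
    (fun ⟨w, x⟩ => by
      cases w <;>
      simp [barDiff, chainD, chainMul, tailDiff, chainBase, chainCons, tailD]) v

variable {a}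
variable (hM : M.IsModule a)
include hM

/-- Only the first entry is affected. If it is the last one as well, this is a law of `M`; otherwise
it is associativity, with exponents matched by `loops_cocycle`. -/
theorem tailMul_tailMul (A B : Diagram (2 * n) (2 * n)) (v) :
    tailMul a M A (tailMul a M B v) = a ^ A.loops B • tailMul a M (A.comp B) v := by
  refine LinearMap.congr_fun (f := tailMul a M A ∘ₗ tailMul a M B)
    (g := a ^ A.loops B • tailMul a M (A.comp B)) (tail_ext (fun v => ?_) fun C v _ => ?_) v
  · simp only [LinearMap.comp_apply, LinearMap.smul_apply, tailMul_nil, hM.actMap_actMap, map_smul]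
  · simp only [LinearMap.comp_apply, LinearMap.smul_apply, tailMul_cons, map_smul, smul_smul,
      ← pow_add, Diagram.comp_assoc]
    rw [loops_cocycle]

theorem chainMul_tailMul (hn : 0 < n) (D : Diagram 0 (2 * n)) (B : Diagram (2 * n) (2 * n)) (v) :
    chainMul a M hn D (tailMul a M B v) = a ^ D.loops B • chainMul a M hn (D.comp B) v := by
  refine LinearMap.congr_fun (f := chainMul a M hn D ∘ₗ tailMul a M B)
    (g := a ^ D.loops B • chainMul a M hn (D.comp B)) (tail_ext (fun v => ?_) fun C v _ => ?_) v
  · simp only [LinearMap.comp_apply, LinearMap.smul_apply, tailMul_nil, chainMul_nil,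
      hM.actMap_actMap, map_smul]
  · simp only [LinearMap.comp_apply, LinearMap.smul_apply, tailMul_cons, chainMul_cons, map_smul,
      smul_smul, ← pow_add, Diagram.comp_assoc]
    rw [loops_cocycle]

/-- The face at the first entry is compatible by associativity, and the remaining faces do not
involve the first entry. -/
theorem tailDiff_tailMul (A : Diagram (2 * n) (2 * n)) (v) :
    tailDiff a M (tailMul a M A v) = tailMul a M A (tailDiff a M v) := by
  refine LinearMap.congr_fun (f := tailDiff a M ∘ₗ tailMul a M A)
    (g := tailMul a M A ∘ₗ tailDiff a M) (tail_ext (fun v => ?_) fun C v _ => ?_) v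
  · simp only [LinearMap.comp_apply, tailMul_nil, tailDiff_nil, map_zero]
  · simp only [LinearMap.comp_apply, tailMul_cons, tailDiff_cons, map_smul, map_sub,
      tailMul_tailMul hM, smul_sub]

theorem barDiff_chainMul (hn : 0 < n) (D : Diagram 0 (2 * n)) (v) :
    barDiff a M (chainMul a M hn D v) = chainMul a M hn D (tailDiff a M v) := by
  refine LinearMap.congr_fun (f := barDiff a M ∘ₗ chainMul a M hn D)
    (g := chainMul a M hn D ∘ₗ tailDiff a M) (tail_ext (fun v => ?_) fun C v _ => ?_) v
  · simp only [LinearMap.comp_apply, chainMul_nil, tailDiff_nil, barDiff_base, map_zero]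
  · simp only [LinearMap.comp_apply, chainMul_cons, tailDiff_cons, barDiff_cons, map_smul, map_sub,
      chainMul_tailMul hM, smul_sub]

/-- In short notation `d(A|v) = Av - (A|dv)`, hence `dd(A|v) = d(Av) - A(dv) + (A|ddv)`. The first
two terms cancel since `d` commutes with multiplication by `A`, and the last one vanishes by
induction. -/
theorem tailDiff_tailDiff (v : Tail M.B n →₀ R) : tailDiff a M (tailDiff a M v) = 0 := by
  refine LinearMap.congr_fun (f := tailDiff a M ∘ₗ tailDiff a M) (g := 0)
    (tail_ext (fun v => ?_) fun C v h => ?_) v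
  · simp only [LinearMap.comp_apply, tailDiff_nil, map_zero, LinearMap.zero_apply]
  · simp only [LinearMap.comp_apply, LinearMap.zero_apply] at h ⊢
    simp only [tailDiff_cons, map_sub, tailDiff_tailMul hM, h, map_zero, sub_zero, sub_self]

theorem barDiff_barDiff (v : Chain M.B n →₀ R) : barDiff a M (barDiff a M v) = 0 := by
  refine LinearMap.congr_fun (f := barDiff a M ∘ₗ barDiff a M) (g := 0)
    (chain_ext (fun v => ?_) fun hn D v => ?_) v
  · simp only [LinearMap.comp_apply, barDiff_base, map_zero, LinearMap.zero_apply]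
  · simp only [LinearMap.comp_apply, LinearMap.zero_apply, barDiff_cons, map_sub,
      barDiff_chainMul hM, tailDiff_tailDiff hM, map_zero, sub_zero, sub_self]

end BarOperators

/-! ### The action of the dga of planar loops -/

section BarAction

variable {R : Type*} [CommRing R] (a : R) (M : TLData R) {n : ℕ}

/-- The action on `M` of diagrams in `TL(2n, 0)`, as the last entry of an element of `L(2n)`. -/
noncomputable def headAct (E : Diagram (2 * n) 0) : (Chain M.B n →₀ R) →ₗ[R] (Tail M.B n →₀ R) :=
  Finsupp.linearCombination R fun b => match b with
    | .base y => tailNil R M.B n (M.act E y)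
    | .bar _ D w x => Finsupp.single (E.comp D :: w, x) (a ^ E.loops D)

/-- The action of a tail of an element of `L(2n)`. -/
noncomputable def tailAct : (Tail (fun m => Diagram m 0) n →₀ R) →ₗ[R]
    (Chain M.B n →₀ R) →ₗ[R] (Tail M.B n →₀ R) :=
  Finsupp.linearCombination R fun p =>
    Finsupp.lmapDomain R R (fun q => (p.1 ++ q.1, q.2)) ∘ₗ headAct a M p.2

/-- The action of `L(2n)`. -/
noncomputable def barAct : (LoopBasis n →₀ R) →ₗ[R]
    (Chain M.B n →₀ R) →ₗ[R] (Chain M.B n →₀ R) :=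
  Finsupp.linearCombination R fun r => Finsupp.linearCombination R (chainAct a M r)

variable {M}

theorem headAct_base (E : Diagram (2 * n) 0) (v) :
    headAct a M E (chainBase R M.B n v) = tailNil R M.B n (M.actMap E v) :=
  linear_congr (f := headAct a M E ∘ₗ chainBase R M.B n) (g := tailNil R M.B n ∘ₗ M.actMap E)
    (fun x => by simp [chainBase_single, headAct, M.actMap_single]) v

theorem headAct_cons (E : Diagram (2 * n) 0) (hn : 0 < n) (D : Diagram 0 (2 * n)) (v) :
    headAct a M E (chainCons R hn D v) = a ^ E.loops D • tailCons R (E.comp D) v :=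
  linear_congr (f := headAct a M E ∘ₗ chainCons R hn D)
    (g := a ^ E.loops D • tailCons R (E.comp D))
    (fun x => by simp [chainCons_single, headAct, tailCons_single]) v

theorem tailAct_single_nil (E : Diagram (2 * n) 0) (r : R) (y) :
    tailAct a M (Finsupp.single ([], E) r) y = r • headAct a M E y := by
  have h : (fun q : Tail M.B n => q) = id := rfl
  simp [tailAct, h]

theorem tailAct_cons (A : Diagram (2 * n) (2 * n)) (v) (y) :
    tailAct a M (tailCons R A v) y = tailCons R A (tailAct a M v y) := by
  refine linear_congr (f := (tailAct a M ∘ₗ tailCons R A).flip y)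
    (g := tailCons R A ∘ₗ (tailAct a M).flip y) (fun p => ?_) v
  simp [tailAct, tailCons, ← Finsupp.mapDomain_comp, Function.comp_def]

theorem barAct_base (e : Diagram 0 0) (r : R) (y : Chain M.B n →₀ R) :
    barAct a M (Finsupp.single (.base e) r) y = r • y :=
  linear_congr (f := barAct a M (Finsupp.single (.base e) r)) (g := r • LinearMap.id)
    (fun x => by simp [barAct, chainAct]) y

theorem barAct_cons (hn : 0 < n) (D : Diagram 0 (2 * n)) (v) (y) :
    barAct a M (chainCons R hn D v) y = chainCons R hn D (tailAct a M v y) := by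
  refine linear_congr (f := (barAct a M ∘ₗ chainCons R hn D).flip y)
    (g := chainCons R hn D ∘ₗ (tailAct a M).flip y) (fun p => ?_) v
  refine linear_congr (f := barAct a M (chainCons R hn D (Finsupp.single p 1)))
    (g := chainCons R hn D ∘ₗ tailAct a M (Finsupp.single p 1)) (fun b => ?_) y
  rcases b with b | b <;>
  simp [barAct, chainAct, tailAct, headAct, chainCons, tailNil,
    ← Finsupp.mapDomain_comp, Function.comp_def]

end BarAction

/-! ### Laws of the coefficient modules and the Leibniz rule -/

section Laws

variable {R : Type*} [CommRing R] {a : R} {n : ℕ}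

variable (a) in
/-- The module `m ↦ TL(m, 0)`, in reducible form. -/
noncomputable abbrev loopData : TLData R where
  B m := Diagram m 0
  act D E := Finsupp.single (D.comp E) (a ^ D.loops E)
  close E := E
  closeLoops _ := 0

/-- Composition of a diagram with a diagram with dashed cups, which are kept. -/
noncomputable def Dashed.lcomp {i k m : ℕ} (D : Diagram k m) (x : Dashed i m) : Dashed i k :=
  ⟨(D.comp x.diagram, x.dashes), fun j hj => (x.2 j hj).comp D⟩

theorem Dashed.diagram_lcomp {i k m : ℕ} (D : Diagram k m) (x : Dashed i m) :
    (x.lcomp D).diagram = D.comp x.diagram := rfl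

variable (a) in
/-- The module `m ↦ ⨁_p Inn_p(m, 2i)`, in reducible form. -/
noncomputable abbrev dashedData (i : ℕ) : TLData R where
  B := Dashed i
  act D x := Finsupp.single (x.lcomp D) (a ^ D.loops x.diagram)
  close x := x.diagram.comp (Diagram.leftMax i)
  closeLoops x := x.diagram.loops (Diagram.leftMax i)

open Classical in
variable (a) in
/-- The module `m ↦ S(m, 2i)`, in reducible form. -/
noncomputable abbrev quotientData (i : ℕ) : TLData R where
  B m := {D : Diagram m (2 * i) // D.NoRightCup}
  act D x := if h : (D.comp x.1).NoRightCup then Finsupp.single ⟨_, h⟩ (a ^ D.loops x.1) else 0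
  close x := x.1.comp (Diagram.leftMax i)
  closeLoops x := x.1.loops (Diagram.leftMax i)

theorem loopData_act {k m : ℕ} (D : Diagram k m) (E : Diagram m 0) :
    (loopData a).act D E = Finsupp.single (D.comp E) (a ^ D.loops E) := rfl

theorem dashedData_act (i : ℕ) {k m : ℕ} (D : Diagram k m) (x : Dashed i m) :
    (dashedData a i).act D x = Finsupp.single (x.lcomp D) (a ^ D.loops x.diagram) := rfl

theorem loopData_isModule : (loopData a).IsModule a where
  act_act {k l m} D E x := by
    rw [TLData.actMap, loopData_act, Finsupp.linearCombination_single, loopData_act, loopData_act,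
      Finsupp.smul_single, Finsupp.smul_single,
      smul_eq_mul, smul_eq_mul, ← pow_add, ← pow_add, loops_cocycle, Diagram.comp_assoc]
  act_empty e x := by
    rw [loopData_act, empty_comp, loops_empty_middle, pow_zero]

theorem loopData_isWeighted (l : ℕ) : (loopData a).IsWeighted a fun _ _ => l :=
  fun D x => Or.inr ⟨D.comp x, D.loops x, rfl, rfl, rfl, by simp⟩

theorem dashedData_isModule (i : ℕ) : (dashedData a i).IsModule a where
  act_act {k l m} D E x := by
    rw [TLData.actMap, dashedData_act, Finsupp.linearCombination_single, dashedData_act,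
      dashedData_act, Finsupp.smul_single, Finsupp.smul_single, smul_eq_mul, smul_eq_mul, ← pow_add,
      ← pow_add, Dashed.diagram_lcomp, loops_cocycle]
    congr 1
    exact Dashed.ext (Diagram.comp_assoc _ _ _).symm rfl
  act_empty e x := by
    rw [dashedData_act, loops_empty_middle, pow_zero]
    congr 1
    exact Dashed.ext (empty_comp _ _) rfl

theorem dashedData_isWeighted (i : ℕ) :
    (dashedData a i).IsWeighted a fun _ x => Finset.card (Dashed.dashes x) := by
  intro k m D x
  refine Or.inr ⟨_, _, rfl, rfl, Diagram.comp_assoc D x.diagram (Diagram.leftMax i), ?_⟩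
  exact (loops_cocycle D x.diagram (Diagram.leftMax i))

/-- Right cups survive composition on the left. Hence the diagrams with a right cup span a
submodule, and the cell module inherits the action. -/
theorem Diagram.NoRightCup.of_comp {k l m : ℕ} {D : Diagram k l} {E : Diagram l m}
    (h : (D.comp E).NoRightCup) : E.NoRightCup := fun j k hjk =>
  h j k (Diagram.comp_partner_inr D E hjk)

theorem quotientData_act_of_noRightCup {i k m : ℕ} {D : Diagram k m} {x : (quotientData a i).B m}
    (h : (D.comp x.1).NoRightCup) :
    (quotientData a i).act D x = Finsupp.single ⟨_, h⟩ (a ^ D.loops x.1) := by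
  simp only
  rw [dif_pos h]

theorem quotientData_act_of_rightCup {i k m : ℕ} {D : Diagram k m} {x : (quotientData a i).B m}
    (h : ¬ (D.comp x.1).NoRightCup) : (quotientData a i).act D x = 0 := by
  simp only
  rw [dif_neg h]

theorem quotientData_isModule (i : ℕ) : (quotientData a i).IsModule a where
  act_act {k l m} D E x := by
    by_cases h : (E.comp x.1).NoRightCup
    · rw [quotientData_act_of_noRightCup h, TLData.actMap, Finsupp.linearCombination_single]
      by_cases h' : (D.comp (E.comp x.1)).NoRightCup
      · have h'' : ((D.comp E).comp x.1).NoRightCup := by rwa [Diagram.comp_assoc]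
        rw [quotientData_act_of_noRightCup h', quotientData_act_of_noRightCup h'', Finsupp.smul_single,
          Finsupp.smul_single, smul_eq_mul, smul_eq_mul, ← pow_add, ← pow_add, loops_cocycle]
        congr 1
        exact Subtype.ext (Diagram.comp_assoc _ _ _).symm
      · have h'' : ¬ ((D.comp E).comp x.1).NoRightCup := by rwa [Diagram.comp_assoc]
        rw [quotientData_act_of_rightCup h', quotientData_act_of_rightCup h'', smul_zero, smul_zero]
    · have h'' : ¬ ((D.comp E).comp x.1).NoRightCup := by
        rw [Diagram.comp_assoc]
        exact fun h' => h h'.of_comp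
      rw [quotientData_act_of_rightCup h, quotientData_act_of_rightCup h'', smul_zero, map_zero]
  act_empty e x := by
    have h : (e.comp x.1).NoRightCup := by rw [empty_comp]; exact x.2
    rw [quotientData_act_of_noRightCup h, loops_empty_middle, pow_zero]
    congr 1
    exact Subtype.ext (empty_comp _ _)

theorem quotientData_isWeighted (i : ℕ) : (quotientData a i).IsWeighted a fun _ _ => 0 := by
  intro k m D x
  by_cases h : (D.comp x.1).NoRightCup
  · refine Or.inr ⟨_, _, quotientData_act_of_noRightCup h, rfl,
      Diagram.comp_assoc D x.1 (Diagram.leftMax i), ?_⟩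
    exact (loops_cocycle D x.1 (Diagram.leftMax i))
  · exact Or.inl (quotientData_act_of_rightCup h)

variable {M : TLData R} (hM : M.IsModule a)
include hM

theorem tailMul_headAct (A : Diagram (2 * n) (2 * n)) (E : Diagram (2 * n) 0) (y) :
    tailMul a M A (headAct a M E y) = a ^ A.loops E • headAct a M (A.comp E) y := by
  refine LinearMap.congr_fun (f := tailMul a M A ∘ₗ headAct a M E)
    (g := a ^ A.loops E • headAct a M (A.comp E)) (chain_ext (fun v => ?_) fun hn D v => ?_) y
  · simp only [LinearMap.comp_apply, LinearMap.smul_apply, headAct_base, tailMul_nil,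
      hM.actMap_actMap, map_smul]
  · simp only [LinearMap.comp_apply, LinearMap.smul_apply, headAct_cons, tailMul_cons, map_smul,
      smul_smul, ← pow_add, Diagram.comp_assoc]
    rw [loops_cocycle]

/-- The product of `D` and `E` lies in `TL(0, 0)`, where only the empty diagram and loops remain.
This is the face by which an element of degree one in `L(2n)` is sent to a scalar. -/
theorem chainMul_headAct (hn : 0 < n) (D : Diagram 0 (2 * n)) (E : Diagram (2 * n) 0) (y) :
    chainMul a M hn D (headAct a M E y) = a ^ D.loops E • y := by
  refine LinearMap.congr_fun (f := chainMul a M hn D ∘ₗ headAct a M E)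
    (g := a ^ D.loops E • LinearMap.id) (chain_ext (fun v => ?_) fun hn' D' v => ?_) y
  · simp only [LinearMap.comp_apply, LinearMap.smul_apply, headAct_base, chainMul_nil,
      hM.actMap_actMap, map_smul, hM.actMap_empty, LinearMap.id_apply]
  · simp only [LinearMap.comp_apply, LinearMap.smul_apply, headAct_cons, chainMul_cons, map_smul,
      smul_smul, ← pow_add, LinearMap.id_apply]
    rw [← Diagram.comp_assoc, empty_comp, ← loops_cocycle, loops_empty_middle (D.comp E), add_zero]

theorem tailMul_tailAct (A : Diagram (2 * n) (2 * n)) (v) (y) :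
    tailMul a M A (tailAct a M v y) = tailAct a M (tailMul a (loopData a) A v) y := by
  refine LinearMap.congr_fun (f := tailMul a M A ∘ₗ (tailAct a M).flip y)
    (g := (tailAct a M).flip y ∘ₗ tailMul a (loopData a) A) (tail_ext (fun E => ?_)
      fun C v _ => ?_) v
  · simp only [LinearMap.comp_apply, LinearMap.flip_apply]
    rw [tailMul_nil, TLData.actMap_single]
    rw [tailNil_single, tailNil_single, tailAct_single_nil, tailAct_single_nil, one_smul,
      tailMul_headAct hM]
  · simp only [LinearMap.comp_apply, LinearMap.flip_apply]
    rw [tailAct_cons, tailMul_cons (M := loopData a), tailMul_cons, map_smul,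
      LinearMap.smul_apply, tailAct_cons]

theorem chainMul_tailAct (hn : 0 < n) (D : Diagram 0 (2 * n)) (v) (y) :
    chainMul a M hn D (tailAct a M v y) = barAct a M (chainMul a (loopData a) hn D v) y := by
  refine LinearMap.congr_fun (f := chainMul a M hn D ∘ₗ (tailAct a M).flip y)
    (g := (barAct a M).flip y ∘ₗ chainMul a (loopData a) hn D) (tail_ext (fun E => ?_)
      fun C v _ => ?_) v
  · simp only [LinearMap.comp_apply, LinearMap.flip_apply]
    rw [chainMul_nil, TLData.actMap_single]
    change _ = barAct a M (chainBase R _ n (Finsupp.single (D.comp E) (a ^ D.loops E))) y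
    rw [chainBase_single, barAct_base, tailNil_single, tailAct_single_nil, one_smul,
      chainMul_headAct hM]
  · simp only [LinearMap.comp_apply, LinearMap.flip_apply]
    rw [tailAct_cons, chainMul_cons (M := loopData a), chainMul_cons, map_smul,
      LinearMap.smul_apply, barAct_cons]

theorem headAct_chainMul (E : Diagram (2 * n) 0) (hn : 0 < n) (D : Diagram 0 (2 * n)) (v) :
    headAct a M E (chainMul a M hn D v) = a ^ E.loops D • tailMul a M (E.comp D) v := by
  refine LinearMap.congr_fun (f := headAct a M E ∘ₗ chainMul a M hn D)
    (g := a ^ E.loops D • tailMul a M (E.comp D)) (tail_ext (fun v => ?_) fun C v _ => ?_) v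
  · simp only [LinearMap.comp_apply, LinearMap.smul_apply, chainMul_nil, headAct_base, tailMul_nil,
      hM.actMap_actMap, map_smul]
  · simp only [LinearMap.comp_apply, LinearMap.smul_apply, chainMul_cons, headAct_cons,
      tailMul_cons, map_smul, smul_smul, ← pow_add, Diagram.comp_assoc]
    rw [loops_cocycle]

theorem tailDiff_headAct (E : Diagram (2 * n) 0) (y) :
    tailDiff a M (headAct a M E y) = headAct a M E (barDiff a M y) := by
  refine LinearMap.congr_fun (f := tailDiff a M ∘ₗ headAct a M E)
    (g := headAct a M E ∘ₗ barDiff a M) (chain_ext (fun v => ?_) fun hn D v => ?_) y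
  · simp only [LinearMap.comp_apply, headAct_base, tailDiff_nil, barDiff_base, map_zero]
  · simp only [LinearMap.comp_apply, headAct_cons, tailDiff_cons, barDiff_cons, map_smul, map_sub,
      headAct_chainMul hM, smul_sub]

/-- Each diagram put in front of a tail contributes one sign. The exponent is one less than the
degree of the full chain, because the entry in `TL(0, 2n)` is still missing. -/
theorem tailDiff_tailAct (p : Tail (fun m => Diagram m 0) n) (y) :
    tailDiff a M (tailAct a M (Finsupp.single p 1) y) =
      tailAct a M (tailDiff a (loopData a) (Finsupp.single p 1)) y +
        (-1 : R) ^ p.1.length • tailAct a M (Finsupp.single p 1) (barDiff a M y) := by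
  obtain ⟨w, E⟩ := p
  induction w with
  | nil =>
    have h := tailDiff_nil a (M := loopData a) (Finsupp.single E 1)
    rw [tailNil_single] at h
    rw [h]
    simp [tailAct_single_nil, tailDiff_headAct hM]
  | cons A w ih =>
    have h := tailDiff_cons a (M := loopData a) A (Finsupp.single (w, E) 1)
    have h' := tailCons_single (R := R) (B := fun m => Diagram m 0) A (w, E) 1
    rw [← h', tailAct_cons, tailAct_cons, tailDiff_cons, ih, tailMul_tailAct hM]
    erw [h]
    rw [map_sub, LinearMap.sub_apply, tailAct_cons, map_add, map_smul, List.length_cons, pow_succ]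
    simp only [mul_neg, mul_one, neg_smul]
    abel

/-- The first face is handled by `chainMul_tailAct`, the others by the Leibniz rule for tails, whose
sign is reversed once more by the additional first entry. -/
theorem barDiff_barAct (r : LoopBasis n) (y) :
    barDiff a M (barAct a M (Finsupp.single r 1) y) =
      barAct a M (barDiff a (loopData a) (Finsupp.single r 1)) y +
        (-1 : R) ^ r.deg • barAct a M (Finsupp.single r 1) (barDiff a M y) := by
  rcases r with e | ⟨hn, D, w, E⟩
  · have h := barDiff_base a (M := loopData a) (n := n) (Finsupp.single e 1)
    rw [chainBase_single] at h
    rw [h]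
    simp [barAct_base, Chain.deg]
  · have h := barDiff_cons a (M := loopData a) hn D (Finsupp.single (w, E) 1)
    have h' := chainCons_single (R := R) (B := fun m => Diagram m 0) hn D (w, E) 1
    rw [← h', barAct_cons, barAct_cons, barDiff_cons, tailDiff_tailAct hM, chainMul_tailAct hM]
    erw [h]
    rw [map_sub, LinearMap.sub_apply, barAct_cons, map_add, map_smul, Chain.deg, pow_succ]
    simp only [mul_neg, mul_one, neg_smul]
    abel

omit hM in
theorem headAct_barAct (E : Diagram (2 * n) 0) (s y) :
    tailAct a M (headAct a (loopData a) E s) y = headAct a M E (barAct a M s y) := by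
  refine LinearMap.congr_fun (f := (tailAct a M).flip y ∘ₗ headAct a (loopData a) E)
    (g := headAct a M E ∘ₗ (barAct a M).flip y) (chain_ext (fun e => ?_) fun hn D v => ?_) s
  · simp only [LinearMap.comp_apply, LinearMap.flip_apply]
    rw [headAct_base, TLData.actMap_single, chainBase_single, barAct_base, one_smul]
    change tailAct a M (tailNil R _ n (Finsupp.single (E.comp e) (a ^ E.loops e))) y = _
    rw [tailNil_single, tailAct_single_nil, loops_empty_middle, pow_zero, one_smul, comp_empty]
  · simp only [LinearMap.comp_apply, LinearMap.flip_apply]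
    rw [headAct_cons (M := loopData a), map_smul, LinearMap.smul_apply, tailAct_cons, barAct_cons,
      headAct_cons]

omit hM in
theorem tailAct_tailAct (v s y) :
    tailAct a M (tailAct (n := n) a (loopData a) v s) y = tailAct a M v (barAct a M s y) := by
  refine LinearMap.congr_fun (f := (tailAct a M).flip y ∘ₗ (tailAct a (loopData a)).flip s)
    (g := (tailAct a M).flip (barAct a M s y)) (tail_ext (fun E => ?_) fun A v h => ?_) v
  · simp only [LinearMap.comp_apply, LinearMap.flip_apply]
    rw [tailNil_single, tailAct_single_nil, tailAct_single_nil, one_smul, one_smul, headAct_barAct]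
  · simp only [LinearMap.comp_apply, LinearMap.flip_apply] at h ⊢
    rw [tailAct_cons (M := loopData a), tailAct_cons, tailAct_cons, h]

omit hM in
-- The gluing of `r` to `s` and that of `s` to `y` take place at different bars. Only factors of
-- degree zero are special; they are multiples of the empty diagram, which acts trivially.
theorem barAct_barAct (r s y) :
    barAct a M (barAct (n := n) a (loopData a) r s) y = barAct a M r (barAct a M s y) := by
  refine LinearMap.congr_fun (f := (barAct a M).flip y ∘ₗ (barAct a (loopData a)).flip s)
    (g := (barAct a M).flip (barAct a M s y)) (chain_ext (fun E => ?_) fun hn D v => ?_) r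
  · simp only [LinearMap.comp_apply, LinearMap.flip_apply]
    rw [chainBase_single, barAct_base, barAct_base, one_smul, one_smul]
  · simp only [LinearMap.comp_apply, LinearMap.flip_apply]
    rw [barAct_cons (M := loopData a), barAct_cons, barAct_cons, tailAct_tailAct]

end Laws

/-! ### Homogeneous elements of free modules on weighted bases -/

section Homogeneous

variable {R : Type*} [CommRing R] (𝒜 : ℕ → AddSubgroup R)

/-- The elements of weight `w` that are supported on `P`, where basis elements have weights and the
scalars are graded by `𝒜`. -/
noncomputable def homPart {β : Type} (wt : β → ℕ) (P : Set β) (w : ℕ) : AddSubgroup (β →₀ R) :=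
  AddSubgroup.closure
    {x | ∃ b j, ∃ r ∈ 𝒜 j, b ∈ P ∧ j + wt b = w ∧ x = Finsupp.single b r}

variable {𝒜} {β γ : Type} {wt : β → ℕ} {wt' : γ → ℕ} {P P' : Set β} {Q : Set γ} {w s : ℕ}

theorem homPart_mono (h : P ⊆ P') : homPart 𝒜 wt P w ≤ homPart 𝒜 wt P' w :=
  AddSubgroup.closure_mono fun _ ⟨b, j, r, hr, hb, hw, hx⟩ => ⟨b, j, r, hr, h hb, hw, hx⟩

theorem single_mem_homPart {b : β} {j : ℕ} {r : R} (hr : r ∈ 𝒜 j) (hb : b ∈ P)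
    (hw : j + wt b = w) : Finsupp.single b r ∈ homPart 𝒜 wt P w :=
  AddSubgroup.subset_closure ⟨b, j, r, hr, hb, hw, rfl⟩

theorem homPart_le_supported : homPart 𝒜 wt P w ≤ (Finsupp.supported R R P).toAddSubgroup := by
  refine (AddSubgroup.closure_le _).2 ?_
  rintro _ ⟨b, j, r, hr, hb, hw, rfl⟩
  exact Finsupp.single_mem_supported R r hb

theorem homPart_shift (s : ℕ) {x : β →₀ R} (hx : x ∈ homPart 𝒜 wt P w) :
    x ∈ homPart 𝒜 (fun b => wt b + s) P (w + s) := by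
  refine (AddSubgroup.closure_le _).2 ?_ hx
  rintro _ ⟨b, j, r, hr, hb, rfl, rfl⟩
  exact single_mem_homPart hr hb (add_assoc _ _ _).symm

variable [SetLike.GradedMonoid 𝒜]

theorem single_one_mem_homPart {b : β} (hb : b ∈ P) :
    Finsupp.single b 1 ∈ homPart 𝒜 wt P (wt b) :=
  single_mem_homPart SetLike.GradedOne.one_mem hb (zero_add _)

theorem single_pow_mem_homPart {a : R} (ha : a ∈ 𝒜 1) {b : β} {c : ℕ} (hb : b ∈ P)
    (hw : c + wt b = w) : Finsupp.single b (a ^ c) ∈ homPart 𝒜 wt P w := by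
  refine single_mem_homPart ?_ hb hw
  simpa using SetLike.pow_mem_graded c ha

theorem smul_mem_homPart {r : R} {j : ℕ} (hr : r ∈ 𝒜 j) {x : β →₀ R}
    (hx : x ∈ homPart 𝒜 wt P w) : r • x ∈ homPart 𝒜 wt P (j + w) := by
  induction hx using AddSubgroup.closure_induction with
  | mem x hx =>
    obtain ⟨b, j', r', hr', hb, rfl, rfl⟩ := hx
    rw [Finsupp.smul_single, smul_eq_mul]
    exact single_mem_homPart (SetLike.GradedMul.mul_mem hr hr') hb (add_assoc _ _ _)
  | zero => rw [smul_zero]; exact zero_mem _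
  | add x y _ _ hx hy => rw [smul_add]; exact add_mem hx hy
  | neg x _ hx => rw [smul_neg]; exact neg_mem hx

theorem pow_smul_mem_homPart {a : R} (ha : a ∈ 𝒜 1) {c w' : ℕ} {x : β →₀ R}
    (hx : x ∈ homPart 𝒜 wt P w) (hw : c + w = w') : a ^ c • x ∈ homPart 𝒜 wt P w' := by
  subst hw
  refine smul_mem_homPart ?_ hx
  simpa using SetLike.pow_mem_graded c ha

/-- A linear map is homogeneous if it is so on basis elements. -/
theorem map_mem_homPart {f : (β →₀ R) →ₗ[R] (γ →₀ R)}
    (h : ∀ b ∈ P, f (Finsupp.single b 1) ∈ homPart 𝒜 wt' Q (wt b + s)) {x : β →₀ R}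
    (hx : x ∈ homPart 𝒜 wt P w) : f x ∈ homPart 𝒜 wt' Q (w + s) := by
  induction hx using AddSubgroup.closure_induction with
  | mem x hx =>
    obtain ⟨b, j, r, hr, hb, rfl, rfl⟩ := hx
    rw [← mul_one r, ← smul_eq_mul, ← Finsupp.smul_single, map_smul, add_assoc]
    exact smul_mem_homPart hr (h b hb)
  | zero => rw [map_zero]; exact zero_mem _
  | add x y _ _ hx hy => rw [map_add]; exact add_mem hx hy
  | neg x _ hx => rw [map_neg]; exact neg_mem hx

theorem neg_one_pow_smul_mem {S : AddSubgroup (β →₀ R)} {x : β →₀ R} (hx : x ∈ S) (p : ℕ) :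
    (-1 : R) ^ p • x ∈ S := by
  rcases neg_one_pow_eq_or R p with h | h <;> rw [h]
  · rwa [one_smul]
  · rw [neg_smul, one_smul]; exact neg_mem hx

/-- The trivial grading datum, for which weights are not restricted. -/
instance topGraded : SetLike.GradedMonoid (fun _ : ℕ => (⊤ : AddSubgroup R)) where
  one_mem := trivial
  mul_mem _ _ _ _ _ _ := trivial

theorem map_mem_supported {f : (β →₀ R) →ₗ[R] (γ →₀ R)}
    (h : ∀ b ∈ P, f (Finsupp.single b 1) ∈ Finsupp.supported R R Q) {x : β →₀ R}
    (hx : x ∈ Finsupp.supported R R P) : f x ∈ Finsupp.supported R R Q := by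
  rw [Finsupp.supported_eq_span_single] at hx
  induction hx using Submodule.span_induction with
  | mem x hx =>
    obtain ⟨b, hb, rfl⟩ := hx
    exact h b hb
  | zero => rw [map_zero]; exact zero_mem _
  | add x y _ _ hx hy => rw [map_add]; exact add_mem hx hy
  | smul r x _ hx => rw [map_smul]; exact Submodule.smul_mem _ _ hx

end Homogeneous

/-! ### Degrees and weights in the augmented bar construction -/

section BarWeights

variable {R : Type*} [CommRing R] {a : R} {𝒜 : ℕ → AddSubgroup R} {M : TLData R}
  (lab : ∀ m, M.B m → ℕ) {n : ℕ}

/-- Close a tail on the right. -/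
noncomputable def tailClose (M : TLData R) {n : ℕ} : List (Diagram (2 * n) (2 * n)) →
    M.B (2 * n) → Diagram (2 * n) 0
  | [], x => M.close x
  | A :: w, x => A.comp (tailClose M w x)

/-- The number of loops of a tail that is closed on the right. -/
noncomputable def tailWt (M : TLData R) {n : ℕ} : List (Diagram (2 * n) (2 * n)) →
    M.B (2 * n) → ℕ
  | [], x => M.closeLoops x
  | A :: w, x => tailWt M w x + A.loops (tailClose M w x)

/-- The weight is defined by gluing from the left, whereas the recursion on tails glues from the
right. The cocycle identity shows that both count the same loops. -/
theorem closeLoops_add_loopsAlong (D : Diagram 0 (2 * n)) (w) (x : M.B (2 * n)) :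
    M.closeLoops x + loopsAlong D w (M.close x) = tailWt M w x + D.loops (tailClose M w x) := by
  induction w generalizing D with
  | nil => rfl
  | cons A w ih =>
    have h1 := ih (D.comp A)
    have h2 := loops_cocycle D A (tailClose M w x)
    simp only [loopsAlong, tailWt, tailClose]
    omega

/-- The label of the last entry of a chain. -/
def chainLab : Chain M.B n → ℕ
  | .base y => lab 0 y
  | .bar _ _ _ x => lab _ x

variable (n) in
/-- The tails of length `q` and label `l` that are closed up to `X`. -/
def tailSet (q l : ℕ) (X : Diagram (2 * n) 0) : Set (Tail M.B n) :=
  {p | p.1.length = q ∧ lab _ p.2 = l ∧ tailClose M p.1 p.2 = X}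

/-- The basis elements of label `l` that are closed up to `X`. -/
def basisSet (m l : ℕ) (X : Diagram m 0) : Set (M.B m) := {y | lab m y = l ∧ M.close y = X}

variable (n) in
/-- The chains of degree `q` and label `l`. -/
def chainSet (q l : ℕ) : Set (Chain M.B n) := {b | b.deg = q ∧ chainLab lab b = l}

variable (𝒜 n) in
/-- The homogeneous tails. -/
noncomputable abbrev TailPart (q l : ℕ) (X : Diagram (2 * n) 0) (w : ℕ) : AddSubgroup (Tail M.B n →₀ R) :=
  homPart 𝒜 (fun p => tailWt M p.1 p.2) (tailSet lab n q l X) w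

variable (𝒜 n) in
/-- The homogeneous chains. -/
noncomputable abbrev ChainPart (q l w : ℕ) : AddSubgroup (Chain M.B n →₀ R) :=
  homPart 𝒜 (Chain.wt M) (chainSet lab n q l) w

variable (𝒜) in
/-- The homogeneous elements of the module of coefficients. -/
noncomputable abbrev BasisPart (m l : ℕ) (X : Diagram m 0) (w : ℕ) : AddSubgroup (M.B m →₀ R) :=
  homPart 𝒜 M.closeLoops (basisSet lab m l X) w

variable {lab} [SetLike.GradedMonoid 𝒜] {q l w : ℕ} {X : Diagram (2 * n) 0}

theorem tailNil_mem {v} (hv : v ∈ BasisPart 𝒜 lab (2 * n) l X w) :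
    tailNil R M.B n v ∈ TailPart 𝒜 lab n 0 l X w := by
  refine map_mem_homPart (s := 0) (fun x hx => ?_) hv
  rw [tailNil_single]
  exact single_one_mem_homPart (b := (([], x) : Tail M.B n)) ⟨rfl, hx.1, hx.2⟩

theorem tailCons_mem (A : Diagram (2 * n) (2 * n)) {v} (hv : v ∈ TailPart 𝒜 lab n q l X w) :
    tailCons R A v ∈ TailPart 𝒜 lab n (q + 1) l (A.comp X) (w + A.loops X) := by
  refine map_mem_homPart (fun p hp => ?_) hv
  rw [tailCons_single, ← hp.2.2]
  exact single_one_mem_homPart (b := ((A :: p.1, p.2) : Tail M.B n))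
    ⟨congrArg (· + 1) hp.1, hp.2.1, rfl⟩

theorem chainBase_mem {X : Diagram 0 0} {v} (hv : v ∈ BasisPart 𝒜 lab 0 l X w) :
    chainBase R M.B n v ∈ ChainPart 𝒜 lab n 0 l w := by
  refine map_mem_homPart (s := 0) (fun x hx => ?_) hv
  rw [chainBase_single]
  exact single_one_mem_homPart (b := (Chain.base x : Chain M.B n)) ⟨rfl, hx.1⟩

theorem chainCons_mem (hn : 0 < n) (D : Diagram 0 (2 * n)) {v}
    (hv : v ∈ TailPart 𝒜 lab n q l X w) :
    chainCons R hn D v ∈ ChainPart 𝒜 lab n (q + 1) l (w + D.loops X) := by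
  refine map_mem_homPart (fun p hp => ?_) hv
  rw [chainCons_single, ← hp.2.2, ← closeLoops_add_loopsAlong]
  exact single_one_mem_homPart (b := Chain.bar hn D p.1 p.2)
    ⟨congrArg (· + 1) hp.1, hp.2.1⟩

variable (ha : a ∈ 𝒜 1) (hw : M.IsWeighted a lab)
include ha hw

/-- The loops formed by the action, together with those formed on closing the result, are the loops
formed on closing first and acting afterwards. The label and the closed diagram are kept in the
statement because the loops formed with entries further to the left depend on the closed diagram. -/
theorem actMap_mem {k m : ℕ} {X : Diagram m 0} (D : Diagram k m) {v}
    (hv : v ∈ BasisPart 𝒜 lab m l X w) :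
    M.actMap D v ∈ BasisPart 𝒜 lab k l (D.comp X) (w + D.loops X) := by
  refine map_mem_homPart (fun x hx => ?_) hv
  rw [M.actMap_single]
  rcases hw D x with h | ⟨y, c, h, h1, h2, h3⟩
  · rw [h]; exact zero_mem _
  · rw [h]
    refine single_pow_mem_homPart ha ⟨h1.trans hx.1, by rw [h2, hx.2]⟩ (h3.trans ?_)
    rw [hx.2]

theorem act_mem {k m : ℕ} (D : Diagram k m) (x : M.B m) :
    M.act D x ∈ BasisPart 𝒜 lab k (lab m x) (D.comp (M.close x))
      (M.closeLoops x + D.loops (M.close x)) := by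
  rw [← M.actMap_single]
  exact actMap_mem ha hw D (single_one_mem_homPart ⟨rfl, rfl⟩)

theorem tailMul_mem (A : Diagram (2 * n) (2 * n)) {v} (hv : v ∈ TailPart 𝒜 lab n q l X w) :
    tailMul a M A v ∈ TailPart 𝒜 lab n q l (A.comp X) (w + A.loops X) := by
  refine map_mem_homPart (fun p hp => ?_) hv
  obtain ⟨u, x⟩ := p
  obtain ⟨rfl, rfl, rfl⟩ := hp
  rcases u with _ | ⟨B, u⟩
  · rw [← tailNil_single, tailMul_nil, M.actMap_single]
    exact tailNil_mem (act_mem ha hw A x)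
  · have h := tailCons_single (R := R) B ((u, x) : Tail M.B n) 1
    rw [← h, tailMul_cons, tailCons_single, Finsupp.smul_single, smul_eq_mul, mul_one]
    refine single_pow_mem_homPart ha ⟨rfl, rfl, Diagram.comp_assoc _ _ _⟩ ?_
    have := loops_cocycle A B (tailClose M u x)
    simp only [tailWt, tailClose]
    omega

theorem chainMul_mem (hn : 0 < n) (D : Diagram 0 (2 * n)) {v}
    (hv : v ∈ TailPart 𝒜 lab n q l X w) :
    chainMul a M hn D v ∈ ChainPart 𝒜 lab n q l (w + D.loops X) := by
  refine map_mem_homPart (fun p hp => ?_) hv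
  obtain ⟨u, x⟩ := p
  obtain ⟨rfl, rfl, rfl⟩ := hp
  rcases u with _ | ⟨B, u⟩
  · rw [← tailNil_single, chainMul_nil, M.actMap_single]
    exact chainBase_mem (act_mem ha hw D x)
  · have h := tailCons_single (R := R) B ((u, x) : Tail M.B n) 1
    rw [← h, chainMul_cons, chainCons_single, Finsupp.smul_single, smul_eq_mul, mul_one]
    refine single_pow_mem_homPart ha ⟨rfl, rfl⟩ ?_
    have h1 := loops_cocycle D B (tailClose M u x)
    have h2 := closeLoops_add_loopsAlong (D.comp B) u x
    simp only [tailWt, tailClose, Chain.wt]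
    omega

/-- Faces shorten a tail but do not change the diagram obtained by gluing all of it, so loops with a
further entry on the left are the same before and after. -/
theorem tailDiff_single_mem (u : List (Diagram (2 * n) (2 * n))) (x : M.B (2 * n)) :
    tailDiff a M (Finsupp.single (u, x) 1) ∈ homPart 𝒜 (fun p => tailWt M p.1 p.2)
      {p | p.1.length + 1 = u.length ∧ lab _ p.2 = lab _ x ∧
        tailClose M p.1 p.2 = tailClose M u x} (tailWt M u x) := by
  induction u with
  | nil => rw [← tailNil_single, tailDiff_nil]; exact zero_mem _
  | cons A u ih =>
    have h := tailCons_single (R := R) A ((u, x) : Tail M.B n) 1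
    rw [← h, tailDiff_cons]
    refine sub_mem ?_ ?_
    · refine homPart_mono ?_ (tailMul_mem ha hw A (single_one_mem_homPart
        (b := ((u, x) : Tail M.B n)) ⟨rfl, rfl, rfl⟩))
      rintro p ⟨h1, h2, h3⟩
      exact ⟨congrArg (· + 1) h1, h2, h3⟩
    · refine map_mem_homPart (fun p hp => ?_) ih
      rw [tailCons_single, ← hp.2.2]
      exact single_one_mem_homPart (b := ((A :: p.1, p.2) : Tail M.B n))
        ⟨congrArg (· + 1) hp.1, hp.2.1, congrArg A.comp hp.2.2⟩

theorem barDiff_single_mem (b : Chain M.B n) :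
    barDiff a M (Finsupp.single b 1) ∈ homPart 𝒜 (Chain.wt M)
      {c | c.deg + 1 = b.deg ∧ chainLab lab c = chainLab lab b} (Chain.wt M b) := by
  rcases b with y | ⟨hn, D, u, x⟩
  · rw [← chainBase_single, barDiff_base]; exact zero_mem _
  · have h := chainCons_single (R := R) hn D ((u, x) : Tail M.B n) 1
    rw [← h, barDiff_cons]
    simp only [Chain.wt]
    rw [closeLoops_add_loopsAlong]
    refine sub_mem ?_ ?_
    · refine homPart_mono ?_ (chainMul_mem ha hw hn D (single_one_mem_homPart
        (b := ((u, x) : Tail M.B n)) ⟨rfl, rfl, rfl⟩))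
      rintro p ⟨h1, h2⟩
      exact ⟨congrArg (· + 1) h1, h2⟩
    · refine map_mem_homPart (fun p hp => ?_) (tailDiff_single_mem ha hw u x)
      rw [chainCons_single, ← hp.2.2, ← closeLoops_add_loopsAlong]
      exact single_one_mem_homPart (b := Chain.bar hn D p.1 p.2)
        ⟨congrArg (· + 1) hp.1, hp.2.1⟩

/-- A closed chain is an element of `TL(0, 0)`. Composing `E` with it returns `E`, and no loop
passes through the empty bar; therefore weights simply add. -/
theorem headAct_mem (E : Diagram (2 * n) 0) {y} (hy : y ∈ ChainPart 𝒜 lab n q l w) :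
    headAct a M E y ∈ TailPart 𝒜 lab n q l E w := by
  refine map_mem_homPart (s := 0) (fun b hb => ?_) hy
  obtain ⟨rfl, rfl⟩ := hb
  rcases b with y | ⟨hn, D, u, x⟩
  · rw [← chainBase_single, headAct_base, M.actMap_single]
    have := tailNil_mem (n := n) (act_mem ha hw E y)
    rwa [comp_empty, loops_empty_middle] at this
  · have h := chainCons_single (R := R) hn D ((u, x) : Tail M.B n) 1
    rw [← h, headAct_cons, tailCons_single, Finsupp.smul_single, smul_eq_mul, mul_one]
    have h1 := loops_cocycle E D (tailClose M u x)
    have h2 := closeLoops_add_loopsAlong D u x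
    have h3 := loops_empty_middle E (D.comp (tailClose M u x))
    refine single_pow_mem_homPart ha ⟨rfl, rfl, ?_⟩ ?_
    · simp only [tailClose]
      rw [Diagram.comp_assoc, comp_empty]
    · simp only [tailWt, Chain.wt]
      omega

theorem tailAct_mem (u : List (Diagram (2 * n) (2 * n))) (E : Diagram (2 * n) 0) {y}
    (hy : y ∈ ChainPart 𝒜 lab n q l w) :
    tailAct a M (Finsupp.single (u, E) 1) y ∈ TailPart 𝒜 lab n (u.length + q) l
      (tailClose (loopData a) u E) (w + tailWt (loopData a) u E) := by
  induction u with
  | nil =>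
    rw [tailAct_single_nil, one_smul, List.length_nil, zero_add]
    exact headAct_mem ha hw E hy
  | cons A u ih =>
    have h := tailCons_single (R := R) (B := fun m => Diagram m 0) A (u, E) 1
    rw [← h, tailAct_cons]
    simp only [tailWt, tailClose]
    rw [← add_assoc, List.length_cons, add_right_comm]
    exact tailCons_mem A ih

theorem barAct_single_mem (r : LoopBasis n) {y} (hy : y ∈ ChainPart 𝒜 lab n q l w) :
    barAct a M (Finsupp.single r 1) y ∈
      ChainPart 𝒜 lab n (r.deg + q) l (w + Chain.wt (loopData a) r) := by
  rcases r with e | ⟨hn, D, u, E⟩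
  · rw [barAct_base, one_smul]
    simpa [Chain.deg, Chain.wt] using hy
  · have h := chainCons_single (R := R) (B := fun m => Diagram m 0) hn D (u, E) 1
    have h2 : Chain.wt (loopData a) (Chain.bar hn D u E) =
        tailWt (loopData a) u E + D.loops (tailClose (loopData a) u E) :=
      closeLoops_add_loopsAlong (M := loopData a) D u E
    rw [← h, barAct_cons, h2, ← add_assoc, Chain.deg, add_right_comm]
    exact chainCons_mem hn D (tailAct_mem ha hw u E hy)

end BarWeights

/-! ### Maps of coefficients -/

section Naturality

variable {R : Type*} [CommRing R] {a : R} {n : ℕ}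

/-- The map of tails induced by a map of coefficients. -/
noncomputable def tailMap {B B' : ℕ → Type} (n : ℕ) (f : ∀ m, B m → (B' m →₀ R)) :
    (Tail B n →₀ R) →ₗ[R] (Tail B' n →₀ R) :=
  Finsupp.linearCombination R fun p => Finsupp.lmapDomain R R (fun x => (p.1, x)) (f _ p.2)

/-- The map of augmented bar constructions induced by a map of coefficients. -/
noncomputable def barMap {B B' : ℕ → Type} (n : ℕ) (f : ∀ m, B m → (B' m →₀ R)) :
    (Chain B n →₀ R) →ₗ[R] (Chain B' n →₀ R) :=
  Finsupp.linearCombination R (chainMap n f)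

section

variable {B B' : ℕ → Type} (f : ∀ m, B m → (B' m →₀ R))

theorem tailMap_nil (v) :
    tailMap n f (tailNil R B n v) = tailNil R B' n (Finsupp.linearCombination R (f _) v) :=
  linear_congr (f := tailMap n f ∘ₗ tailNil R B n)
    (g := tailNil R B' n ∘ₗ Finsupp.linearCombination R (f _))
    (fun x => by simp [tailMap, tailNil]) v

theorem tailMap_cons (A : Diagram (2 * n) (2 * n)) (v) :
    tailMap n f (tailCons R A v) = tailCons R A (tailMap n f v) :=
  linear_congr (f := tailMap n f ∘ₗ tailCons R A) (g := tailCons R A ∘ₗ tailMap n f)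
    (fun x => by simp [tailMap, tailCons, ← Finsupp.mapDomain_comp, Function.comp_def]) v

theorem barMap_base (v) :
    barMap n f (chainBase R B n v) = chainBase R B' n (Finsupp.linearCombination R (f _) v) :=
  linear_congr (f := barMap n f ∘ₗ chainBase R B n)
    (g := chainBase R B' n ∘ₗ Finsupp.linearCombination R (f _))
    (fun x => by simp [barMap, chainBase, chainMap]) v

theorem barMap_cons (hn : 0 < n) (D : Diagram 0 (2 * n)) (v) :
    barMap n f (chainCons R hn D v) = chainCons R hn D (tailMap n f v) :=
  linear_congr (f := barMap n f ∘ₗ chainCons R hn D) (g := chainCons R hn D ∘ₗ tailMap n f)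
    (fun x => by
      simp [barMap, chainCons, tailMap, chainMap, ← Finsupp.mapDomain_comp, Function.comp_def]) v

end

variable {M M' : TLData R} {f : ∀ m, M.B m → (M'.B m →₀ R)}

/-- The map of coefficients commutes with the action of diagrams. -/
def IsNatural (M M' : TLData R) (f : ∀ m, M.B m → (M'.B m →₀ R)) : Prop :=
  ∀ {k m : ℕ} (D : Diagram k m) (x : M.B m),
    Finsupp.linearCombination R (f k) (M.act D x) = M'.actMap D (f m x)

variable (hf : IsNatural M M' f)
include hf

theorem IsNatural.actMap {k m : ℕ} (D : Diagram k m) (v : M.B m →₀ R) :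
    Finsupp.linearCombination R (f k) (M.actMap D v) =
      M'.actMap D (Finsupp.linearCombination R (f m) v) :=
  linear_congr (f := Finsupp.linearCombination R (f k) ∘ₗ M.actMap D)
    (g := M'.actMap D ∘ₗ Finsupp.linearCombination R (f m))
    (fun x => by simp [M.actMap_single, hf D x]) v

theorem tailMap_tailMul (A : Diagram (2 * n) (2 * n)) (v) :
    tailMap n f (tailMul a M A v) = tailMul a M' A (tailMap n f v) := by
  refine LinearMap.congr_fun (f := tailMap n f ∘ₗ tailMul a M A)
    (g := tailMul a M' A ∘ₗ tailMap n f) (tail_ext (fun x => ?_) fun B v _ => ?_) v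
  · simp only [LinearMap.comp_apply, tailMul_nil, tailMap_nil, hf.actMap]
  · simp only [LinearMap.comp_apply, tailMul_cons, tailMap_cons, map_smul]

theorem barMap_chainMul (hn : 0 < n) (D : Diagram 0 (2 * n)) (v) :
    barMap n f (chainMul a M hn D v) = chainMul a M' hn D (tailMap n f v) := by
  refine LinearMap.congr_fun (f := barMap n f ∘ₗ chainMul a M hn D)
    (g := chainMul a M' hn D ∘ₗ tailMap n f) (tail_ext (fun x => ?_) fun B v _ => ?_) v
  · simp only [LinearMap.comp_apply, chainMul_nil, tailMap_nil, barMap_base, hf.actMap]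
  · simp only [LinearMap.comp_apply, chainMul_cons, tailMap_cons, barMap_cons, map_smul]

theorem tailMap_tailDiff (v : Tail M.B n →₀ R) :
    tailMap n f (tailDiff a M v) = tailDiff a M' (tailMap n f v) := by
  refine LinearMap.congr_fun (f := tailMap n f ∘ₗ tailDiff a M)
    (g := tailDiff a M' ∘ₗ tailMap n f) (tail_ext (fun x => ?_) fun B v h => ?_) v
  · simp only [LinearMap.comp_apply, tailDiff_nil, tailMap_nil, map_zero]
  · simp only [LinearMap.comp_apply] at h ⊢
    simp only [tailDiff_cons, tailMap_cons, map_sub, tailMap_tailMul hf, h]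

/-- A map of coefficients affects only the last entry, so naturality is needed just for the face
that multiplies into it. -/
theorem barMap_barDiff (v : Chain M.B n →₀ R) :
    barMap n f (barDiff a M v) = barDiff a M' (barMap n f v) := by
  refine LinearMap.congr_fun (f := barMap n f ∘ₗ barDiff a M)
    (g := barDiff a M' ∘ₗ barMap n f) (chain_ext (fun x => ?_) fun hn D v => ?_) v
  · simp only [LinearMap.comp_apply, barDiff_base, barMap_base, map_zero]
  · simp only [LinearMap.comp_apply, barDiff_cons, barMap_cons, map_sub, barMap_chainMul hf,
      tailMap_tailDiff hf]

theorem tailMap_headAct (E : Diagram (2 * n) 0) (y) :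
    tailMap n f (headAct a M E y) = headAct a M' E (barMap n f y) := by
  refine LinearMap.congr_fun (f := tailMap n f ∘ₗ headAct a M E)
    (g := headAct a M' E ∘ₗ barMap n f) (chain_ext (fun x => ?_) fun hn D v => ?_) y
  · simp only [LinearMap.comp_apply, headAct_base, barMap_base, tailMap_nil, hf.actMap]
  · simp only [LinearMap.comp_apply, headAct_cons, barMap_cons, tailMap_cons, map_smul]

theorem tailMap_tailAct (v y) :
    tailMap n f (tailAct a M v y) = tailAct a M' v (barMap n f y) := by
  refine LinearMap.congr_fun (f := tailMap n f ∘ₗ (tailAct a M).flip y)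
    (g := (tailAct a M').flip (barMap n f y)) (tail_ext (fun E => ?_) fun A v h => ?_) v
  · simp only [LinearMap.comp_apply, LinearMap.flip_apply, tailNil_single, tailAct_single_nil,
      map_smul, tailMap_headAct hf]
  · simp only [LinearMap.comp_apply, LinearMap.flip_apply] at h ⊢
    rw [tailAct_cons, tailAct_cons, tailMap_cons, h]

theorem barMap_barAct (r y) :
    barMap n f (barAct a M r y) = barAct a M' r (barMap n f y) := by
  refine LinearMap.congr_fun (f := barMap n f ∘ₗ (barAct a M).flip y)
    (g := (barAct a M').flip (barMap n f y)) (chain_ext (fun E => ?_) fun hn D v => ?_) r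
  · simp only [LinearMap.comp_apply, LinearMap.flip_apply, chainBase_single, barAct_base, map_smul]
  · simp only [LinearMap.comp_apply, LinearMap.flip_apply]
    rw [barAct_cons, barAct_cons, barMap_cons, tailMap_tailAct hf]

end Naturality

/-! ### The hook maps -/

section Hook

variable {R : Type*} [CommRing R] (a : R) (M : TLData R) {k m n : ℕ}

/-- The diagram `R₁`. -/
def hookR (n : ℕ) : Diagram (2 * n) (2 * (n + 1)) := Diagram.rightCup (2 * n) 0 (Nat.zero_le _)

/-- The diagram `L₂`. -/
def hookL {n : ℕ} (hn : 0 < n) : Diagram (2 * (n + 1)) (2 * n) :=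
  Diagram.leftCup (2 * n) 1 (by omega)

theorem loops_hookR (x : Diagram m (2 * n)) : x.loops (hookR n) = 0 := loops_rightCup x _

/-- This straightening carries all properties of the hook map: a face multiplies `D_j R₁` with `L₂
D_{j+1}` and sees only `D_j D_{j+1}`. In particular `D₀R₁ · L₂x = D₀x`, which agrees with the hook
map being the identity in degree zero. -/
theorem comp_hookR_hookL (hn : 0 < n) (x : Diagram m (2 * n)) :
    (x.comp (hookR n)).comp (hookL hn) = x :=
  comp_rightCup_leftCup x _ _ (Or.inl rfl)

theorem loops_hookR_hookL (hn : 0 < n) (x : Diagram m (2 * n)) :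
    (x.comp (hookR n)).loops (hookL hn) = 0 :=
  loops_comp_rightCup_leftCup x _ _ (Or.inl rfl)

theorem comp_hookR_comp_hookL (hn : 0 < n) (x : Diagram m (2 * n)) (y : Diagram (2 * n) k) :
    (x.comp (hookR n)).comp ((hookL hn).comp y) = x.comp y := by
  rw [← Diagram.comp_assoc, comp_hookR_hookL]

/-- Loops already formed by `L₂` and `y` are part of those formed by `x` and `y` once the zig-zag
has been straightened. -/
theorem loops_hookR_comp_hookL (hn : 0 < n) (x : Diagram m (2 * n)) (y : Diagram (2 * n) k) :
    (hookL hn).loops y + (x.comp (hookR n)).loops ((hookL hn).comp y) = x.loops y := by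
  have h := loops_cocycle (x.comp (hookR n)) (hookL hn) y
  rw [comp_hookR_hookL, loops_hookR_hookL] at h
  omega

theorem loops_comp_hookR (x : Diagram k m) (y : Diagram m (2 * n)) :
    x.loops (y.comp (hookR n)) = x.loops y := by
  have h := loops_cocycle x y (hookR n)
  rw [loops_hookR, loops_hookR] at h
  omega

/-- The hook map on tails. -/
noncomputable def tailHook (hn : 0 < n) : (Tail M.B n →₀ R) →ₗ[R] (Tail M.B (n + 1) →₀ R) :=
  Finsupp.linearCombination R fun p => a ^ (p.1.map (hookL hn).loops).sum •
    Finsupp.lmapDomain R R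
      (fun y => (p.1.map fun A => ((hookL hn).comp A).comp (hookR n), y)) (M.act (hookL hn) p.2)

/-- The hook map. -/
noncomputable def barHook : (Chain M.B n →₀ R) →ₗ[R] (Chain M.B (n + 1) →₀ R) :=
  Finsupp.linearCombination R (chainHook a M)

variable {M}

theorem tailHook_nil (hn : 0 < n) (v) :
    tailHook a M hn (tailNil R M.B n v) = tailNil R M.B (n + 1) (M.actMap (hookL hn) v) :=
  linear_congr (f := tailHook a M hn ∘ₗ tailNil R M.B n)
    (g := tailNil R M.B (n + 1) ∘ₗ M.actMap (hookL hn))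
    (fun x => by simp [tailHook, M.actMap_single, tailNil]) v

theorem tailHook_cons (hn : 0 < n) (A : Diagram (2 * n) (2 * n)) (v) :
    tailHook a M hn (tailCons R A v) = a ^ (hookL hn).loops A •
      tailCons R (((hookL hn).comp A).comp (hookR n)) (tailHook a M hn v) :=
  linear_congr (f := tailHook a M hn ∘ₗ tailCons R A)
    (g := a ^ (hookL hn).loops A •
      tailCons R (((hookL hn).comp A).comp (hookR n)) ∘ₗ tailHook a M hn)
    (fun x => by
      simp [tailHook, tailCons, ← Finsupp.mapDomain_comp, Function.comp_def, pow_add, smul_smul]) v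

theorem barHook_base (v) : barHook a M (chainBase R M.B n v) = chainBase R M.B (n + 1) v :=
  linear_congr (f := barHook a M ∘ₗ chainBase R M.B n) (g := chainBase R M.B (n + 1))
    (fun x => by simp [barHook, chainBase, chainHook]) v

/-- Gluing `R₁` on the right never closes a loop, so in the exponent of `chainHook` only the loops
formed with `L₂` remain. -/
theorem barHook_cons (hn : 0 < n) (D : Diagram 0 (2 * n)) (v) :
    barHook a M (chainCons R hn D v) =
      chainCons R n.succ_pos (D.comp (hookR n)) (tailHook a M hn v) := by
  refine linear_congr (f := barHook a M ∘ₗ chainCons R hn D)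
    (g := chainCons R n.succ_pos (D.comp (hookR n)) ∘ₗ tailHook a M hn) (fun x => ?_) v
  have h1 : chainHook a M (Chain.bar hn D x.1 x.2) =
      a ^ (D.loops (hookR n) + (x.1.map fun A => (hookL hn).loops A +
        ((hookL hn).comp A).loops (hookR n)).sum) • (M.act (hookL hn) x.2).mapDomain
          (.bar n.succ_pos (D.comp (hookR n))
            (x.1.map fun A => ((hookL hn).comp A).comp (hookR n))) := rfl
  simp only [LinearMap.comp_apply, barHook, Finsupp.mapDomain_single, Finsupp.linearCombination_single,
    one_smul, h1, loops_hookR, zero_add, add_zero, tailHook, map_smul, chainCons,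
    Finsupp.lmapDomain_apply, ← Finsupp.mapDomain_comp, Function.comp_def]

theorem barMap_barHook {M' : TLData R} {f : ∀ m, M.B m → (M'.B m →₀ R)} (hf : IsNatural M M' f)
    (v : Chain M.B n →₀ R) :
    barMap (n + 1) f (barHook a M v) = barHook a M' (barMap n f v) := by
  have h : ∀ (hn : 0 < n) (v : Tail M.B n →₀ R),
      tailMap (n + 1) f (tailHook a M hn v) = tailHook a M' hn (tailMap n f v) := by
    intro hn v
    refine LinearMap.congr_fun (f := tailMap (n + 1) f ∘ₗ tailHook a M hn)
      (g := tailHook a M' hn ∘ₗ tailMap n f) (tail_ext (fun x => ?_) fun A v h => ?_) v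
    · simp only [LinearMap.comp_apply, tailHook_nil, tailMap_nil, hf.actMap]
    · simp only [LinearMap.comp_apply] at h ⊢
      simp only [tailHook_cons, tailMap_cons, map_smul, h]
  refine LinearMap.congr_fun (f := barMap (n + 1) f ∘ₗ barHook a M)
    (g := barHook a M' ∘ₗ barMap n f) (chain_ext (fun x => ?_) fun hn D v => ?_) v
  · simp only [LinearMap.comp_apply, barHook_base, barMap_base]
  · simp only [LinearMap.comp_apply, barHook_cons, barMap_cons, h]

variable {a} (hM : M.IsModule a)
include hM

theorem tailHook_tailMul (hn : 0 < n) (A : Diagram (2 * n) (2 * n)) (v) :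
    tailHook a M hn (tailMul a M A v) = a ^ (hookL hn).loops A •
      tailMul a M (((hookL hn).comp A).comp (hookR n)) (tailHook a M hn v) := by
  refine LinearMap.congr_fun (f := tailHook a M hn ∘ₗ tailMul a M A)
    (g := a ^ (hookL hn).loops A •
      tailMul a M (((hookL hn).comp A).comp (hookR n)) ∘ₗ tailHook a M hn)
    (tail_ext (fun x => ?_) fun B v _ => ?_) v
  · simp only [LinearMap.comp_apply, LinearMap.smul_apply, tailHook_nil, tailMul_nil,
      hM.actMap_actMap, map_smul, comp_hookR_hookL, loops_hookR_hookL, pow_zero, one_smul]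
  · simp only [LinearMap.comp_apply, LinearMap.smul_apply, tailHook_cons, tailMul_cons, map_smul,
      smul_smul, ← pow_add]
    have h1 := loops_cocycle (hookL hn) A B
    have h2 := loops_hookR_comp_hookL hn ((hookL hn).comp A) B
    rw [loops_comp_hookR, ← Diagram.comp_assoc _ _ (hookR n), comp_hookR_comp_hookL,
      ← Diagram.comp_assoc]
    congr 2
    omega

theorem barHook_chainMul (hn : 0 < n) (D : Diagram 0 (2 * n)) (v) :
    barHook a M (chainMul a M hn D v) =
      chainMul a M n.succ_pos (D.comp (hookR n)) (tailHook a M hn v) := by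
  refine LinearMap.congr_fun (f := barHook a M ∘ₗ chainMul a M hn D)
    (g := chainMul a M n.succ_pos (D.comp (hookR n)) ∘ₗ tailHook a M hn)
    (tail_ext (fun x => ?_) fun B v _ => ?_) v
  · simp only [LinearMap.comp_apply, tailHook_nil, chainMul_nil, barHook_base,
      hM.actMap_actMap, comp_hookR_hookL, loops_hookR_hookL, pow_zero, one_smul]
  · simp only [LinearMap.comp_apply, tailHook_cons, chainMul_cons, barHook_cons, map_smul,
      smul_smul, ← pow_add]
    have h2 := loops_hookR_comp_hookL hn D B
    rw [loops_comp_hookR, ← Diagram.comp_assoc _ _ (hookR n), comp_hookR_comp_hookL, h2]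

theorem tailHook_tailDiff (hn : 0 < n) (v : Tail M.B n →₀ R) :
    tailHook a M hn (tailDiff a M v) = tailDiff a M (tailHook a M hn v) := by
  refine LinearMap.congr_fun (f := tailHook a M hn ∘ₗ tailDiff a M)
    (g := tailDiff a M ∘ₗ tailHook a M hn) (tail_ext (fun x => ?_) fun B v h => ?_) v
  · simp only [LinearMap.comp_apply, tailHook_nil, tailDiff_nil, map_zero]
  · simp only [LinearMap.comp_apply] at h ⊢
    simp only [tailDiff_cons, tailHook_cons, map_sub, map_smul, tailHook_tailMul hM, h, smul_sub]

theorem barHook_barDiff (v : Chain M.B n →₀ R) :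
    barHook a M (barDiff a M v) = barDiff a M (barHook a M v) := by
  refine LinearMap.congr_fun (f := barHook a M ∘ₗ barDiff a M)
    (g := barDiff a M ∘ₗ barHook a M) (chain_ext (fun x => ?_) fun hn D v => ?_) v
  · simp only [LinearMap.comp_apply, barHook_base, barDiff_base, map_zero]
  · simp only [LinearMap.comp_apply, barDiff_cons, barHook_cons, map_sub, barHook_chainMul hM,
      tailHook_tailDiff hM]

/-- When two chains are juxtaposed, the entry `E D` becomes `L₂ E D R₁`, which is the product of the
hooked neighbours `L₂ E` and `D R₁`. -/
theorem tailHook_headAct (hn : 0 < n) (E : Diagram (2 * n) 0) (y) :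
    tailHook a M hn (headAct a M E y) = a ^ (hookL hn).loops E •
      headAct a M ((hookL hn).comp E) (barHook a M y) := by
  refine LinearMap.congr_fun (f := tailHook a M hn ∘ₗ headAct a M E)
    (g := a ^ (hookL hn).loops E • headAct a M ((hookL hn).comp E) ∘ₗ barHook a M)
    (chain_ext (fun x => ?_) fun hn D v => ?_) y
  · simp only [LinearMap.comp_apply, LinearMap.smul_apply, headAct_base, tailHook_nil,
      barHook_base, hM.actMap_actMap, map_smul]
  · simp only [LinearMap.comp_apply, LinearMap.smul_apply, headAct_cons, tailHook_cons,
      barHook_cons, map_smul, smul_smul, ← pow_add]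
    have h1 := loops_cocycle (hookL hn) E D
    rw [loops_comp_hookR, ← Diagram.comp_assoc _ _ (hookR n), ← Diagram.comp_assoc, h1]

theorem tailHook_tailAct (hn : 0 < n) (v y) :
    tailHook a M hn (tailAct a M v y) =
      tailAct a M (tailHook a (loopData a) hn v) (barHook a M y) := by
  refine LinearMap.congr_fun (f := tailHook a M hn ∘ₗ (tailAct a M).flip y)
    (g := (tailAct a M).flip (barHook a M y) ∘ₗ tailHook a (loopData a) hn)
    (tail_ext (fun E => ?_) fun A v h => ?_) v
  · simp only [LinearMap.comp_apply, LinearMap.flip_apply]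
    rw [tailHook_nil, TLData.actMap_single, loopData_act, tailNil_single, tailNil_single,
      tailAct_single_nil, tailAct_single_nil, one_smul, tailHook_headAct hM]
  · simp only [LinearMap.comp_apply, LinearMap.flip_apply] at h ⊢
    rw [tailAct_cons, tailHook_cons (M := loopData a), tailHook_cons, map_smul,
      LinearMap.smul_apply, tailAct_cons, h]

theorem barHook_barAct (r y) :
    barHook a M (barAct a M r y) =
      barAct a M (barHook (n := n) a (loopData a) r) (barHook a M y) := by
  refine LinearMap.congr_fun (f := barHook a M ∘ₗ (barAct a M).flip y)
    (g := (barAct a M).flip (barHook a M y) ∘ₗ barHook a (loopData a))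
    (chain_ext (fun e => ?_) fun hn D v => ?_) r
  · simp only [LinearMap.comp_apply, LinearMap.flip_apply]
    rw [barHook_base, chainBase_single, chainBase_single, barAct_base, barAct_base, one_smul,
      one_smul]
  · simp only [LinearMap.comp_apply, LinearMap.flip_apply]
    rw [barAct_cons, barHook_cons (M := loopData a), barHook_cons, barAct_cons,
      tailHook_tailAct hM]

end Hook

/-! ### Weights under the hook maps -/

section HookWeights

variable {R : Type*} [CommRing R] {a : R} {𝒜 : ℕ → AddSubgroup R} [SetLike.GradedMonoid 𝒜]
  {M : TLData R} {lab : ∀ m, M.B m → ℕ} {n q l w : ℕ} (ha : a ∈ 𝒜 1) (hw : M.IsWeighted a lab)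
include ha hw

/-- The hook map on tails closes up to `L₂` composed with the old diagram and gains the loops formed
there. The preceding entry ends in `R₁`, so at the next gluing these loops are accounted for and the
total weight is unchanged. -/
theorem tailHook_single_mem (hn : 0 < n) (u : List (Diagram (2 * n) (2 * n))) (x : M.B (2 * n)) :
    tailHook a M hn (Finsupp.single (u, x) 1) ∈ TailPart 𝒜 lab (n + 1) u.length (lab _ x)
      ((hookL hn).comp (tailClose M u x))
      (tailWt M u x + (hookL hn).loops (tailClose M u x)) := by
  induction u with
  | nil =>
    rw [← tailNil_single, tailHook_nil, M.actMap_single]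
    exact tailNil_mem (act_mem ha hw _ x)
  | cons A u ih =>
    have h := tailCons_single (R := R) A ((u, x) : Tail M.B n) 1
    have h1 := loops_cocycle (hookL hn) A (tailClose M u x)
    have h2 := loops_hookR_comp_hookL hn ((hookL hn).comp A) (tailClose M u x)
    have h3 := tailCons_mem (((hookL hn).comp A).comp (hookR n)) ih
    rw [comp_hookR_comp_hookL, Diagram.comp_assoc] at h3
    rw [← h, tailHook_cons]
    refine pow_smul_mem_homPart ha h3 ?_
    simp only [tailWt, tailClose]
    omega

theorem barHook_single_mem (b : Chain M.B n) :
    barHook a M (Finsupp.single b 1) ∈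
      ChainPart 𝒜 lab (n + 1) b.deg (chainLab lab b) (Chain.wt M b) := by
  rcases b with y | ⟨hn, D, u, x⟩
  · rw [← chainBase_single, barHook_base]
    exact chainBase_mem (single_one_mem_homPart ⟨rfl, rfl⟩)
  · have h := chainCons_single (R := R) hn D ((u, x) : Tail M.B n) 1
    have h1 := chainCons_mem n.succ_pos (D.comp (hookR n)) (tailHook_single_mem ha hw hn u x)
    have h2 := loops_hookR_comp_hookL hn D (tailClose M u x)
    have h3 := closeLoops_add_loopsAlong D u x
    rw [← h, barHook_cons]
    convert h1 using 1
    simp only [Chain.wt]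
    congr 1
    omega

end HookWeights

/-! ### Differential graded modules -/

section Support

variable {R : Type*} [CommRing R] {β γ κ : Type} {P : Set β} {Q : Set γ} {S : Set κ}

theorem map₂_mem_supported {f : (β →₀ R) →ₗ[R] (γ →₀ R) →ₗ[R] (κ →₀ R)}
    (h : ∀ b ∈ P, ∀ c ∈ Q, f (Finsupp.single b 1) (Finsupp.single c 1) ∈ Finsupp.supported R R S)
    {x : β →₀ R} (hx : x ∈ Finsupp.supported R R P) {y : γ →₀ R}
    (hy : y ∈ Finsupp.supported R R Q) : f x y ∈ Finsupp.supported R R S :=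
  map_mem_supported (f := f.flip y) (fun b hb => map_mem_supported (h b hb) hy) hx

theorem eq_of_mem_supported {X : Type*} [AddCommGroup X] [Module R X] {f g : (β →₀ R) →ₗ[R] X}
    (h : ∀ b ∈ P, f (Finsupp.single b 1) = g (Finsupp.single b 1)) {x : β →₀ R}
    (hx : x ∈ Finsupp.supported R R P) : f x = g x := by
  rw [Finsupp.supported_eq_span_single] at hx
  refine LinearMap.eqOn_span (s := (fun b => Finsupp.single b (1 : R)) '' P) ?_ hx
  rintro _ ⟨b, hb, rfl⟩
  exact h b hb

end Support

section DGModules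

variable {R : Type*} [CommRing R] {a : R} {n : ℕ}

theorem DGData.wtPart_eq (M : DGData R n) (𝒜 : ℕ → AddSubgroup R) (w : ℕ) :
    M.wtPart 𝒜 w = homPart 𝒜 M.wt Set.univ w := by
  simp [DGData.wtPart, homPart]

theorem DGData.map_mem_wtPart {n' : ℕ} {M : DGData R n} {N : DGData R n'}
    {𝒜 : ℕ → AddSubgroup R} [SetLike.GradedMonoid 𝒜]
    {f : (M.Basis →₀ R) →ₗ[R] (N.Basis →₀ R)}
    (h : ∀ b, ∃ Q, f (Finsupp.single b 1) ∈ homPart 𝒜 N.wt Q (M.wt b)) (w : ℕ) (x)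
    (hx : x ∈ M.wtPart 𝒜 w) : f x ∈ N.wtPart 𝒜 w := by
  rw [DGData.wtPart_eq] at hx ⊢
  refine map_mem_homPart (s := 0) (fun b _ => ?_) hx
  obtain ⟨Q, hQ⟩ := h b
  exact homPart_mono (Set.subset_univ _) hQ

theorem DGData.map_mem_degPart {n' : ℕ} {M : DGData R n} {N : DGData R n'}
    {f : (M.Basis →₀ R) →ₗ[R] (N.Basis →₀ R)} {k l : ℕ}
    (h : ∀ b, M.deg b = k → f (Finsupp.single b 1) ∈ Finsupp.supported R R {c | N.deg c = l}) (x)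
    (hx : x ∈ M.degPart k) : f x ∈ N.degPart l :=
  map_mem_supported h hx

theorem DGData.act_wt_of_single {M : DGData R n} {𝒜 : ℕ → AddSubgroup R}
    [SetLike.GradedMonoid 𝒜]
    (h : ∀ r b, M.act (Finsupp.single r 1) (Finsupp.single b 1) ∈
      homPart 𝒜 M.wt Set.univ (M.wt b + (loopDG a n).wt r)) :
    ∀ v w, ∀ r ∈ (loopDG a n).wtPart 𝒜 v, ∀ x ∈ M.wtPart 𝒜 w, M.act r x ∈ M.wtPart 𝒜 (v + w) := by
  intro v w r hr x hx
  rw [DGData.wtPart_eq] at hr hx ⊢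
  refine map_mem_homPart (f := M.act.flip x) (fun r _ => ?_) hr
  rw [LinearMap.flip_apply, add_comm]
  exact map_mem_homPart (fun b _ => h r b) hx

section Bar

variable {M : TLData R} {lab : ∀ m, M.B m → ℕ} (hw : M.IsWeighted a lab)
include hw

/-- Under the trivial grading by `⊤` the condition `a ∈ 𝒜 1` is void, and the weighted statement
leaves the information on degrees and labels for any ring. -/
theorem barDiff_single_supported (b : Chain M.B n) :
    barDiff a M (Finsupp.single b 1) ∈ Finsupp.supported R R
      {c | c.deg + 1 = b.deg ∧ chainLab lab c = chainLab lab b} :=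
  homPart_le_supported (barDiff_single_mem (𝒜 := fun _ => ⊤) trivial hw b)

theorem barAct_single_supported (r : LoopBasis n) (b : Chain M.B n) :
    barAct a M (Finsupp.single r 1) (Finsupp.single b 1) ∈ Finsupp.supported R R
      {c | c.deg = r.deg + b.deg ∧ chainLab lab c = chainLab lab b} :=
  homPart_le_supported (barAct_single_mem (𝒜 := fun _ => ⊤) trivial hw r
    (single_one_mem_homPart (wt := Chain.wt M) ⟨rfl, rfl⟩))

theorem barHook_single_supported (b : Chain M.B n) :
    barHook a M (Finsupp.single b 1) ∈ Finsupp.supported R R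
      {c | c.deg = b.deg ∧ chainLab lab c = chainLab lab b} :=
  homPart_le_supported (barHook_single_mem (𝒜 := fun _ => ⊤) trivial hw b)

theorem barDG_isDGModule (hM : M.IsModule a) (n : ℕ) : IsDGModule a (barDG a M n) where
  d_deg k := DGData.map_mem_degPart (M := barDG a M n) (N := barDG a M n) fun b hb =>
    Finsupp.supported_mono (fun c hc => Nat.succ_injective (hc.1.trans hb))
      (barDiff_single_supported hw b)
  d_deg_zero x hx := by
    refine eq_of_mem_supported (f := barDiff a M) (g := 0) (fun b hb => ?_) hx
    have h := barDiff_single_supported hw b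
    have h0 : {c : Chain M.B n | c.deg + 1 = b.deg ∧ chainLab lab c = chainLab lab b} = ∅ := by
      ext c
      simp only [Set.mem_ofPred_eq, Set.mem_empty_iff_false, iff_false, not_and]
      intro hc
      rw [show b.deg = 0 from hb] at hc
      exact absurd hc (Nat.succ_ne_zero _)
    rw [h0, Finsupp.supported_empty, Submodule.mem_bot] at h
    exact h
  d_d := barDiff_barDiff hM
  act_deg j k r hr x hx := by
    refine map₂_mem_supported (f := barAct a M) (fun r hr b hb => ?_) hr hx
    refine Finsupp.supported_mono (fun c hc => ?_) (barAct_single_supported hw r b)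
    obtain rfl : r.deg = j := hr
    obtain rfl : b.deg = k := hb
    exact hc.1
  one_act e x := (barAct_base a e 1 x).trans (one_smul R x)
  mul_act := barAct_barAct
  leibniz j r hr x := by
    refine eq_of_mem_supported (f := barDiff a M ∘ₗ (barAct a M).flip x)
      (g := (barAct a M).flip x ∘ₗ barDiff a (loopData a) +
        (-1 : R) ^ j • (barAct a M).flip (barDiff a M x)) (fun r hr => ?_) hr
    obtain rfl : r.deg = j := hr
    exact barDiff_barAct hM r x

theorem barDG_isBigradedDGModule (hM : M.IsModule a) {𝒜 : ℕ → AddSubgroup R}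
    [SetLike.GradedMonoid 𝒜] (ha : a ∈ 𝒜 1) (n : ℕ) :
    IsBigradedDGModule a 𝒜 (barDG a M n) where
  toIsDGModule := barDG_isDGModule hw hM n
  d_wt := DGData.map_mem_wtPart (M := barDG a M n) (N := barDG a M n)
    fun _ => ⟨_, barDiff_single_mem ha hw _⟩
  act_wt := DGData.act_wt_of_single (M := barDG a M n) fun r _ =>
    homPart_mono (Set.subset_univ _) (barAct_single_mem ha hw r
      (single_one_mem_homPart (wt := Chain.wt M) ⟨rfl, rfl⟩))

end Bar

/-! ### Twisted differentials -/

section Twist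

variable {β γ : Type} {p : β → ℕ} {q : γ → ℕ}

/-- The sign `(-1)^(j p(b))` on the basis element `b`. -/
noncomputable def signMap (R : Type*) [CommRing R] {β : Type} (p : β → ℕ) (j : ℕ) :
    (β →₀ R) →ₗ[R] (β →₀ R) :=
  Finsupp.linearCombination R fun b => (-1 : R) ^ (p b * j) • Finsupp.single b 1

theorem signMap_single (j : ℕ) (b : β) :
    signMap R p j (Finsupp.single b 1) = (-1 : R) ^ (p b * j) • Finsupp.single b 1 := by
  simp [signMap]

theorem neg_one_pow_smul_congr {X : Type*} [AddCommGroup X] [Module R X] {p q : ℕ}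
    (h : p % 2 = q % 2) (x : X) : (-1 : R) ^ p • x = (-1 : R) ^ q • x := by
  rw [neg_one_pow_eq_pow_mod_two, h, ← neg_one_pow_eq_pow_mod_two]

theorem signMap_signMap (j k : ℕ) (x : β →₀ R) :
    signMap R p j (signMap R p k x) = signMap R p (j + k) x :=
  linear_congr (f := signMap R p j ∘ₗ signMap R p k) (g := signMap R p (j + k)) (fun b => by
    simp only [LinearMap.comp_apply, signMap_single, map_smul, smul_smul, ← pow_add, mul_add]
    rw [add_comm]) x

theorem signMap_congr {j k : ℕ} (h : j % 2 = k % 2) (x : β →₀ R) :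
    signMap R p j x = signMap R p k x :=
  linear_congr (fun b => by
    rw [signMap_single, signMap_single]
    exact neg_one_pow_smul_congr (Nat.ModEq.mul_left (n := 2) (p b) h) _) x

theorem signMap_zero (x : β →₀ R) : signMap R p 0 x = x :=
  linear_congr (f := signMap R p 0) (g := LinearMap.id) (fun b => by simp [signMap_single]) x

theorem signMap_of_mem {j k : ℕ} {x : β →₀ R} (hx : x ∈ Finsupp.supported R R {b | p b = k}) :
    signMap R p j x = (-1 : R) ^ (k * j) • x := by
  refine eq_of_mem_supported (f := signMap R p j) (g := (-1 : R) ^ (k * j) • LinearMap.id)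
    (fun b hb => ?_) hx
  obtain rfl : p b = k := hb
  rw [signMap_single]
  rfl

theorem map_signMap {f : (β →₀ R) →ₗ[R] (γ →₀ R)}
    (hf : ∀ b, f (Finsupp.single b 1) ∈ Finsupp.supported R R {c | q c = p b}) (j : ℕ) (x) :
    f (signMap R p j x) = signMap R q j (f x) :=
  linear_congr (f := f ∘ₗ signMap R p j) (g := signMap R q j ∘ₗ f) (fun b => by
    simp only [LinearMap.comp_apply, signMap_single, map_smul, signMap_of_mem (hf b)]) x

/-- Lowering the label by one changes the sign `(-1)^(pj)` by `(-1)^j`. -/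
theorem map_signMap_succ {f : (β →₀ R) →ₗ[R] (γ →₀ R)}
    (hf : ∀ b, f (Finsupp.single b 1) ∈ Finsupp.supported R R {c | q c + 1 = p b}) (j : ℕ) (x) :
    f (signMap R p j x) = (-1 : R) ^ j • signMap R q j (f x) :=
  linear_congr (f := f ∘ₗ signMap R p j) (g := (-1 : R) ^ j • signMap R q j ∘ₗ f) (fun b => by
    simp only [LinearMap.comp_apply, signMap_single, map_smul, LinearMap.smul_apply]
    have h := hf b
    -- At label zero there is no label to move to, so `f` vanishes on `b`.
    rcases Nat.eq_zero_or_pos (p b) with h0 | h0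
    · have h1 : {c | q c + 1 = p b} = ∅ := by
        ext c
        simp [h0]
      rw [h1, Finsupp.supported_empty, Submodule.mem_bot] at h
      rw [h]
      simp
    · have h2 : f (Finsupp.single b 1) ∈ Finsupp.supported R R {c | q c = p b - 1} :=
        Finsupp.supported_mono (fun c hc => by
          have hc : q c + 1 = p b := hc
          change q c = p b - 1
          omega) h
      rw [signMap_of_mem h2, smul_smul, ← pow_add]
      congr 2
      obtain ⟨k, hk⟩ : ∃ k, p b = k + 1 := ⟨p b - 1, by omega⟩
      rw [hk, Nat.add_sub_cancel]
      ring) x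

variable {M : TLData R} (a) (lab : ∀ m, M.B m → ℕ) (δ : (Chain M.B n →₀ R) →ₗ[R] (Chain M.B n →₀ R))
  (s : ℕ)

/-- The differential `δ + (-1)^p d` on the part of label `p`. -/
noncomputable def twistDiff : (Chain M.B n →₀ R) →ₗ[R] (Chain M.B n →₀ R) :=
  Finsupp.linearCombination R fun b =>
    δ (Finsupp.single b 1) + (-1 : R) ^ chainLab lab b • chainD a M b

variable (n) in
/-- The action of `r` with the sign `(-1)^(p |r|)` on the part of label `p`. -/
noncomputable def twistAct : (LoopBasis n →₀ R) →ₗ[R]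
    (Chain M.B n →₀ R) →ₗ[R] (Chain M.B n →₀ R) :=
  Finsupp.linearCombination R fun r => Finsupp.linearCombination R fun b =>
    (-1 : R) ^ (chainLab lab b * r.deg) • chainAct a M r b

/-- The augmented bar construction, with labels as an additional degree. -/
noncomputable def twistDG : DGData R n where
  Basis := Chain M.B n
  deg b := b.deg + chainLab lab b
  wt b := Chain.wt M b + s
  d := twistDiff a lab δ
  act := twistAct a n lab

/-- With the signs collected in the operator `σ = (-1)^p`, the total differential is `δ + dσ`. All
checks of signs then use only that `σ` commutes with `d` and anticommutes with `δ`. -/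
theorem twistDiff_apply (x) :
    twistDiff a lab δ x = δ x + barDiff a M (signMap R (chainLab lab) 1 x) :=
  linear_congr (f := twistDiff a lab δ) (g := δ + barDiff a M ∘ₗ signMap R (chainLab lab) 1)
    (fun b => by simp [twistDiff, signMap_single, barDiff]) x

theorem twistAct_single (r : LoopBasis n) (x) : twistAct a n lab (Finsupp.single r 1) x =
    barAct a M (Finsupp.single r 1) (signMap R (chainLab lab) r.deg x) :=
  linear_congr (f := twistAct a n lab (Finsupp.single r 1))
    (g := barAct a M (Finsupp.single r 1) ∘ₗ signMap R (chainLab lab) r.deg)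
    (fun b => by simp [twistAct, signMap_single, barAct]) x

theorem twistAct_of_mem {j : ℕ} {r} (hr : r ∈ Finsupp.supported R R {r : LoopBasis n | r.deg = j})
    (x) : twistAct a n lab r x = barAct a M r (signMap R (chainLab lab) j x) := by
  refine eq_of_mem_supported (f := (twistAct a n lab).flip x)
    (g := (barAct a M).flip (signMap R (chainLab lab) j x)) (fun r hr => ?_) hr
  obtain rfl : r.deg = j := hr
  exact twistAct_single a lab r x

variable {a lab δ}

/-- The part of the differential that lowers the label. -/
structure IsTwist (a : R) (lab : ∀ m, M.B m → ℕ)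
    (δ : (Chain M.B n →₀ R) →ₗ[R] (Chain M.B n →₀ R)) : Prop where
  supp : ∀ b, δ (Finsupp.single b 1) ∈ Finsupp.supported R R
    {c | c.deg = b.deg ∧ chainLab lab c + 1 = chainLab lab b}
  sq : ∀ x, δ (δ x) = 0
  comm : ∀ x, δ (barDiff a M x) = barDiff a M (δ x)
  act : ∀ r x, δ (barAct a M r x) = barAct a M r (δ x)

theorem isTwist_zero : IsTwist a lab (0 : (Chain M.B n →₀ R) →ₗ[R] (Chain M.B n →₀ R)) where
  supp _ := zero_mem _
  sq _ := rfl
  comm _ := (map_zero _).symm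
  act _ _ := (map_zero _).symm

variable (hM : M.IsModule a) (hw : M.IsWeighted a lab) (hδ : IsTwist a lab δ)

include hw in
theorem signMap_barDiff (j : ℕ) (x) : barDiff a M (signMap R (chainLab (n := n) lab) j x) =
    signMap R (chainLab lab) j (barDiff a M x) :=
  map_signMap (fun b => Finsupp.supported_mono (fun _ hc => hc.2) (barDiff_single_supported hw b))
    j x

include hw in
theorem signMap_barAct (j : ℕ) (r : LoopBasis n) (x) :
    barAct a M (Finsupp.single r 1) (signMap R (chainLab lab) j x) =
      signMap R (chainLab lab) j (barAct a M (Finsupp.single r 1) x) :=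
  map_signMap (fun b => Finsupp.supported_mono (fun _ hc => hc.2)
    (barAct_single_supported hw r b)) j x

include hδ in
theorem signMap_twist (j : ℕ) (x) : δ (signMap R (chainLab lab) j x) =
    (-1 : R) ^ j • signMap R (chainLab lab) j (δ x) :=
  map_signMap_succ (fun b => Finsupp.supported_mono (fun _ hc => hc.2) (hδ.supp b)) j x

include hM hw hδ

omit hM in
theorem twistDiff_single_supported (b : Chain M.B n) :
    twistDiff a lab δ (Finsupp.single b 1) ∈ Finsupp.supported R R
      {c | c.deg + chainLab lab c + 1 = b.deg + chainLab lab b} := by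
  rw [twistDiff_apply, signMap_single, map_smul]
  refine add_mem (Finsupp.supported_mono ?_ (hδ.supp b)) (Submodule.smul_mem _ _
    (Finsupp.supported_mono ?_ (barDiff_single_supported hw b)))
  · rintro c ⟨h1, h2⟩
    change c.deg + chainLab lab c + 1 = b.deg + chainLab lab b
    omega
  · rintro c ⟨h1, h2⟩
    change c.deg + chainLab lab c + 1 = b.deg + chainLab lab b
    omega

/-- Of the four terms of `(δ + dσ)²`, the two squares vanish and the mixed terms `δdσ` and `dσδ =
-dδσ` cancel. -/
theorem twistDiff_twistDiff (x : Chain M.B n →₀ R) :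
    twistDiff a lab δ (twistDiff a lab δ x) = 0 := by
  rw [twistDiff_apply, twistDiff_apply, map_add, map_add, map_add, hδ.sq, hδ.comm,
    signMap_twist hδ, ← signMap_barDiff hw 1 (signMap R (chainLab lab) 1 x),
    barDiff_barDiff hM, map_smul]
  simp

omit hM hδ in
theorem twistAct_single_supported (r : LoopBasis n) (b : Chain M.B n) :
    twistAct a n lab (Finsupp.single r 1) (Finsupp.single b 1) ∈ Finsupp.supported R R
      {c | c.deg + chainLab lab c = r.deg + (b.deg + chainLab lab b)} := by
  rw [twistAct_single, signMap_single, map_smul]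
  refine Submodule.smul_mem _ _ (Finsupp.supported_mono (fun c hc => ?_)
    (barAct_single_supported hw r b))
  obtain ⟨h1, h2⟩ := hc
  change c.deg + chainLab lab c = r.deg + (b.deg + chainLab lab b)
  omega

omit hM hδ in
-- The action does not change labels and degrees in `L(2n)` add, so the signs `(-1)^(p|r|)` and
-- `(-1)^(p|s|)` combine to that of the product.
theorem twistAct_twistAct (r s : LoopBasis n →₀ R) (x : Chain M.B n →₀ R) :
    twistAct a n lab (barAct a (loopData a) r s) x =
      twistAct a n lab r (twistAct a n lab s x) := by
  refine linear_congr (f := (twistAct a n lab).flip x ∘ₗ (barAct a (loopData a)).flip s)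
    (g := (twistAct a n lab).flip (twistAct a n lab s x)) (fun r => ?_) r
  refine linear_congr (f := (twistAct a n lab).flip x ∘ₗ
    barAct a (loopData a) (Finsupp.single r 1))
    (g := twistAct a n lab (Finsupp.single r 1) ∘ₗ (twistAct a n lab).flip x) (fun s => ?_) s
  have h := Finsupp.supported_mono (fun _ hc => hc.1)
    (barAct_single_supported (n := n) (loopData_isWeighted (a := a) 0) r s)
  simp only [LinearMap.comp_apply, LinearMap.flip_apply]
  rw [twistAct_of_mem a lab h, twistAct_single, twistAct_single, barAct_barAct,
    ← signMap_barAct hw, signMap_signMap]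

/-- The part with `d` is the Leibniz rule of the bar construction. The operator `δ` commutes with
the untwisted action, and the sign `(-1)^|r|` arises when it passes the twist `(-1)^(p|r|)`. -/
theorem twistDiff_twistAct (r : LoopBasis n) (x : Chain M.B n →₀ R) :
    twistDiff a lab δ (twistAct a n lab (Finsupp.single r 1) x) =
      twistAct a n lab (barDiff a (loopData a) (Finsupp.single r 1)) x +
        (-1 : R) ^ r.deg • twistAct a n lab (Finsupp.single r 1) (twistDiff a lab δ x) := by
  -- The boundary of `r` has degree `|r| - 1`. For signs this may be replaced by `|r| + 1`, and in
  -- degree zero both sides vanish.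
  have h1 : twistAct a n lab (barDiff a (loopData a) (Finsupp.single r 1)) x =
      barAct a M (barDiff a (loopData a) (Finsupp.single r 1))
        (signMap R (chainLab lab) (r.deg + 1) x) := by
    have h := barDiff_single_supported (n := n) (loopData_isWeighted (a := a) 0) r
    rcases hj : r.deg with _ | j
    · have h0 : barDiff a (loopData a) (Finsupp.single r 1) = 0 :=
        (barDG_isDGModule (a := a) (loopData_isWeighted 0) loopData_isModule n).d_deg_zero
          (Finsupp.single r 1) (Finsupp.single_mem_supported R _ hj)
      rw [h0]
      simp
    · rw [twistAct_of_mem a lab (j := j) (Finsupp.supported_mono (fun c hc => ?_) h)]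
      · rw [signMap_congr (R := R) (p := chainLab lab) (j := j) (k := j + 1 + 1) (by omega)]
      · have hc := hc.1
        change c.deg = j
        omega
  rw [h1, twistAct_single, twistAct_single, twistDiff_apply, twistDiff_apply, hδ.act,
    signMap_twist hδ, ← signMap_barAct hw, signMap_signMap, barDiff_barAct hM, map_add,
    map_add, map_smul, ← signMap_barDiff hw, signMap_signMap, smul_add, add_comm 1 r.deg]
  abel

/-- One verification serves all three modules: the label is the number of dashes with `δ`
un-dashing, or constantly `i` with `δ = 0` for the suspension, or constantly `0` with `δ = 0` for
the derived cell module. -/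
theorem twistDG_isDGModule : IsDGModule a (twistDG a lab δ s) where
  d_deg k := DGData.map_mem_degPart (M := twistDG a lab δ s) (N := twistDG a lab δ s)
    fun b hb => Finsupp.supported_mono (fun _ hc => Nat.succ_injective (hc.trans hb))
      (twistDiff_single_supported hw hδ b)
  d_deg_zero x hx := by
    refine eq_of_mem_supported (f := twistDiff a lab δ) (g := 0) (fun b hb => ?_) hx
    have h := Finsupp.supported_mono (t := ∅)
      (fun _ hc => (Nat.succ_ne_zero _ (Eq.trans hc hb)).elim)
      (twistDiff_single_supported hw hδ b)
    rw [Finsupp.supported_empty, Submodule.mem_bot] at h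
    exact h
  d_d := twistDiff_twistDiff hM hw hδ
  act_deg j k r hr x hx := by
    refine map₂_mem_supported (f := twistAct a n lab) (fun r hr b hb => ?_) hr hx
    exact Finsupp.supported_mono (fun c hc => Eq.trans hc (congrArg₂ (· + ·) hr hb))
      (twistAct_single_supported hw r b)
  one_act e x := by
    refine (twistAct_single a lab (.base e) x).trans ?_
    exact ((barAct_base a e 1 _).trans (one_smul R _)).trans (signMap_zero x)
  mul_act := twistAct_twistAct hw
  leibniz j r hr x := by
    refine eq_of_mem_supported (f := twistDiff a lab δ ∘ₗ (twistAct a n lab).flip x)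
      (g := (twistAct a n lab).flip x ∘ₗ barDiff a (loopData a) +
        (-1 : R) ^ j • (twistAct a n lab).flip (twistDiff a lab δ x)) (fun r hr => ?_) hr
    obtain rfl : r.deg = j := hr
    exact twistDiff_twistAct hM hw hδ r x

omit hM hδ in
theorem twistDiff_single_mem {𝒜 : ℕ → AddSubgroup R} [SetLike.GradedMonoid 𝒜] (ha : a ∈ 𝒜 1)
    (hδw : ∀ b, δ (Finsupp.single b 1) ∈ homPart 𝒜 (Chain.wt M) Set.univ (Chain.wt M b))
    (b : Chain M.B n) :
    twistDiff a lab δ (Finsupp.single b 1) ∈ homPart 𝒜 (Chain.wt M) Set.univ (Chain.wt M b) := by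
  rw [twistDiff_apply, signMap_single, map_smul]
  exact add_mem (hδw b) (neg_one_pow_smul_mem (homPart_mono (Set.subset_univ _)
    (barDiff_single_mem ha hw b)) _)

omit hM hδ in
theorem twistAct_single_mem {𝒜 : ℕ → AddSubgroup R} [SetLike.GradedMonoid 𝒜] (ha : a ∈ 𝒜 1)
    (r : LoopBasis n) (b : Chain M.B n) :
    twistAct a n lab (Finsupp.single r 1) (Finsupp.single b 1) ∈
      homPart 𝒜 (fun c => Chain.wt M c + s) Set.univ
        (Chain.wt M b + s + Chain.wt (loopData a) r) := by
  rw [twistAct_single, signMap_single, map_smul, add_right_comm]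
  exact neg_one_pow_smul_mem (homPart_shift s (homPart_mono (Set.subset_univ _)
    (barAct_single_mem ha hw r (single_one_mem_homPart (wt := Chain.wt M) ⟨rfl, rfl⟩)))) _

theorem twistDG_isBigradedDGModule {𝒜 : ℕ → AddSubgroup R} [SetLike.GradedMonoid 𝒜]
    (ha : a ∈ 𝒜 1)
    (hδw : ∀ b, δ (Finsupp.single b 1) ∈ homPart 𝒜 (Chain.wt M) Set.univ (Chain.wt M b)) :
    IsBigradedDGModule a 𝒜 (twistDG a lab δ s) where
  toIsDGModule := twistDG_isDGModule s hM hw hδ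
  d_wt := DGData.map_mem_wtPart (M := twistDG a lab δ s) (N := twistDG a lab δ s) fun b =>
    ⟨Set.univ, homPart_shift s (twistDiff_single_mem hw ha hδw b)⟩
  act_wt := DGData.act_wt_of_single (M := twistDG a lab δ s) (twistAct_single_mem s hw ha)

variable {δ' : (Chain M.B (n + 1) →₀ R) →ₗ[R] (Chain M.B (n + 1) →₀ R)}
  (hh : ∀ x, barHook a M (δ x) = δ' (barHook a M x))

omit hM hδ in
theorem barHook_signMap (j : ℕ) (x) : barHook a M (signMap R (chainLab (n := n) lab) j x) =
    signMap R (chainLab lab) j (barHook a M x) :=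
  map_signMap (fun b => Finsupp.supported_mono (fun _ hc => hc.2) (barHook_single_supported hw b))
    j x

include hh

omit hδ in
theorem barHook_twistDiff (x : Chain M.B n →₀ R) :
    barHook a M (twistDiff a lab δ x) = twistDiff a lab δ' (barHook a M x) := by
  rw [twistDiff_apply, twistDiff_apply, map_add, hh, barHook_barDiff hM, barHook_signMap hw]

omit hδ hh in
theorem barHook_twistAct (r : LoopBasis n →₀ R) (x : Chain M.B n →₀ R) :
    barHook a M (twistAct a n lab r x) =
      twistAct a (n + 1) lab (barHook a (loopData a) r) (barHook a M x) := by
  refine linear_congr (f := barHook a M ∘ₗ (twistAct a n lab).flip x)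
    (g := (twistAct a (n + 1) lab).flip (barHook a M x) ∘ₗ barHook a (loopData a))
    (fun r => ?_) r
  have h := Finsupp.supported_mono (fun _ hc => hc.1)
    (barHook_single_supported (n := n) (loopData_isWeighted (a := a) 0) r)
  simp only [LinearMap.comp_apply, LinearMap.flip_apply]
  rw [twistAct_single, barHook_barAct hM, twistAct_of_mem a lab h, barHook_signMap hw]

omit hδ in
theorem twist_isHookLinear :
    IsHookLinear a (M := twistDG a lab δ s) (N := twistDG a lab δ' s) (barHook a M) where
  map_deg _ := DGData.map_mem_degPart (M := twistDG a lab δ s) (N := twistDG a lab δ' s)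
    fun b hb => Finsupp.supported_mono
      (fun _ hc => (congrArg₂ (· + ·) hc.1 hc.2).trans hb) (barHook_single_supported hw b)
  map_d := barHook_twistDiff hM hw hh
  map_act := barHook_twistAct hM hw

omit hδ in
theorem twist_isBigradedHookLinear {𝒜 : ℕ → AddSubgroup R} [SetLike.GradedMonoid 𝒜]
    (ha : a ∈ 𝒜 1) :
    IsBigradedHookLinear a 𝒜 (M := twistDG a lab δ s) (N := twistDG a lab δ' s)
      (barHook a M) where
  toIsHookLinear := twist_isHookLinear s hM hw hh
  map_wt := DGData.map_mem_wtPart (M := twistDG a lab δ s) (N := twistDG a lab δ' s) fun b =>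
    ⟨_, homPart_shift s (barHook_single_mem ha hw b)⟩

end Twist

end DGModules

/-! ### Maps between twisted bar constructions -/

section TwistMap

variable {R : Type*} [CommRing R] {a : R} {n : ℕ} {M M' : TLData R} {lab : ∀ m, M.B m → ℕ}
  {lab' : ∀ m, M'.B m → ℕ} {f : ∀ m, M.B m → (M'.B m →₀ R)}

/-- A map of coefficients that preserves closures, raises weights by `s'` in comparison to `s`, and
changes labels according to `rel`, has these properties on the bar construction. -/
theorem barMap_single_mem {𝒜 : ℕ → AddSubgroup R} [SetLike.GradedMonoid 𝒜] {rel : ℕ → ℕ → Prop}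
    {s s' : ℕ}
    (hf : ∀ m x, f m x ∈ homPart 𝒜 (fun y => M'.closeLoops y + s')
      {y | M'.close y = M.close x ∧ rel (lab m x) (lab' m y)} (M.closeLoops x + s))
    (b : Chain M.B n) :
    barMap n f (Finsupp.single b 1) ∈ homPart 𝒜 (fun c => Chain.wt M' c + s')
      {c | c.deg = b.deg ∧ rel (chainLab lab b) (chainLab lab' c)} (Chain.wt M b + s) := by
  rw [barMap, Finsupp.linearCombination_single, one_smul]
  rcases b with y | ⟨hn, D, u, x⟩
  · refine map_mem_homPart (s := 0) (f := Finsupp.lmapDomain R R Chain.base) (fun z hz => ?_)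
      (hf 0 y)
    rw [Finsupp.lmapDomain_apply, Finsupp.mapDomain_single]
    exact single_one_mem_homPart (b := (Chain.base z : Chain M'.B n)) ⟨rfl, hz.2⟩
  · change (f _ x).mapDomain (Chain.bar hn D u) ∈ _
    have h := map_mem_homPart (s := loopsAlong D u (M.close x)) (𝒜 := 𝒜)
      (wt' := fun c : Chain M'.B n => Chain.wt M' c + s')
      (Q := {c | c.deg = u.length + 1 ∧ rel (lab _ x) (chainLab lab' c)})
      (f := Finsupp.lmapDomain R R (Chain.bar hn D u)) (fun z hz => ?_) (hf _ x)
    · simp only [Chain.wt]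
      rw [add_right_comm]
      exact h
    · rw [Finsupp.lmapDomain_apply, Finsupp.mapDomain_single, ← hz.1, add_right_comm]
      exact single_one_mem_homPart (b := (Chain.bar hn D u z : Chain M'.B n)) ⟨rfl, hz.2⟩

variable {δ : (Chain M.B n →₀ R) →ₗ[R] (Chain M.B n →₀ R)}
  {δ' : (Chain M'.B n →₀ R) →ₗ[R] (Chain M'.B n →₀ R)} (hf : IsNatural M M' f)
  (hlab : ∀ b : Chain M.B n, barMap n f (Finsupp.single b 1) ∈
    Finsupp.supported R R {c | c.deg = b.deg ∧ chainLab lab' c = chainLab lab b})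

include hlab in
theorem barMap_signMap (j : ℕ) (x : Chain M.B n →₀ R) :
    barMap n f (signMap R (chainLab lab) j x) = signMap R (chainLab lab') j (barMap n f x) :=
  map_signMap (fun b => Finsupp.supported_mono (fun _ hc => hc.2) (hlab b)) j x

include hf hlab

theorem barMap_twistDiff (hδ : ∀ x, barMap n f (δ x) = δ' (barMap n f x)) (x : Chain M.B n →₀ R) :
    barMap n f (twistDiff a lab δ x) = twistDiff a lab' δ' (barMap n f x) := by
  rw [twistDiff_apply, twistDiff_apply, map_add, hδ, barMap_barDiff hf, barMap_signMap hlab]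

theorem barMap_twistAct (r : LoopBasis n →₀ R) (x : Chain M.B n →₀ R) :
    barMap n f (twistAct a n lab r x) = twistAct a n lab' r (barMap n f x) := by
  refine linear_congr (f := barMap n f ∘ₗ (twistAct a n lab).flip x)
    (g := (twistAct a n lab').flip (barMap n f x)) (fun r => ?_) r
  simp only [LinearMap.comp_apply, LinearMap.flip_apply]
  rw [twistAct_single, twistAct_single, barMap_barAct hf, barMap_signMap hlab]

end TwistMap

/-! ### The differential of the complex of innermost cups -/

section Undash

variable {R : Type*} [CommRing R] {a : R} {i m n : ℕ}

/-- Remove a dash. -/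
def Dashed.erase (x : Dashed i m) (j : Fin (2 * i)) : Dashed i m :=
  ⟨(x.diagram, x.dashes.erase j), fun k hk => x.2 k (Finset.mem_of_mem_erase hk)⟩

theorem Dashed.dashes_erase (x : Dashed i m) (j : Fin (2 * i)) :
    (x.erase j).dashes = x.dashes.erase j := rfl

theorem undash_eq (x : Dashed i m) : undash (R := R) x =
    ∑ j ∈ x.dashes, Finsupp.single (x.erase j) ((-1) ^ (x.dashes.filter (· < j)).card) := rfl

/-- The simplicial sign rule: of two elements, removing the smaller one shifts the position of the
larger one by one, while removing the larger one leaves the position of the smaller one unchanged.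
The two orders of removal therefore have opposite signs. -/
theorem card_filter_lt_erase {α : Type} [LinearOrder α] {S : Finset α} {j k : α} (hj : j ∈ S)
    (hjk : j ≠ k) : (((S.filter (· < j)).card + ((S.erase j).filter (· < k)).card) + 1) % 2 =
      ((S.filter (· < k)).card + ((S.erase k).filter (· < j)).card) % 2 ∨ k ∉ S := by
  by_cases hk : k ∈ S
  swap
  · exact Or.inr hk
  left
  wlog h : j < k generalizing j k with H
  · have := H hk hjk.symm hj (lt_of_le_of_ne (not_lt.1 h) hjk.symm)
    omega
  rw [Finset.filter_erase, Finset.filter_erase, Finset.card_erase_of_mem (by simp [hj, h]),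
    Finset.erase_eq_of_notMem (by simp [h.le])]
  have : 0 < (S.filter (· < k)).card := Finset.card_pos.2 ⟨j, by simp [hj, h]⟩
  omega

/-- The terms for `(j, k)` and `(k, j)` remove the same two dashes with opposite signs, so
exchanging the two indices is a cancelling involution. -/
theorem undash_undash (x : Dashed i m) :
    Finsupp.linearCombination R (undash (R := R)) (undash x) = 0 := by
  simp only [undash_eq, map_sum, Finsupp.linearCombination_single, Finset.smul_sum,
    Finsupp.smul_single, smul_eq_mul, ← pow_add, Dashed.dashes_erase]
  rw [Finset.sum_sigma']
  refine Finset.sum_involution (fun p _ => ⟨p.2, p.1⟩) ?_ ?_ ?_ ?_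
  · rintro ⟨j, k⟩ h
    simp only [Finset.mem_sigma, Finset.mem_erase] at h
    have h1 : (x.erase j).erase k = (x.erase k).erase j :=
      Dashed.ext rfl (Finset.erase_right_comm)
    simp only [h1]
    rw [← Finsupp.single_add]
    have h2 := (card_filter_lt_erase h.1 h.2.1.symm).resolve_right (not_not.2 h.2.2)
    rw [neg_one_pow_eq_pow_mod_two, ← neg_one_pow_eq_pow_mod_two (n := _ + _),
      neg_one_pow_eq_pow_mod_two (n := (x.dashes.filter (· < k)).card + _), ← h2,
      ← neg_one_pow_eq_pow_mod_two, pow_succ, mul_neg_one, add_neg_cancel, Finsupp.single_zero]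
  · rintro ⟨j, k⟩ h - heq
    simp only [Finset.mem_sigma, Finset.mem_erase] at h
    exact h.2.1 (congrArg Sigma.fst heq)
  · rintro ⟨j, k⟩ h
    simp only [Finset.mem_sigma, Finset.mem_erase] at h ⊢
    exact ⟨h.2.2, h.2.1.symm, h.1⟩
  · rintro ⟨j, k⟩ h
    rfl

/-- Composition on the left keeps the set of dashes and so the signs; the number of loops depends
only on the underlying diagram. -/
theorem undash_isNatural : IsNatural (dashedData a i) (dashedData a i) fun _ => undash := by
  intro k m D x
  rw [dashedData_act, Finsupp.linearCombination_single]
  change _ • undash (x.lcomp D) = (dashedData a i).actMap D (undash x)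
  rw [undash_eq, undash_eq, map_sum, Finset.smul_sum]
  refine Finset.sum_congr rfl fun j hj => ?_
  rw [TLData.actMap, Finsupp.linearCombination_single, dashedData_act, Finsupp.smul_single,
    Finsupp.smul_single, smul_eq_mul, smul_eq_mul, mul_comm]
  rfl

/-- The part of the differential that removes dashes. -/
noncomputable def barUndash (R : Type*) [CommRing R] (n i : ℕ) :
    (Chain (Dashed i) n →₀ R) →ₗ[R] (Chain (Dashed i) n →₀ R) :=
  barMap n fun _ => undash

theorem undash_mem {𝒜 : ℕ → AddSubgroup R} [SetLike.GradedMonoid 𝒜] (x : Dashed i m) :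
    undash x ∈ homPart 𝒜 (fun y => (dashedData a i).closeLoops y + 0)
      {y | (dashedData a i).close y = (dashedData a i).close x ∧
        y.dashes.card + 1 = x.dashes.card} ((dashedData a i).closeLoops x + 0) := by
  rw [undash_eq]
  refine sum_mem fun j hj => ?_
  have h := neg_one_pow_smul_mem (single_one_mem_homPart (𝒜 := 𝒜) (b := x.erase j)
    (wt := fun y => (dashedData a i).closeLoops y + 0)
    (P := {y | (dashedData a i).close y = (dashedData a i).close x ∧
      y.dashes.card + 1 = x.dashes.card})
    ⟨rfl, Finset.card_erase_add_one hj⟩) (x.dashes.filter (· < j)).card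
  rwa [Finsupp.smul_single, smul_eq_mul, mul_one] at h

/-- A map of coefficients that vanishes on the image of `undash` does so on the bar
construction. -/
theorem barMap_barUndash {B : ℕ → Type} {f : ∀ m, Dashed i m → (B m →₀ R)}
    (hf : ∀ m x, Finsupp.linearCombination R (f m) (undash x) = 0) (x : Chain (Dashed i) n →₀ R) :
    barMap n f (barUndash R n i x) = 0 := by
  have h : ∀ {m} (v : Dashed i m →₀ R), Finsupp.linearCombination R (f m)
      (Finsupp.linearCombination R undash v) = 0 := fun v =>
    linear_congr (f := Finsupp.linearCombination R (f _) ∘ₗ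
      Finsupp.linearCombination R undash) (g := 0) (fun x => by
        rw [LinearMap.comp_apply, Finsupp.linearCombination_single, one_smul, hf]; rfl) v
  have ht : ∀ v : Tail (Dashed i) n →₀ R,
      tailMap n f (tailMap n (fun _ => undash) v) = 0 := fun v => by
    refine LinearMap.congr_fun (f := tailMap n f ∘ₗ
      tailMap n (fun _ => undash)) (g := 0) (tail_ext (fun x => ?_) fun A v h' => ?_) v
    · simp only [LinearMap.comp_apply, tailMap_nil, h, map_zero, LinearMap.zero_apply]
    · simp only [LinearMap.comp_apply, LinearMap.zero_apply] at h' ⊢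
      rw [tailMap_cons, tailMap_cons, h', map_zero]
  refine LinearMap.congr_fun (f := barMap n f ∘ₗ barUndash R n i) (g := 0)
    (chain_ext (fun x => ?_) fun hn D v => ?_) x
  · simp only [LinearMap.comp_apply, barUndash, barMap_base, h, map_zero, LinearMap.zero_apply]
  · simp only [LinearMap.comp_apply, barUndash, barMap_cons, ht, map_zero, LinearMap.zero_apply]

theorem barUndash_barUndash (x : Chain (Dashed i) n →₀ R) :
    barUndash R n i (barUndash R n i x) = 0 :=
  barMap_barUndash (fun _ => undash_undash) x

theorem barUndash_single_mem {𝒜 : ℕ → AddSubgroup R} [SetLike.GradedMonoid 𝒜]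
    (b : Chain (Dashed i) n) :
    barUndash R n i (Finsupp.single b 1) ∈ homPart 𝒜 (Chain.wt (dashedData a i))
      {c | c.deg = b.deg ∧ chainLab (M := dashedData a i) (fun _ x => x.dashes.card) c + 1 =
        chainLab (M := dashedData a i) (fun _ x => x.dashes.card) b}
      (Chain.wt (dashedData a i) b) :=
  barMap_single_mem (M := dashedData a i) (M' := dashedData a i)
    (rel := fun p q => q + 1 = p) (fun _ => undash_mem) b

theorem barUndash_isTwist :
    IsTwist (M := dashedData a i) a (fun _ x => Finset.card (Dashed.dashes x))
      (barUndash R n i) where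
  supp b := homPart_le_supported (barUndash_single_mem (𝒜 := fun _ => ⊤) b)
  sq := barUndash_barUndash
  comm := barMap_barDiff undash_isNatural
  act := barMap_barAct undash_isNatural

theorem dashCount_eq (b : Chain (Dashed i) n) :
    dashCount b = chainLab (M := dashedData a i) (fun _ x => Finset.card (Dashed.dashes x)) b := by
  cases b <;> rfl

end Undash

/-! ### The modules of the zig-zag as twisted bar constructions -/

section Identification

variable {R : Type*} [CommRing R]

variable (a : R) (n i : ℕ)

/-- The number of dashes as a label. -/
abbrev dashLab (i : ℕ) (m : ℕ) (x : Dashed i m) : ℕ := x.dashes.card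

/-- The totalised complex of innermost cups as a twisted bar construction. -/
noncomputable abbrev innTwist : DGData R n :=
  twistDG (M := dashedData a i) a (dashLab i) (barUndash R n i) 0

/-- The suspension of the dga of planar loops as a twisted bar construction. -/
noncomputable abbrev suspTwist : DGData R n := twistDG (M := loopData a) a (fun _ _ => i) 0 i

/-- The derived cell module as a twisted bar construction. -/
noncomputable abbrev cellTwist : DGData R n := twistDG (M := quotientData a i) a (fun _ _ => 0) 0 0

/-- A property of the data on a fixed basis. -/
abbrev DGProp (R : Type*) [CommRing R] (n : ℕ) (B : Type) : Type _ :=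
  (B → ℕ) → (B → ℕ) → ((B →₀ R) →ₗ[R] (B →₀ R)) →
    ((LoopBasis n →₀ R) →ₗ[R] (B →₀ R) →ₗ[R] (B →₀ R)) → Prop

variable {a n i}

/-- Basis and weights agree by definition, while degree, differential and action agree only after
rewriting. Viewing a statement as a property `P` of these data lets it be transported, separately
for the source and the target of a map. -/
theorem innDG_of_innTwist {P : DGProp R n (Chain (Dashed i) n)}
    (h : P (innTwist a n i).deg (innTwist a n i).wt (innTwist a n i).d (innTwist a n i).act) :
    P (innDG a n i).deg (innDG a n i).wt (innDG a n i).d (innDG a n i).act := by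
  have h1 : (innTwist a n i).deg = (innDG a n i).deg :=
    funext fun b => congrArg (b.deg + ·) (dashCount_eq b).symm
  have h2 : (innTwist a n i).d = (innDG a n i).d := by
    refine congrArg (Finsupp.linearCombination R) (funext fun b => ?_)
    rw [dashCount_eq (a := a) b]
    refine congrArg (· + _) ?_
    rw [barUndash, barMap, Finsupp.linearCombination_single, one_smul]
    rfl
  have h3 : (innTwist a n i).act = (innDG a n i).act := by
    refine congrArg (Finsupp.linearCombination R) (funext fun r => ?_)
    refine congrArg (Finsupp.linearCombination R) (funext fun b => ?_)
    rw [dashCount_eq (a := a) b]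
    rfl
  rw [h1, h2, h3] at h
  exact h

theorem susp_of_suspTwist {P : DGProp R n (LoopBasis n)}
    (h : P (suspTwist a n i).deg (suspTwist a n i).wt (suspTwist a n i).d (suspTwist a n i).act) :
    P ((loopDG a n).susp i).deg ((loopDG a n).susp i).wt ((loopDG a n).susp i).d
      ((loopDG a n).susp i).act := by
  have hl : ∀ b : LoopBasis n, chainLab (M := loopData a) (fun _ _ => i) b = i := by
    rintro (_ | _) <;> rfl
  have h1 : (suspTwist a n i).deg = ((loopDG a n).susp i).deg :=
    funext fun b => congrArg (b.deg + ·) (hl b)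
  have h2 : (suspTwist a n i).d = ((loopDG a n).susp i).d := by
    refine LinearMap.ext fun x => linear_congr (f := twistDiff (M := loopData a) a (fun _ _ => i) 0)
      (g := (-1 : R) ^ i • barDiff a (loopData a)) (fun b => ?_) x
    simp [twistDiff, hl, barDiff]
  have h3 : (suspTwist a n i).act = ((loopDG a n).susp i).act := by
    refine LinearMap.ext fun r => linear_congr (f := twistAct (M := loopData a) a n fun _ _ => i)
      (g := Finsupp.linearCombination R fun r : LoopBasis n =>
        (-1 : R) ^ (i * r.deg) • barAct a (loopData a) (Finsupp.single r 1)) (fun r => ?_) r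
    refine LinearMap.ext fun x => ?_
    rw [twistAct_single, signMap_of_mem (k := i), map_smul, Finsupp.linearCombination_single,
      one_smul, LinearMap.smul_apply]
    refine (Finsupp.mem_supported R x).2 fun b _ => hl b
  rw [h1, h2, h3] at h
  exact h

theorem cell_of_cellTwist {P : DGProp R n (Chain (quotientData a i).B n)}
    (h : P (cellTwist a n i).deg (cellTwist a n i).wt (cellTwist a n i).d (cellTwist a n i).act) :
    P (cellDG a n i).deg (cellDG a n i).wt (cellDG a n i).d (cellDG a n i).act := by
  have hl : ∀ b : Chain (quotientData a i).B n,
      chainLab (M := quotientData a i) (fun _ _ => 0) b = 0 := by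
    rintro (_ | _) <;> rfl
  have h1 : (cellTwist a n i).deg = (cellDG a n i).deg :=
    funext fun b => congrArg (b.deg + ·) (hl b)
  have h2 : (cellTwist a n i).d = (cellDG a n i).d := by
    refine LinearMap.ext fun x => linear_congr
      (f := twistDiff (M := quotientData a i) a (fun _ _ => 0) 0)
      (g := barDiff a (quotientData a i)) (fun b => ?_) x
    simp [twistDiff, hl, barDiff]
  have h3 : (cellTwist a n i).act = (cellDG a n i).act := by
    refine LinearMap.ext fun r => linear_congr
      (f := twistAct (M := quotientData a i) a n fun _ _ => 0)
      (g := barAct a (quotientData a i)) (fun r => ?_) r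
    refine LinearMap.ext fun x => ?_
    rw [twistAct_single, signMap_of_mem (k := 0), map_smul, Nat.zero_mul, pow_zero, one_smul]
    refine (Finsupp.mem_supported R x).2 fun b _ => hl b
  rw [h1, h2, h3] at h
  exact h

end Identification

section ZigZag

variable {R : Type*} [CommRing R] {a : R} {n i m : ℕ}

/-! ### The module structures -/

theorem innDG_isDGModule : IsDGModule a (innDG a n i) :=
  innDG_of_innTwist (P := fun deg wt d act => IsDGModule a ⟨_, deg, wt, d, act⟩)
    (twistDG_isDGModule 0 (dashedData_isModule i) (dashedData_isWeighted i) barUndash_isTwist)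

theorem susp_isDGModule : IsDGModule a ((loopDG a n).susp i) :=
  susp_of_suspTwist (P := fun deg wt d act => IsDGModule a ⟨_, deg, wt, d, act⟩)
    (twistDG_isDGModule i loopData_isModule (loopData_isWeighted i) isTwist_zero)

theorem loopDG_isDGModule : IsDGModule a (loopDG a n) :=
  barDG_isDGModule (loopData_isWeighted 0) loopData_isModule n

theorem cellDG_isDGModule : IsDGModule a (cellDG a n i) :=
  barDG_isDGModule (quotientData_isWeighted i) (quotientData_isModule i) n

section Bigraded

variable {𝒜 : ℕ → AddSubgroup R} [SetLike.GradedMonoid 𝒜] (ha : a ∈ 𝒜 1)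
include ha

theorem innDG_isBigradedDGModule : IsBigradedDGModule a 𝒜 (innDG a n i) :=
  innDG_of_innTwist (P := fun deg wt d act => IsBigradedDGModule a 𝒜 ⟨_, deg, wt, d, act⟩)
    (twistDG_isBigradedDGModule 0 (dashedData_isModule i) (dashedData_isWeighted i)
      barUndash_isTwist ha fun b => homPart_mono (Set.subset_univ _) (barUndash_single_mem b))

theorem susp_isBigradedDGModule : IsBigradedDGModule a 𝒜 ((loopDG a n).susp i) :=
  susp_of_suspTwist (P := fun deg wt d act => IsBigradedDGModule a 𝒜 ⟨_, deg, wt, d, act⟩)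
    (twistDG_isBigradedDGModule i loopData_isModule (loopData_isWeighted i) isTwist_zero ha
      fun _ => zero_mem _)

theorem loopDG_isBigradedDGModule : IsBigradedDGModule a 𝒜 (loopDG a n) :=
  barDG_isBigradedDGModule (loopData_isWeighted 0) loopData_isModule ha n

theorem cellDG_isBigradedDGModule : IsBigradedDGModule a 𝒜 (cellDG a n i) :=
  barDG_isBigradedDGModule (quotientData_isWeighted i) (quotientData_isModule i) ha n

end Bigraded

/-! ### The hook maps -/

theorem barHook_barUndash (x : Chain (Dashed i) n →₀ R) :
    barHook a (dashedData a i) (barUndash R n i x) =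
      barUndash R (n + 1) i (barHook a (dashedData a i) x) :=
  (barMap_barHook a undash_isNatural x).symm

theorem innHook_isHookLinear : IsHookLinear a (innHook a n i) :=
  innDG_of_innTwist (P := fun deg wt d act => IsHookLinear a (M := ⟨_, deg, wt, d, act⟩)
      (N := innDG a (n + 1) i) (innHook a n i))
    (innDG_of_innTwist (P := fun deg wt d act => IsHookLinear a (M := innTwist a n i)
      (N := ⟨_, deg, wt, d, act⟩) (innHook a n i))
      (twist_isHookLinear 0 (dashedData_isModule i) (dashedData_isWeighted i) barHook_barUndash))

theorem suspHook_isHookLinear : IsHookLinear a (suspHook a n i) :=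
  susp_of_suspTwist (P := fun deg wt d act => IsHookLinear a (M := ⟨_, deg, wt, d, act⟩)
      (N := (loopDG a (n + 1)).susp i) (suspHook a n i))
    (susp_of_suspTwist (P := fun deg wt d act => IsHookLinear a (M := suspTwist a n i)
      (N := ⟨_, deg, wt, d, act⟩) (suspHook a n i))
      (twist_isHookLinear i loopData_isModule (loopData_isWeighted i) fun _ => map_zero _))

theorem cellHook_isHookLinear : IsHookLinear a (cellHook a n i) :=
  cell_of_cellTwist (P := fun deg wt d act => IsHookLinear a (M := ⟨_, deg, wt, d, act⟩)
      (N := cellDG a (n + 1) i) (cellHook a n i))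
    (cell_of_cellTwist (P := fun deg wt d act => IsHookLinear a (M := cellTwist a n i)
      (N := ⟨_, deg, wt, d, act⟩) (cellHook a n i))
      (twist_isHookLinear 0 (quotientData_isModule i) (quotientData_isWeighted i)
        fun _ => map_zero _))

section Bigraded

variable {𝒜 : ℕ → AddSubgroup R} [SetLike.GradedMonoid 𝒜] (ha : a ∈ 𝒜 1)
include ha

theorem innHook_isBigradedHookLinear : IsBigradedHookLinear a 𝒜 (innHook a n i) :=
  innDG_of_innTwist (P := fun deg wt d act => IsBigradedHookLinear a 𝒜
      (M := ⟨_, deg, wt, d, act⟩) (N := innDG a (n + 1) i) (innHook a n i))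
    (innDG_of_innTwist (P := fun deg wt d act => IsBigradedHookLinear a 𝒜
      (M := innTwist a n i) (N := ⟨_, deg, wt, d, act⟩) (innHook a n i))
      (twist_isBigradedHookLinear 0 (dashedData_isModule i) (dashedData_isWeighted i)
        barHook_barUndash ha))

theorem suspHook_isBigradedHookLinear : IsBigradedHookLinear a 𝒜 (suspHook a n i) :=
  susp_of_suspTwist (P := fun deg wt d act => IsBigradedHookLinear a 𝒜
      (M := ⟨_, deg, wt, d, act⟩) (N := (loopDG a (n + 1)).susp i) (suspHook a n i))
    (susp_of_suspTwist (P := fun deg wt d act => IsBigradedHookLinear a 𝒜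
      (M := suspTwist a n i) (N := ⟨_, deg, wt, d, act⟩) (suspHook a n i))
      (twist_isBigradedHookLinear i loopData_isModule (loopData_isWeighted i)
        (fun _ => map_zero _) ha))

theorem cellHook_isBigradedHookLinear : IsBigradedHookLinear a 𝒜 (cellHook a n i) :=
  cell_of_cellTwist (P := fun deg wt d act => IsBigradedHookLinear a 𝒜
      (M := ⟨_, deg, wt, d, act⟩) (N := cellDG a (n + 1) i) (cellHook a n i))
    (cell_of_cellTwist (P := fun deg wt d act => IsBigradedHookLinear a 𝒜
      (M := cellTwist a n i) (N := ⟨_, deg, wt, d, act⟩) (cellHook a n i))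
      (twist_isBigradedHookLinear 0 (quotientData_isModule i) (quotientData_isWeighted i)
        (fun _ => map_zero _) ha))

end Bigraded

/-! ### The maps of the zig-zag -/

variable (R) in
/-- Delete the dashed cups if there are `i` of them. -/
noncomputable def deleteDashes (i m : ℕ) (x : Dashed i m) : Diagram m 0 →₀ R :=
  if x.dashes.card = i then Finsupp.single (x.diagram.comp (Diagram.leftMax i)) 1 else 0

open Classical in
variable (R) in
/-- The class of a diagram without dashed cups in the cell module. -/
noncomputable def cellClass (i m : ℕ) (x : Dashed i m) :
    {D : Diagram m (2 * i) // D.NoRightCup} →₀ R :=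
  if h : x.dashes = ∅ ∧ x.diagram.NoRightCup then Finsupp.single ⟨x.diagram, h.2⟩ 1 else 0

/-- Both `x` and its composite with `D` form exactly `i` loops with `L_max`. These cancel in the
cocycle identity, so `D` forms as many loops with `x` as with the diagram whose dashed cups are
deleted. -/
theorem deleteDashes_isNatural : IsNatural (dashedData a i) (loopData a) (deleteDashes R i) := by
  intro k m D x
  rw [dashedData_act, Finsupp.linearCombination_single]
  by_cases h : x.dashes.card = i
  · have h' : (x.lcomp D).dashes.card = i := h
    rw [deleteDashes, deleteDashes, if_pos h, if_pos h', TLData.actMap_single, loopData_act,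
      Finsupp.smul_single, smul_eq_mul, mul_one, Dashed.diagram_lcomp, Diagram.comp_assoc]
    have h1 := loops_cocycle D x.diagram (Diagram.leftMax i)
    have h2 := loops_leftMax h
    have h3 := loops_leftMax h'
    rw [Dashed.diagram_lcomp] at h3
    rw [show D.loops x.diagram = D.loops (x.diagram.comp (Diagram.leftMax i)) by omega]
  · have h' : ¬ (x.lcomp D).dashes.card = i := h
    rw [deleteDashes, deleteDashes, if_neg h, if_neg h', smul_zero, map_zero]

theorem cellClass_isNatural : IsNatural (dashedData a i) (quotientData a i) (cellClass R i) := by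
  intro k m D x
  rw [dashedData_act, Finsupp.linearCombination_single]
  by_cases h : x.dashes = ∅ ∧ x.diagram.NoRightCup
  · rw [cellClass, cellClass, dif_pos h, TLData.actMap_single]
    by_cases h' : (D.comp x.diagram).NoRightCup
    · rw [dif_pos ⟨h.1, h'⟩]
      refine Eq.trans ?_ (quotientData_act_of_noRightCup (a := a) (x := ⟨x.diagram, h.2⟩) h').symm
      rw [Finsupp.smul_single, smul_eq_mul, mul_one]
      rfl
    · rw [dif_neg fun h'' => h' h''.2, smul_zero]
      exact (quotientData_act_of_rightCup (a := a) (x := ⟨x.diagram, h.2⟩) h').symm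
  · rw [cellClass, cellClass, dif_neg h, dif_neg fun h' => h ⟨h'.1, h'.2.of_comp⟩, smul_zero,
      map_zero]

/-- The `i` loops of the dashed cups with `L_max` disappear on deletion; the weight shift by `i` on
the target makes up for them. -/
theorem deleteDashes_mem {𝒜 : ℕ → AddSubgroup R} [SetLike.GradedMonoid 𝒜] (x : Dashed i m) :
    deleteDashes R i m x ∈ homPart 𝒜 (fun y => (loopData a).closeLoops y + i)
      {y | (loopData a).close y = (dashedData a i).close x ∧ i = x.dashes.card}
      ((dashedData a i).closeLoops x + 0) := by
  by_cases h : x.dashes.card = i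
  · rw [deleteDashes, if_pos h]
    have h1 : (dashedData a i).closeLoops x + 0 = (loopData a).closeLoops
        (x.diagram.comp (Diagram.leftMax i)) + i := (loops_leftMax h).trans (Nat.zero_add i).symm
    rw [h1]
    exact single_one_mem_homPart (wt := fun y => (loopData a).closeLoops y + i) ⟨rfl, h.symm⟩
  · rw [deleteDashes, if_neg h]
    exact zero_mem _

theorem cellClass_mem {𝒜 : ℕ → AddSubgroup R} [SetLike.GradedMonoid 𝒜] (x : Dashed i m) :
    cellClass R i m x ∈ homPart 𝒜 (fun y => (quotientData a i).closeLoops y + 0)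
      {y | (quotientData a i).close y = (dashedData a i).close x ∧ 0 = x.dashes.card}
      ((dashedData a i).closeLoops x + 0) := by
  by_cases h : x.dashes = ∅ ∧ x.diagram.NoRightCup
  · rw [cellClass, dif_pos h]
    have h1 : (0 : ℕ) = x.dashes.card := (Finset.card_eq_zero.2 h.1).symm
    exact single_one_mem_homPart (wt := fun y => (quotientData a i).closeLoops y + 0)
      (b := (⟨x.diagram, h.2⟩ : (quotientData a i).B m)) ⟨rfl, h1⟩
  · rw [cellClass, dif_neg h]
    exact zero_mem _

theorem barMap_deleteDashes_mem {𝒜 : ℕ → AddSubgroup R} [SetLike.GradedMonoid 𝒜]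
    (b : Chain (Dashed i) n) :
    barMap n (deleteDashes R i) (Finsupp.single b 1) ∈
      homPart 𝒜 (fun c => Chain.wt (loopData a) c + i)
        {c | c.deg = b.deg ∧ chainLab (M := loopData a) (fun _ _ => i) c =
          chainLab (M := dashedData a i) (dashLab i) b} (Chain.wt (dashedData a i) b) :=
  barMap_single_mem (M := dashedData a i) (M' := loopData a) (rel := fun p q => q = p)
    (lab := dashLab i) (lab' := fun _ _ => i) (s := 0) (fun _ => deleteDashes_mem) b

theorem barMap_cellClass_mem {𝒜 : ℕ → AddSubgroup R} [SetLike.GradedMonoid 𝒜]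
    (b : Chain (Dashed i) n) :
    barMap n (cellClass R i) (Finsupp.single b 1) ∈
      homPart 𝒜 (fun c => Chain.wt (quotientData a i) c + 0)
        {c | c.deg = b.deg ∧ chainLab (M := quotientData a i) (fun _ _ => 0) c =
          chainLab (M := dashedData a i) (dashLab i) b} (Chain.wt (dashedData a i) b) :=
  barMap_single_mem (M := dashedData a i) (M' := quotientData a i) (rel := fun p q => q = p)
    (lab := dashLab i) (lab' := fun _ _ => 0) (s := 0) (fun _ => cellClass_mem) b

/-- There are never more than `i` dashes, so fewer than `i` remain after one has been removed. -/
theorem deleteDashes_undash (x : Dashed i m) :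
    Finsupp.linearCombination R (deleteDashes R i m) (undash x) = 0 := by
  rw [undash_eq, map_sum]
  refine Finset.sum_eq_zero fun j hj => ?_
  rw [Finsupp.linearCombination_single, deleteDashes, if_neg, smul_zero]
  have := Finset.card_erase_add_one hj
  have := x.card_dashes_le
  rw [Dashed.dashes_erase]
  omega

/-- An un-dashed cup is still a right cup, and diagrams with a right cup vanish in the cell module.
-/
theorem cellClass_undash (x : Dashed i m) :
    Finsupp.linearCombination R (cellClass R i m) (undash x) = 0 := by
  rw [undash_eq, map_sum]
  refine Finset.sum_eq_zero fun j hj => ?_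
  rw [Finsupp.linearCombination_single, cellClass, dif_neg, smul_zero]
  rintro ⟨-, h⟩
  obtain ⟨h1, h2⟩ := x.2 j hj
  exact h _ _ h2

theorem toSusp_innHook (x) : toSusp a (n + 1) i (innHook a n i x) =
    suspHook a n i (toSusp a n i x) :=
  barMap_barHook a deleteDashes_isNatural x

theorem toCell_innHook (x) : toCell a (n + 1) i (innHook a n i x) =
    cellHook a n i (toCell a n i x) :=
  barMap_barHook a cellClass_isNatural x

end ZigZag

/-! ### Homology by reduction along a filtration -/

section Reduction

variable {R : Type*} [CommRing R] {β γ : Type}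

/-- A linear endomorphism that decreases a filtration of the basis is locally nilpotent. -/
theorem exists_pow_eq_zero {e : (β →₀ R) →ₗ[R] (β →₀ R)} {g : β → ℕ}
    (he : ∀ b, e (Finsupp.single b 1) ∈ Finsupp.supported R R {c | g c < g b}) (x : β →₀ R) :
    ∃ N, (e ^ N) x = 0 := by
  have h : ∀ N, ∀ x ∈ Finsupp.supported R R {c | g c < N}, (e ^ N) x = 0 := by
    intro N
    induction N with
    | zero =>
      intro x hx
      simpa using hx
    | succ N ih =>
      intro x hx
      rw [pow_succ]
      refine ih _ (map_mem_supported (fun b hb => ?_) hx)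
      refine Finsupp.supported_mono (fun c hc => ?_) (he b)
      exact lt_of_lt_of_le hc (Nat.lt_succ_iff.1 hb)
  -- The filtration is bounded on the finite support of `x`, and each application of `e` lowers the
  -- bound by at least one.
  refine ⟨x.support.sup g + 1, h _ x ((Finsupp.mem_supported R x).2 fun b hb => ?_)⟩
  exact Nat.lt_succ_of_le (Finset.le_sup hb)

variable {D h e : (β →₀ R) →ₗ[R] (β →₀ R)} {D' : (γ →₀ R) →ₗ[R] (γ →₀ R)}
  {f : (β →₀ R) →ₗ[R] (γ →₀ R)} {s : (γ →₀ R) →ₗ[R] (β →₀ R)} {g : β → ℕ}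
  (hD : ∀ x, D (D x) = 0) (hf : ∀ x, f (D x) = D' (f x)) (hs : ∀ y, f (s y) = y)
  (hh : ∀ x, f (h x) = 0) (he : ∀ x, D (h x) + h (D x) = x - s (f x) - e x)
  (hg : ∀ b, e (Finsupp.single b 1) ∈ Finsupp.supported R R {c | g c < g b})
include hD hf hh he hg

/-- For a cycle `x` with `f x = 0` the homotopy gives `x = D(hx) + ex`, and `ex` is again a cycle
killed by `f`. Iterating, `x` is the boundary of `hx + hex + he²x + ⋯`, a finite sum by local
nilpotence. The section `s` is not assumed to be a chain map; the additional conclusion `f c = 0`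
makes up for this when cycles are lifted. -/
theorem exists_primitive {x : β →₀ R} (hx : D x = 0) (hx' : f x = 0) :
    ∃ c, D c = x ∧ f c = 0 := by
  obtain ⟨N, hN⟩ := exists_pow_eq_zero hg x
  induction N generalizing x with
  | zero => exact ⟨0, by rw [map_zero]; simpa using hN.symm, map_zero f⟩
  | succ N ih =>
    have h1 := he x
    rw [hx, map_zero, add_zero, hx', map_zero, sub_zero] at h1
    have h2 : e x = x - D (h x) := by rw [h1]; abel
    obtain ⟨c, hc, hc'⟩ := ih (x := e x) (by rw [h2, map_sub, hx, hD, sub_zero])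
      (by rw [h2, map_sub, hx', hf, hh, map_zero, sub_zero]) (by rwa [pow_succ] at hN)
    refine ⟨h x + c, ?_, ?_⟩
    · rw [map_add, hc, h2]; abel
    · rw [map_add, hh, hc', add_zero]

include hs

/-- Subtracting the boundary of a lift of `b` from `x` reduces to the case `f x = 0`. -/
theorem exists_boundary {x : β →₀ R} (hx : D x = 0) (hx' : ∃ b, D' b = f x) : ∃ c, D c = x := by
  obtain ⟨b, hb⟩ := hx'
  obtain ⟨c, hc, -⟩ := exists_primitive hD hf hh he hg (x := x - D (s b))
    (by rw [map_sub, hx, hD, sub_zero]) (by rw [map_sub, hf, hs, hb, sub_self])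
  exact ⟨c + s b, by rw [map_add, hc]; abel⟩

/-- The lift `s y` need not be a cycle, but its boundary is a cycle in the kernel of `f`. Correcting
`s y` by a primitive in the kernel of `f` gives a cycle that still maps to `y`. -/
theorem exists_cycle {y : γ →₀ R} (hy : D' y = 0) : ∃ x, D x = 0 ∧ f x = y := by
  obtain ⟨c, hc, hc'⟩ := exists_primitive hD hf hh he hg (x := D (s y)) (hD _)
    (by rw [hf, hs, hy])
  exact ⟨s y - c, by rw [map_sub, hc, sub_self], by rw [map_sub, hs, hc', sub_zero]⟩

end Reduction

/-! ### Projections to the homogeneous parts -/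

section Projection

variable {R : Type*} [CommRing R] {β γ : Type} {deg : β → ℕ} {deg' : γ → ℕ} {wt : β → ℕ}
  {wt' : γ → ℕ}

/-- The projection to the part of degree `k`. -/
noncomputable def degProj (R : Type*) [CommRing R] (deg : β → ℕ) (k : ℕ) :
    (β →₀ R) →ₗ[R] (β →₀ R) :=
  Finsupp.linearCombination R fun b => if deg b = k then Finsupp.single b 1 else 0

theorem degProj_of_mem {j k : ℕ} {x : β →₀ R} (hx : x ∈ Finsupp.supported R R {b | deg b = j}) :
    degProj R deg k x = if j = k then x else 0 := by
  refine (eq_of_mem_supported (f := degProj R deg k)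
    (g := if j = k then LinearMap.id else 0) (fun b hb => ?_) hx).trans ?_
  · obtain rfl : deg b = j := hb
    rw [degProj, Finsupp.linearCombination_single, one_smul]
    split_ifs <;> rfl
  · split_ifs <;> rfl

theorem degProj_mem (k : ℕ) (x : β →₀ R) :
    degProj R deg k x ∈ Finsupp.supported R R {b | deg b = k} := by
  refine map_mem_supported (P := Set.univ) (fun b _ => ?_) (by simp)
  rw [degProj, Finsupp.linearCombination_single, one_smul]
  split_ifs with h
  · exact Finsupp.single_mem_supported R 1 h
  · exact zero_mem _

theorem map_degProj {f : (β →₀ R) →ₗ[R] (γ →₀ R)}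
    (hf : ∀ k, ∀ x ∈ Finsupp.supported R R {b | deg b = k},
      f x ∈ Finsupp.supported R R {c | deg' c = k}) (k : ℕ) (x) :
    f (degProj R deg k x) = degProj R deg' k (f x) :=
  linear_congr (f := f ∘ₗ degProj R deg k) (g := degProj R deg' k ∘ₗ f) (fun b => by
    have h : Finsupp.single b (1 : R) ∈ Finsupp.supported R R {c | deg c = deg b} :=
      Finsupp.single_mem_supported R 1 rfl
    simp only [LinearMap.comp_apply]
    rw [degProj_of_mem h, degProj_of_mem (hf _ _ h)]
    split_ifs
    · rfl
    · exact map_zero f) x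

/-- Basis elements of degree zero are treated separately: there `f` vanishes, whereas on degree `l +
1` it lowers degrees by one. -/
theorem map_degProj_succ {f : (β →₀ R) →ₗ[R] (γ →₀ R)}
    (hf : ∀ k, ∀ x ∈ Finsupp.supported R R {b | deg b = k + 1},
      f x ∈ Finsupp.supported R R {c | deg' c = k})
    (hf0 : ∀ x ∈ Finsupp.supported R R {b | deg b = 0}, f x = 0) (k : ℕ) (x) :
    f (degProj R deg (k + 1) x) = degProj R deg' k (f x) :=
  linear_congr (f := f ∘ₗ degProj R deg (k + 1)) (g := degProj R deg' k ∘ₗ f) (fun b => by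
    simp only [LinearMap.comp_apply]
    rcases hb : deg b with _ | l
    · have h : Finsupp.single b (1 : R) ∈ Finsupp.supported R R {c | deg c = 0} :=
        Finsupp.single_mem_supported R 1 hb
      rw [degProj_of_mem h, if_neg (Nat.succ_ne_zero k).symm, hf0 _ h, map_zero, map_zero]
    · have h : Finsupp.single b (1 : R) ∈ Finsupp.supported R R {c | deg c = l + 1} :=
        Finsupp.single_mem_supported R 1 hb
      rw [degProj_of_mem h, degProj_of_mem (hf _ _ h)]
      simp only [Nat.add_right_cancel_iff]
      split_ifs
      · rfl
      · exact map_zero f) x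

variable (𝒜 : ℕ → AddSubgroup R) [GradedRing 𝒜]

/-- The projection to the part of weight `w`. -/
noncomputable def wtProj (wt : β → ℕ) (w : ℕ) : (β →₀ R) →+ (β →₀ R) :=
  Finsupp.liftAddHom fun b =>
    -- The condition guards the truncated subtraction: a basis element heavier than `w` has no part
    -- of weight `w`.
    if wt b ≤ w then (Finsupp.singleAddHom b).comp (GradedRing.proj 𝒜 (w - wt b)) else 0

variable {𝒜}

theorem wtProj_of_mem {v w : ℕ} {x : β →₀ R} (hx : x ∈ homPart 𝒜 wt Set.univ v) :
    wtProj 𝒜 wt w x = if v = w then x else 0 := by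
  induction hx using AddSubgroup.closure_induction with
  | mem x hx =>
    obtain ⟨b, j, r, hr, -, rfl, rfl⟩ := hx
    rw [wtProj, Finsupp.liftAddHom_apply_single]
    by_cases h : wt b ≤ w
    · rw [if_pos h, AddMonoidHom.comp_apply, GradedRing.proj_apply]
      by_cases h' : j = w - wt b
      · rw [if_pos (by omega), ← h', DirectSum.decompose_of_mem_same 𝒜 hr]
        rfl
      · rw [if_neg (by omega), DirectSum.decompose_of_mem_ne 𝒜 hr h', map_zero]
    · rw [if_neg h, if_neg (by omega)]
      rfl
  | zero => simp
  | add x y _ _ hx hy => rw [map_add, hx, hy]; split_ifs <;> simp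
  | neg x _ hx => rw [map_neg, hx]; split_ifs <;> simp

theorem wtProj_mem (w : ℕ) (x : β →₀ R) : wtProj 𝒜 wt w x ∈ homPart 𝒜 wt Set.univ w := by
  induction x using Finsupp.induction_linear with
  | zero => rw [map_zero]; exact zero_mem _
  | add x y hx hy => rw [map_add]; exact add_mem hx hy
  | single b r =>
    rw [wtProj, Finsupp.liftAddHom_apply_single]
    split_ifs with h
    · rw [AddMonoidHom.comp_apply, GradedRing.proj_apply]
      exact single_mem_homPart (SetLike.coe_mem _) trivial (Nat.sub_add_cancel h)
    · exact zero_mem _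

theorem map_wtProj {f : (β →₀ R) →ₗ[R] (γ →₀ R)}
    (hf : ∀ w, ∀ x ∈ homPart 𝒜 wt Set.univ w, f x ∈ homPart 𝒜 wt' Set.univ w) (w : ℕ) (x) :
    f (wtProj 𝒜 wt w x) = wtProj 𝒜 wt' w (f x) := by
  have key : ∀ v, ∀ x ∈ homPart 𝒜 wt Set.univ v,
      f (wtProj 𝒜 wt w x) = wtProj 𝒜 wt' w (f x) := by
    intro v x hx
    rw [wtProj_of_mem hx, wtProj_of_mem (hf v x hx)]
    split_ifs
    · rfl
    · exact map_zero f
  induction x using Finsupp.induction_linear with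
  | zero => simp
  | add x y hx hy => rw [map_add, map_add, map_add, map_add, hx, hy]
  | single b r =>
    induction r using DirectSum.Decomposition.inductionOn 𝒜 with
    | zero => simp
    | homogeneous r => exact key _ _ (single_mem_homPart (SetLike.coe_mem r) trivial rfl)
    | add r r' hr hr' => rw [Finsupp.single_add, map_add, map_add, map_add, map_add, hr, hr']

end Projection

/-! ### From ungraded homology to each bidegree -/

section QuasiIso

variable {R : Type*} [CommRing R] {a : R} {n : ℕ} {M N : DGData R n}
  {f : M.Carrier →ₗ[R] N.Carrier}

/-- Ungraded homology is bijective. -/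
structure IsHomologyIso (f : M.Carrier →ₗ[R] N.Carrier) : Prop where
  boundary : ∀ x, M.d x = 0 → (∃ b, N.d b = f x) → ∃ c, M.d c = x
  cycle : ∀ y, N.d y = 0 → ∃ x, M.d x = 0 ∧ f x = y

variable (hf : IsHomologyIso f)
include hf

/-- Projections compatible with the differentials and with `f` turn arbitrary primitives and lifts
into homogeneous ones. Since lifts hit `y` exactly, the correcting boundary in the target can be
taken to be zero. -/
theorem IsHomologyIso.homologyBijective {S S' : AddSubgroup M.Carrier}
    {T T' : AddSubgroup N.Carrier} {π π' : M.Carrier → M.Carrier} {ρ : N.Carrier → N.Carrier}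
    (hS : ∀ x ∈ S, π x = x) (hπ : ∀ x, π x ∈ S) (hπ' : ∀ x, π' x ∈ S')
    (hd : ∀ x, M.d (π' x) = π (M.d x)) (hd0 : ∀ x, M.d x = 0 → M.d (π x) = 0)
    (hfπ : ∀ x, f (π x) = ρ (f x)) (hT : ∀ y ∈ T, ρ y = y) : HomologyBijective f S S' T T' := by
  constructor
  · rintro x hx hdx ⟨b, -, hb⟩
    obtain ⟨c, hc⟩ := hf.boundary x hdx ⟨b, hb⟩
    exact ⟨π' c, hπ' c, by rw [hd, hc, hS x hx]⟩
  · intro y hy hdy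
    obtain ⟨x, hx, hxy⟩ := hf.cycle y hdy
    refine ⟨π x, hπ x, hd0 x hx, 0, zero_mem _, ?_⟩
    rw [hfπ, hxy, hT y hy, map_zero, sub_self]

theorem IsHomologyIso.isQuasiIso (hM : IsDGModule a M)
    (map_deg : ∀ k, ∀ x ∈ M.degPart k, f x ∈ N.degPart k) (map_d : ∀ x, f (M.d x) = N.d (f x))
    (map_act : ∀ r x, f (M.act r x) = N.act r (f x)) : IsQuasiIso f where
  map_deg := map_deg
  map_d := map_d
  map_act := map_act
  homology k := by
    refine hf.homologyBijective (π := degProj R M.deg k) (π' := degProj R M.deg (k + 1))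
      (ρ := degProj R N.deg k) (fun x hx => (degProj_of_mem hx).trans (if_pos rfl))
      (degProj_mem k) (degProj_mem (k + 1)) (map_degProj_succ hM.d_deg hM.d_deg_zero k)
      (fun x hx => ?_) (map_degProj map_deg k)
      (fun x hx => (degProj_of_mem hx).trans (if_pos rfl))
    rcases k with _ | k
    · exact hM.d_deg_zero _ (degProj_mem 0 x)
    · rw [map_degProj_succ hM.d_deg hM.d_deg_zero, hx, map_zero]

theorem IsHomologyIso.isBigradedQuasiIso {𝒜 : ℕ → AddSubgroup R} [GradedRing 𝒜]
    (hM : IsBigradedDGModule a 𝒜 M) (hf' : IsQuasiIso f)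
    (map_wt : ∀ w, ∀ x ∈ M.wtPart 𝒜 w, f x ∈ N.wtPart 𝒜 w) : IsBigradedQuasiIso 𝒜 f where
  toIsQuasiIso := hf'
  map_wt := map_wt
  homology_wt k w := by
    have hd := map_degProj_succ hM.d_deg hM.d_deg_zero
    have hdw : ∀ x, M.d (wtProj 𝒜 M.wt w x) = wtProj 𝒜 M.wt w (M.d x) := fun x =>
      map_wtProj (fun w x hx => by
        have := hM.d_wt w x (by rwa [DGData.wtPart_eq])
        rwa [DGData.wtPart_eq] at this) w x
    have hfw : ∀ x, f (wtProj 𝒜 M.wt w x) = wtProj 𝒜 N.wt w (f x) := fun x =>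
      map_wtProj (fun w x hx => by
        have := map_wt w x (by rwa [DGData.wtPart_eq])
        rwa [DGData.wtPart_eq] at this) w x
    have hπ : ∀ k x, degProj R M.deg k (wtProj 𝒜 M.wt w x) ∈ M.degPart k ⊓ M.wtPart 𝒜 w := by
      intro k x
      refine ⟨degProj_mem k _, ?_⟩
      rw [DGData.wtPart_eq]
      refine map_mem_homPart (s := 0) (fun b _ => ?_) (wtProj_mem w x)
      rw [degProj, Finsupp.linearCombination_single, one_smul]
      split_ifs
      · exact single_one_mem_homPart trivial
      · exact zero_mem _
    refine hf.homologyBijective (π := fun x => degProj R M.deg k (wtProj 𝒜 M.wt w x))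
      (π' := fun x => degProj R M.deg (k + 1) (wtProj 𝒜 M.wt w x))
      (ρ := fun y => degProj R N.deg k (wtProj 𝒜 N.wt w y)) ?_ (hπ k) (hπ (k + 1)) ?_ ?_ ?_ ?_
    · rintro x ⟨hx, hx'⟩
      rw [DGData.wtPart_eq] at hx'
      change degProj R M.deg k (wtProj 𝒜 M.wt w x) = x
      rw [wtProj_of_mem hx', if_pos rfl]
      exact (degProj_of_mem hx).trans (if_pos rfl)
    · intro x
      rw [hd, hdw]
    · intro x hx
      rcases k with _ | k
      · exact hM.d_deg_zero _ (degProj_mem 0 _)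
      · rw [hd, hdw, hx, map_zero, map_zero]
    · intro x
      rw [← hfw]
      exact map_degProj hf'.map_deg k _
    · rintro x ⟨hx, hx'⟩
      rw [DGData.wtPart_eq] at hx'
      change degProj R N.deg k (wtProj 𝒜 N.wt w x) = x
      rw [wtProj_of_mem hx', if_pos rfl]
      exact (degProj_of_mem hx).trans (if_pos rfl)

end QuasiIso

/-! ### The map to the derived cell module -/

section MapComposition

variable {R : Type*} [CommRing R] {n : ℕ} {B B' B'' : ℕ → Type}

theorem barMap_mapDomain_base (f : ∀ m, B m → (B' m →₀ R)) (v : B 0 →₀ R) :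
    barMap n f (v.mapDomain .base) = (Finsupp.linearCombination R (f 0) v).mapDomain .base :=
  barMap_base f v

theorem barMap_mapDomain_bar (f : ∀ m, B m → (B' m →₀ R)) (hn : 0 < n) (D u)
    (v : B (2 * n) →₀ R) : barMap n f (v.mapDomain (.bar hn D u)) =
      (Finsupp.linearCombination R (f _) v).mapDomain (.bar hn D u) :=
  linear_congr (f := barMap n f ∘ₗ Finsupp.lmapDomain R R (.bar hn D u))
    (g := Finsupp.lmapDomain R R (.bar hn D u) ∘ₗ Finsupp.linearCombination R (f _))
    (fun x => by simp [barMap, chainMap]) v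

theorem barMap_single (f : ∀ m, B m → (B' m →₀ R)) (b : Chain B n) :
    barMap n f (Finsupp.single b 1) = chainMap n f b := by
  rw [barMap, Finsupp.linearCombination_single, one_smul]

theorem barMap_single_supported (f : ∀ m, B m → (B' m →₀ R)) (b : Chain B n) :
    barMap n f (Finsupp.single b 1) ∈ Finsupp.supported R R {c | c.deg = b.deg} := by
  classical
  rw [barMap_single, Finsupp.mem_supported]
  rcases b with y | ⟨hn, D, u, y⟩ <;>
  · intro c hc
    obtain ⟨z, -, rfl⟩ := Finset.mem_image.1 (Finsupp.mapDomain_support hc)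
    rfl

theorem barMap_id_of {f : ∀ m, B m → (B' m →₀ R)} {g : ∀ m, B' m → (B m →₀ R)}
    (h : ∀ m x, Finsupp.linearCombination R (f m) (g m x) = Finsupp.single x 1)
    (x : Chain B' n →₀ R) : barMap n f (barMap n g x) = x :=
  linear_congr (f := barMap n f ∘ₗ barMap n g) (g := LinearMap.id) (fun b => by
    rw [LinearMap.comp_apply, barMap_single]
    rcases b with y | ⟨hn, D, u, y⟩ <;>
    simp only [chainMap, barMap_mapDomain_base, barMap_mapDomain_bar, h,
      Finsupp.mapDomain_single, LinearMap.id_apply]) x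

end MapComposition

/-! ### Contracting the complex of innermost cups -/

section FirstCup

variable {R : Type*} [CommRing R] {a : R} {n i m : ℕ}

/-- The lowest innermost right cup. -/
def Diagram.IsFirstCup {m n : ℕ} (D : Diagram m n) (j : Fin n) : Prop :=
  D.IsInnermostRightCup j ∧ ∀ k, D.IsInnermostRightCup k → j ≤ k

theorem Diagram.IsFirstCup.unique {m n : ℕ} {D : Diagram m n} {j k : Fin n} (hj : D.IsFirstCup j)
    (hk : D.IsFirstCup k) : j = k := le_antisymm (hj.2 k hk.1) (hk.2 j hj.1)

theorem Diagram.exists_isFirstCup {m n : ℕ} {D : Diagram m n} (hD : ¬ D.NoRightCup) :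
    ∃ j, D.IsFirstCup j := by
  classical
  obtain ⟨j, hj⟩ := Diagram.exists_innermost hD
  have hne : (Finset.univ.filter fun j => D.IsInnermostRightCup j).Nonempty :=
    ⟨j, by simpa using hj⟩
  refine ⟨_, (Finset.mem_filter.1 (Finset.min'_mem _ hne)).2, fun k hk => ?_⟩
  exact Finset.min'_le _ _ (by simpa using hk)

theorem Diagram.IsInnermostRightCup.not_noRightCup {m n : ℕ} {D : Diagram m n} {j : Fin n}
    (hj : D.IsInnermostRightCup j) : ¬ D.NoRightCup := fun h => h _ _ hj.2

/-- Add a dash. -/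
def Dashed.insert (x : Dashed i m) (j : Fin (2 * i)) (hj : x.diagram.IsInnermostRightCup j) :
    Dashed i m :=
  ⟨(x.diagram, Insert.insert j x.dashes), fun k hk => by
    rcases Finset.mem_insert.1 hk with rfl | hk
    · exact hj
    · exact x.2 k hk⟩

open Classical in
variable (R) in
/-- Dash the lowest innermost right cup. -/
noncomputable def dashFirst (m : ℕ) (x : Dashed i m) : Dashed i m →₀ R :=
  if h : ∃ j, x.diagram.IsFirstCup j ∧ j ∉ x.dashes then
    Finsupp.single (x.insert h.choose h.choose_spec.1.1) 1 else 0

theorem dashFirst_of_notMem {x : Dashed i m} {j : Fin (2 * i)} (hj : x.diagram.IsFirstCup j)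
    (hjx : j ∉ x.dashes) : dashFirst R m x = Finsupp.single (x.insert j hj.1) 1 := by
  have h : ∃ j, x.diagram.IsFirstCup j ∧ j ∉ x.dashes := ⟨j, hj, hjx⟩
  have h' : h.choose = j := h.choose_spec.1.unique hj
  rw [dashFirst, dif_pos h]
  simp only [h']

theorem dashFirst_of_mem {x : Dashed i m} {j : Fin (2 * i)} (hj : x.diagram.IsFirstCup j)
    (hjx : j ∈ x.dashes) : dashFirst R m x = 0 := by
  rw [dashFirst, dif_neg]
  rintro ⟨k, hk, hkx⟩
  exact hkx (hk.unique hj ▸ hjx)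

theorem dashFirst_of_noRightCup {x : Dashed i m} (hx : x.diagram.NoRightCup) :
    dashFirst R m x = 0 := by
  rw [dashFirst, dif_neg]
  rintro ⟨k, hk, -⟩
  exact hk.1.not_noRightCup hx

theorem filter_lt_first {x : Dashed i m} {j : Fin (2 * i)} (hj : x.diagram.IsFirstCup j) :
    x.dashes.filter (· < j) = ∅ :=
  Finset.filter_eq_empty_iff.2 fun k hk => not_lt.2 (hj.2 k (x.2 k hk))

/-- A diagram without dashes. -/
def Dashed.ofDiagram (D : Diagram m (2 * i)) : Dashed i m :=
  ⟨(D, ∅), fun _ hj => absurd hj (Finset.notMem_empty _)⟩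

variable (R) in
/-- A diagram without right cups, without dashes. -/
noncomputable def undashed (i m : ℕ) (x : {D : Diagram m (2 * i) // D.NoRightCup}) :
    Dashed i m →₀ R :=
  Finsupp.single (Dashed.ofDiagram x.1) 1

theorem cellClass_undashed (m : ℕ) (x : {D : Diagram m (2 * i) // D.NoRightCup}) :
    Finsupp.linearCombination R (cellClass R i m) (undashed R i m x) = Finsupp.single x 1 := by
  rw [undashed, Finsupp.linearCombination_single, one_smul, cellClass]
  exact dif_pos ⟨rfl, x.2⟩

theorem cellClass_dashFirst (x : Dashed i m) :
    Finsupp.linearCombination R (cellClass R i m) (dashFirst R m x) = 0 := by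
  by_cases h : ∃ j, x.diagram.IsFirstCup j ∧ j ∉ x.dashes
  · obtain ⟨j, hj, hjx⟩ := h
    rw [dashFirst_of_notMem hj hjx, Finsupp.linearCombination_single, one_smul, cellClass,
      dif_neg fun h => hj.1.not_noRightCup h.2]
  · rw [dashFirst, dif_neg h, map_zero]

/-- The complex of innermost cups of a diagram is contractible. -/
theorem undash_dashFirst (x : Dashed i m) :
    Finsupp.linearCombination R undash (dashFirst R m x) +
      Finsupp.linearCombination R (dashFirst R m) (undash x) =
    Finsupp.single x 1 - Finsupp.linearCombination R (undashed R i m) (cellClass R i m x) := by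
  by_cases hx : x.diagram.NoRightCup
  · have h0 : x.dashes = ∅ :=
      Finset.eq_empty_of_forall_notMem fun j hj => (x.2 j hj).not_noRightCup hx
    rw [dashFirst_of_noRightCup hx, undash_eq, h0, Finset.sum_empty, map_zero, map_zero, add_zero,
      cellClass, dif_pos ⟨h0, hx⟩, Finsupp.linearCombination_single, one_smul, undashed, eq_comm,
      sub_eq_zero]
    congr 1
    exact Dashed.ext rfl h0
  · obtain ⟨j, hj⟩ := Diagram.exists_isFirstCup hx
    rw [cellClass, dif_neg fun h => hx h.2, map_zero, sub_zero]
    -- The lowest cup `j` is the apex of a cone. If it is dashed already, only the face that removes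
    -- `j` can be coned off again; it carries the sign `+` because no dashed cup lies below `j`.
    by_cases hjx : j ∈ x.dashes
    · rw [dashFirst_of_mem hj hjx, map_zero, zero_add, undash_eq, map_sum,
        Finset.sum_eq_single j]
      · have hj' : (x.erase j).diagram.IsFirstCup j := hj
        rw [Finsupp.linearCombination_single, dashFirst_of_notMem hj' (Finset.notMem_erase _ _),
          filter_lt_first hj, Finset.card_empty, pow_zero, one_smul]
        congr 1
        exact Dashed.ext rfl (Finset.insert_erase hjx)
      · intro k hk hkj
        have hj' : (x.erase k).diagram.IsFirstCup j := hj
        rw [Finsupp.linearCombination_single,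
          dashFirst_of_mem hj' (Finset.mem_erase.2 ⟨hkj.symm, hjx⟩), smul_zero]
      · exact fun h => absurd hjx h
    -- Dashing `j` raises the position of every other dashed cup by one, so the faces at `k ≠ j`
    -- occur with opposite signs in the two terms. The face at `j` gives `x` back.
    · have hd : (x.insert j hj.1).dashes = Insert.insert j x.dashes := rfl
      have hlt : ∀ k ∈ x.dashes, j < k := fun k hk =>
        lt_of_le_of_ne (hj.2 k (x.2 k hk)) fun h => hjx (h ▸ hk)
      have hj' : (x.insert j hj.1).diagram.IsFirstCup j := hj
      rw [dashFirst_of_notMem hj hjx, Finsupp.linearCombination_single, one_smul, undash_eq, hd,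
        Finset.sum_insert hjx, ← hd, filter_lt_first hj', undash_eq, map_sum, add_assoc,
        ← Finset.sum_add_distrib, Finset.sum_eq_zero, add_zero, Finset.card_empty, pow_zero]
      · congr 1
        exact Dashed.ext rfl (Finset.erase_insert hjx)
      · intro k hk
        have hk' : (x.erase k).diagram.IsFirstCup j := hj
        have h1 : j ∉ (x.erase k).dashes := fun h => hjx (Finset.mem_of_mem_erase h)
        have h2 : (x.insert j hj.1).erase k = (x.erase k).insert j hk'.1 :=
          Dashed.ext rfl (Finset.erase_insert_of_ne (hlt k hk).ne)
        rw [Finsupp.linearCombination_single, dashFirst_of_notMem hk' h1, h2, hd,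
          Finset.filter_insert, if_pos (hlt k hk), Finset.card_insert_of_notMem
            fun h => hjx (Finset.mem_filter.1 h).1, Finsupp.smul_single, ← Finsupp.single_add,
          smul_eq_mul, pow_succ, mul_one, mul_neg_one, neg_add_cancel, Finsupp.single_zero]

theorem barUndash_dashFirst (x : Chain (Dashed i) n →₀ R) :
    barUndash R n i (barMap n (dashFirst R) x) + barMap n (dashFirst R) (barUndash R n i x) =
      x - barMap n (undashed R i) (barMap n (cellClass R i) x) :=
  linear_congr (f := barUndash R n i ∘ₗ barMap n (dashFirst R) +
      barMap n (dashFirst R) ∘ₗ barUndash R n i)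
    (g := LinearMap.id - barMap n (undashed R i) ∘ₗ barMap n (cellClass R i)) (fun b => by
    simp only [LinearMap.add_apply, LinearMap.sub_apply, LinearMap.comp_apply, barUndash,
      barMap_single, LinearMap.id_apply]
    rcases b with y | ⟨hn, D, u, y⟩ <;>
    simp only [chainMap, barMap_mapDomain_base, barMap_mapDomain_bar] <;>
    rw [← Finsupp.mapDomain_add, undash_dashFirst, ← Finsupp.mapDomain_single] <;>
    exact map_sub (Finsupp.mapDomain.addMonoidHom _) _ _) x

theorem barMap_cellClass_dashFirst (x : Chain (Dashed i) n →₀ R) :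
    barMap n (cellClass R i) (barMap n (dashFirst R) x) = 0 :=
  linear_congr (f := barMap n (cellClass R i) ∘ₗ barMap n (dashFirst R)) (g := 0) (fun b => by
    simp only [LinearMap.comp_apply, barMap_single]
    rcases b with y | ⟨hn, D, u, y⟩ <;>
    simp only [chainMap, barMap_mapDomain_base, barMap_mapDomain_bar, cellClass_dashFirst,
      Finsupp.mapDomain_zero, LinearMap.zero_apply]) x

/-- The part of the bar differential that keeps the sum of `δ` and `dashFirst` from being a
contraction. -/
noncomputable def cellError (a : R) (n i : ℕ) :
    (Chain (Dashed i) n →₀ R) →ₗ[R] (Chain (Dashed i) n →₀ R) :=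
  -(barDiff a (dashedData a i) ∘ₗ signMap R (chainLab (M := dashedData a i) (dashLab i)) 1 ∘ₗ
      barMap n (dashFirst R) +
    barMap n (dashFirst R) ∘ₗ barDiff a (dashedData a i) ∘ₗ
      signMap R (chainLab (M := dashedData a i) (dashLab i)) 1)

theorem signMap_mem_supported {β : Type} {p : β → ℕ} {P : Set β} (j : ℕ) {x : β →₀ R}
    (hx : x ∈ Finsupp.supported R R P) : signMap R p j x ∈ Finsupp.supported R R P :=
  map_mem_supported (fun b hb => by
    rw [signMap_single]
    exact Submodule.smul_mem _ _ (Finsupp.single_mem_supported R 1 hb)) hx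

/-- Composition can create lower innermost cups, so `dashFirst` is not compatible with `d`. However,
it keeps the bar degree while `d` lowers it, so the error strictly lowers the bar degree. -/
theorem cellError_supported (b : Chain (Dashed i) n) :
    cellError a n i (Finsupp.single b 1) ∈ Finsupp.supported R R {c | c.deg < b.deg} := by
  have hd : ∀ x ∈ Finsupp.supported R R {c : Chain (Dashed i) n | c.deg = b.deg},
      barDiff a (dashedData a i) x ∈
        Finsupp.supported R R {c : Chain (Dashed i) n | c.deg < b.deg} := fun x hx =>
    map_mem_supported (fun c hc => Finsupp.supported_mono (fun c' hc' => by
      have h1 : c'.deg + 1 = c.deg := hc'.1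
      have h2 : c.deg = b.deg := hc
      change c'.deg < b.deg
      omega) (barDiff_single_supported (dashedData_isWeighted i) c)) hx
  refine neg_mem (add_mem ?_ ?_)
  · exact hd _ (signMap_mem_supported 1 (barMap_single_supported _ b))
  · refine map_mem_supported (P := {c | c.deg < b.deg}) (f := barMap n (dashFirst R))
      (fun c hc => ?_)
      (hd _ (signMap_mem_supported 1 (Finsupp.single_mem_supported R 1 rfl)))
    refine Finsupp.supported_mono (fun c' hc' => ?_) (barMap_single_supported _ c)
    exact lt_of_eq_of_lt hc' hc

/-- The reduction lemma is applied with the homotopy `dashFirst`, which contracts the complexes of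
innermost cups, and the filtration by bar degree. -/
theorem toCell_isHomologyIso :
    IsHomologyIso (M := innTwist a n i) (N := cellTwist a n i) (barMap n (cellClass R i)) := by
  have hM := twistDG_isDGModule (n := n) 0 (dashedData_isModule (a := a) i)
    (dashedData_isWeighted i) barUndash_isTwist
  have hd : ∀ x, barMap n (cellClass R i)
      (twistDiff (M := dashedData a i) a (dashLab i) (barUndash R n i) x) =
      twistDiff (M := quotientData a i) a (fun _ _ => 0) 0 (barMap n (cellClass R i) x) :=
    barMap_twistDiff (M := dashedData a i) (M' := quotientData a i) cellClass_isNatural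
      (fun b => homPart_le_supported (barMap_cellClass_mem (𝒜 := fun _ => ⊤) b))
      (barMap_barUndash fun _ => cellClass_undash)
  have he : ∀ x, twistDiff (M := dashedData a i) a (dashLab i) (barUndash R n i)
        (barMap n (dashFirst R) x) +
      barMap n (dashFirst R) (twistDiff (M := dashedData a i) a (dashLab i) (barUndash R n i) x) =
      x - barMap n (undashed R i) (barMap n (cellClass R i) x) - cellError a n i x := by
    intro x
    rw [← barUndash_dashFirst, twistDiff_apply, twistDiff_apply, map_add, cellError]
    simp only [LinearMap.neg_apply, LinearMap.add_apply, LinearMap.comp_apply]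
    abel
  constructor
  · intro x hx hx'
    exact exists_boundary hM.d_d hd (barMap_id_of cellClass_undashed) barMap_cellClass_dashFirst
      he cellError_supported hx hx'
  · intro y hy
    exact exists_cycle hM.d_d hd (barMap_id_of cellClass_undashed) barMap_cellClass_dashFirst
      he cellError_supported hy

end FirstCup

/-! ### The map to the suspension of the dga of planar loops -/

section Split

variable {R : Type*} [CommRing R] {a : R} {n i m k : ℕ}

/-- Diagrams with right cups at `S` factor through `2n` nodes without forming loops. -/
def Splits (n : ℕ) {i : ℕ} (S : Finset (Fin (2 * i))) : Prop :=
  S.card < i ∧ ∃ (U : Diagram (2 * i) (2 * n)) (V : Diagram (2 * n) (2 * i)),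
    IsSplitting (S.image Fin.val) U V

/-- The factorisation through `2n` nodes exists because `2n = 2i + 2(n - i)`, and fewer than `i`
cups do not cover all `2i` nodes. -/
theorem Dashed.splits (hi : i ≤ n) {x : Dashed i m} (hx : x.dashes.card < i) :
    Splits n x.dashes := by
  refine ⟨hx, exists_splitting (t := n - i) _ ?_ ?_ (by omega)⟩
  · intro j hj
    obtain ⟨j, hj', rfl⟩ := Finset.mem_image.1 hj
    refine ⟨(Dashed.hasCup hj').1, fun h => ?_⟩
    obtain ⟨j', hj'', h⟩ := Finset.mem_image.1 h
    exact x.not_succ_mem hj' h hj''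
  · rw [Finset.card_image_of_injective _ Fin.val_injective]
    omega

variable {S : Finset (Fin (2 * i))}

/-- The first factor of a splitting. -/
noncomputable def Splits.left (h : Splits n S) : Diagram (2 * i) (2 * n) := h.2.choose

/-- The second factor of a splitting, with dashes. -/
noncomputable def Splits.right (h : Splits n S) : Dashed i (2 * n) :=
  ⟨(h.2.choose_spec.choose, S), fun _ hj =>
    h.2.choose_spec.choose_spec.hasCup _ (Finset.mem_image_of_mem _ hj)⟩

theorem Splits.isSplitting (h : Splits n S) :
    IsSplitting (S.image Fin.val) h.left h.right.diagram := h.2.choose_spec.choose_spec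

theorem Dashed.hasCup_image (x : Dashed i m) : ∀ j ∈ x.dashes.image Fin.val, x.diagram.HasCup j := by
  intro j hj
  obtain ⟨j, hj', rfl⟩ := Finset.mem_image.1 hj
  exact Dashed.hasCup hj'

variable {x : Dashed i m} (h : Splits n x.dashes)

theorem Splits.lcomp_right : h.right.lcomp (x.diagram.comp h.left) = x :=
  Dashed.ext (h.isSplitting.comp_comp _ _ x.hasCup_image) rfl

theorem Splits.loops_left_right : (x.diagram.comp h.left).loops h.right.diagram = 0 :=
  h.isSplitting.loops_right _ _ x.hasCup_image

/-- Neither `x` nor its composite with `A` forms loops with the first factor, so the cocycle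
identity equates the two remaining counts. -/
theorem Splits.loops_comp_left (A : Diagram k m) :
    A.loops (x.diagram.comp h.left) = A.loops x.diagram := by
  have h1 := loops_cocycle A x.diagram h.left
  have h2 := h.isSplitting.loops_left _ _ x.hasCup_image
  have h3 := h.isSplitting.loops_left _ _ (x.lcomp A).hasCup_image
  rw [Dashed.diagram_lcomp] at h3
  omega

end Split

/-! ### Contracting the part with fewer than `i` dashes -/

section Contraction

variable {R : Type*} [CommRing R] {a : R} {n i m k : ℕ}

open Classical in
variable (R) in
/-- Split off the dashed cups. -/
noncomputable def splitTail (n i : ℕ) (x : Dashed i (2 * n)) : Tail (Dashed i) n →₀ R :=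
  if h : Splits n x.dashes then Finsupp.single ([x.diagram.comp h.left], h.right) 1 else 0

open Classical in
variable (R) in
/-- Split off the dashed cups. -/
noncomputable def splitBase (n i : ℕ) (y : Dashed i 0) : Chain (Dashed i) n →₀ R :=
  if h : 0 < n ∧ Splits n y.dashes then
    Finsupp.single (.bar h.1 (y.diagram.comp h.2.left) [] h.2.right) 1 else 0

variable (R) in
/-- Split off the dashed cups of the last entry, with a sign. -/
noncomputable def tailSplit (n i : ℕ) : (Tail (Dashed i) n →₀ R) →ₗ[R] (Tail (Dashed i) n →₀ R) :=
  Finsupp.linearCombination R fun p => (-1 : R) ^ p.1.length •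
    (splitTail R n i p.2).mapDomain fun q => (p.1 ++ q.1, q.2)

variable (R) in
/-- Split off the dashed cups of the last entry, with a sign. -/
noncomputable def barSplit (n i : ℕ) :
    (Chain (Dashed i) n →₀ R) →ₗ[R] (Chain (Dashed i) n →₀ R) :=
  Finsupp.linearCombination R fun b => match b with
    | .base y => splitBase R n i y
    | .bar hn D u x => -chainCons R hn D (tailSplit R n i (Finsupp.single (u, x) 1))

theorem tailSplit_nil (x : Dashed i (2 * n)) (r : R) :
    tailSplit R n i (tailNil R (Dashed i) n (Finsupp.single x r)) = r • splitTail R n i x := by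
  rw [tailNil_single, tailSplit, Finsupp.linearCombination_single]
  simp only [List.length_nil, pow_zero, one_smul, List.nil_append]
  exact congrArg (r • ·) Finsupp.mapDomain_id

theorem tailSplit_cons (A : Diagram (2 * n) (2 * n)) (v) :
    tailSplit R n i (tailCons R A v) = -tailCons R A (tailSplit R n i v) :=
  linear_congr (f := tailSplit R n i ∘ₗ tailCons R A) (g := -(tailCons R A ∘ₗ tailSplit R n i))
    (fun p => by
      rw [LinearMap.comp_apply, tailCons_single]
      simp only [LinearMap.neg_apply, LinearMap.comp_apply, tailSplit, Finsupp.linearCombination_single,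
        one_smul, map_smul, List.length_cons, pow_succ, mul_neg_one, neg_smul, tailCons,
        Finsupp.lmapDomain_apply, ← Finsupp.mapDomain_comp]
      rfl) v

theorem barSplit_base (y : Dashed i 0) (r : R) :
    barSplit R n i (chainBase R (Dashed i) n (Finsupp.single y r)) = r • splitBase R n i y := by
  rw [chainBase_single, barSplit, Finsupp.linearCombination_single]

theorem barSplit_cons (hn : 0 < n) (D : Diagram 0 (2 * n)) (v) :
    barSplit R n i (chainCons R hn D v) = -chainCons R hn D (tailSplit R n i v) :=
  linear_congr (f := barSplit R n i ∘ₗ chainCons R hn D)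
    (g := -(chainCons R hn D ∘ₗ tailSplit R n i))
    (fun p => by
      rw [LinearMap.comp_apply, chainCons_single, barSplit, Finsupp.linearCombination_single,
        one_smul]
      rfl) v

/-- The chosen factors depend only on the set of dashes, which composition with `A` does not change.
So splitting after composing equals composing after splitting, and the powers of `a` agree by
`Splits.loops_comp_left`. -/
theorem splitTail_lcomp (A : Diagram (2 * n) (2 * n)) (x : Dashed i (2 * n)) :
    a ^ A.loops x.diagram • splitTail R n i (x.lcomp A) =
      tailMul a (dashedData a i) A (splitTail R n i x) := by
  by_cases h : Splits n x.dashes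
  · have h' : Splits n (x.lcomp A).dashes := h
    have h1 := tailCons_single (R := R) (x.diagram.comp h.left) (([], h.right) : Tail (Dashed i) n) 1
    rw [splitTail, splitTail, dif_pos h, dif_pos h', ← h1, tailMul_cons, tailCons_single,
      h.loops_comp_left, Dashed.diagram_lcomp, Diagram.comp_assoc]
    rfl
  · have h' : ¬ Splits n (x.lcomp A).dashes := h
    rw [splitTail, splitTail, dif_neg h, dif_neg h', smul_zero, map_zero]

theorem splitBase_lcomp (hn : 0 < n) (D : Diagram 0 (2 * n)) (x : Dashed i (2 * n)) :
    a ^ D.loops x.diagram • splitBase R n i (x.lcomp D) =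
      chainMul a (dashedData a i) hn D (splitTail R n i x) := by
  by_cases h : Splits n x.dashes
  · have h' : 0 < n ∧ Splits n (x.lcomp D).dashes := ⟨hn, h⟩
    have h1 := tailCons_single (R := R) (x.diagram.comp h.left) (([], h.right) : Tail (Dashed i) n) 1
    rw [splitBase, splitTail, dif_pos h, dif_pos h', ← h1, chainMul_cons, chainCons_single,
      h.loops_comp_left, Dashed.diagram_lcomp, Diagram.comp_assoc]
    rfl
  · have h' : ¬ (0 < n ∧ Splits n (x.lcomp D).dashes) := fun h' => h h'.2
    rw [splitBase, splitTail, dif_neg h, dif_neg h', smul_zero, map_zero]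

theorem tailSplit_tailMul (A : Diagram (2 * n) (2 * n)) (v : Tail (Dashed i) n →₀ R) :
    tailSplit R n i (tailMul a (dashedData a i) A v) =
      tailMul a (dashedData a i) A (tailSplit R n i v) := by
  refine LinearMap.congr_fun (f := tailSplit R n i ∘ₗ tailMul a (dashedData a i) A)
    (g := tailMul a (dashedData a i) A ∘ₗ tailSplit R n i)
    (tail_ext (fun x => ?_) fun B v _ => ?_) v
  · simp only [LinearMap.comp_apply]
    rw [tailSplit_nil, one_smul, ← splitTail_lcomp, tailMul_nil, TLData.actMap_single,
      dashedData_act, tailSplit_nil]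
  · rw [LinearMap.comp_apply, LinearMap.comp_apply, tailMul_cons (M := dashedData a i), map_smul,
      tailSplit_cons, tailSplit_cons, map_neg, tailMul_cons (M := dashedData a i), smul_neg]

theorem barSplit_chainMul (hn : 0 < n) (D : Diagram 0 (2 * n)) (v : Tail (Dashed i) n →₀ R) :
    barSplit R n i (chainMul a (dashedData a i) hn D v) =
      chainMul a (dashedData a i) hn D (tailSplit R n i v) := by
  refine LinearMap.congr_fun (f := barSplit R n i ∘ₗ chainMul a (dashedData a i) hn D)
    (g := chainMul a (dashedData a i) hn D ∘ₗ tailSplit R n i)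
    (tail_ext (fun x => ?_) fun B v _ => ?_) v
  · simp only [LinearMap.comp_apply]
    rw [tailSplit_nil, one_smul, ← splitBase_lcomp, chainMul_nil, TLData.actMap_single,
      dashedData_act, barSplit_base]
  · rw [LinearMap.comp_apply, LinearMap.comp_apply, chainMul_cons (M := dashedData a i), map_smul,
      barSplit_cons, tailSplit_cons, map_neg, chainMul_cons (M := dashedData a i), smul_neg]

variable (R) in
/-- The projection to the span of the elements with less than `i` dashes. -/
noncomputable def lowTail (n i : ℕ) : (Tail (Dashed i) n →₀ R) →ₗ[R] (Tail (Dashed i) n →₀ R) :=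
  tailMap n fun _ x => if x.dashes.card = i then 0 else Finsupp.single x 1

variable (R) in
/-- The projection to the span of the elements with less than `i` dashes. -/
noncomputable def lowChain (n i : ℕ) : (Chain (Dashed i) n →₀ R) →ₗ[R] (Chain (Dashed i) n →₀ R) :=
  barMap n fun _ x => if x.dashes.card = i then 0 else Finsupp.single x 1

variable (hi : i ≤ n)
include hi

/-- On a tail of length one the last face of the split element multiplies the two factors together
again and returns `x`. For longer tails everything to the left of the last entry cancels by the
alternating sign. With `i` dashes the splitting is zero, and so is the projection. -/
theorem tailDiff_tailSplit (v : Tail (Dashed i) n →₀ R) :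
    tailDiff a (dashedData a i) (tailSplit R n i v) +
      tailSplit R n i (tailDiff a (dashedData a i) v) = lowTail R n i v := by
  refine LinearMap.congr_fun (f := tailDiff a (dashedData a i) ∘ₗ tailSplit R n i +
      tailSplit R n i ∘ₗ tailDiff a (dashedData a i)) (g := lowTail R n i)
    (tail_ext (fun x => ?_) fun A v h => ?_) v
  · simp only [LinearMap.add_apply, LinearMap.comp_apply, lowTail]
    rw [tailSplit_nil, one_smul, tailDiff_nil, map_zero, add_zero, tailMap_nil,
      Finsupp.linearCombination_single, one_smul]
    by_cases hx : x.dashes.card = i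
    · rw [if_pos hx, map_zero, splitTail, dif_neg fun h => h.1.ne hx, map_zero]
    · have h := Dashed.splits hi (lt_of_le_of_ne x.card_dashes_le hx)
      have h1 := tailCons_single (R := R) (x.diagram.comp h.left)
        (([], h.right) : Tail (Dashed i) n) 1
      have h2 := tailNil_single (R := R) h.right 1
      rw [if_neg hx, splitTail, dif_pos h, ← h1, ← h2, tailDiff_cons, tailDiff_nil, map_zero,
        sub_zero, tailMul_nil, TLData.actMap_single, dashedData_act, h.loops_left_right, pow_zero,
        h.lcomp_right]
  · simp only [LinearMap.add_apply, LinearMap.comp_apply] at h ⊢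
    rw [tailSplit_cons, map_neg, tailDiff_cons, tailDiff_cons, map_sub, tailSplit_tailMul,
      tailSplit_cons, lowTail, tailMap_cons]
    rw [lowTail] at h
    rw [← h, map_add]
    abel

theorem barDiff_barSplit (v : Chain (Dashed i) n →₀ R) :
    barDiff a (dashedData a i) (barSplit R n i v) +
      barSplit R n i (barDiff a (dashedData a i) v) = lowChain R n i v := by
  refine LinearMap.congr_fun (f := barDiff a (dashedData a i) ∘ₗ barSplit R n i +
      barSplit R n i ∘ₗ barDiff a (dashedData a i)) (g := lowChain R n i)
    (chain_ext (fun y => ?_) fun hn D v => ?_) v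
  · simp only [LinearMap.add_apply, LinearMap.comp_apply, lowChain]
    rw [barSplit_base, one_smul, barDiff_base, map_zero, add_zero, barMap_base,
      Finsupp.linearCombination_single, one_smul]
    by_cases hx : y.dashes.card = i
    · rw [if_pos hx, map_zero, splitBase, dif_neg fun h => h.2.1.ne hx, map_zero]
    · have hlt := lt_of_le_of_ne y.card_dashes_le hx
      -- Fewer than `i` dashes force `i`, and with it `n`, to be positive, so there are chains in
      -- positive degree to split into.
      have h : 0 < n ∧ Splits n y.dashes := ⟨by omega, Dashed.splits hi hlt⟩
      have h1 := chainCons_single (R := R) h.1 (y.diagram.comp h.2.left)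
        (([], h.2.right) : Tail (Dashed i) n) 1
      have h2 := tailNil_single (R := R) h.2.right 1
      rw [if_neg hx, splitBase, dif_pos h, ← h1, ← h2, barDiff_cons, tailDiff_nil, map_zero,
        sub_zero, chainMul_nil, TLData.actMap_single, dashedData_act, h.2.loops_left_right, pow_zero,
        h.2.lcomp_right]
  · simp only [LinearMap.add_apply, LinearMap.comp_apply]
    have h := tailDiff_tailSplit (a := a) hi v
    rw [barSplit_cons, map_neg, barDiff_cons, barDiff_cons, map_sub, barSplit_chainMul,
      barSplit_cons, lowChain, barMap_cons]
    rw [lowTail] at h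
    rw [← h, map_add]
    abel

end Contraction

/-! ### Identifying the part with `i` dashes -/

section Maximal

variable {R : Type*} [CommRing R] {a : R} {n i m : ℕ}

/-- Cut all cups of `L_max` into a diagram and dash them. -/
noncomputable def Dashed.ofLoops (i : ℕ) (E : Diagram m 0) : Dashed i m :=
  ⟨(E.comp (rightMax i), evens i), fun j hj => by
    have hj : (j : ℕ) % 2 = 0 := (Finset.mem_filter.1 hj).2
    exact ⟨_, Diagram.comp_partner_inr _ _ (rightMax_partner i j hj)⟩⟩

variable (R) in
/-- The section of `deleteDashes`. -/
noncomputable def addDashes (i m : ℕ) (E : Diagram m 0) : Dashed i m →₀ R :=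
  Finsupp.single (Dashed.ofLoops i E) 1

theorem deleteDashes_addDashes (m : ℕ) (E : Diagram m 0) :
    Finsupp.linearCombination R (deleteDashes R i m) (addDashes R i m E) =
      Finsupp.single E 1 := by
  rw [addDashes, Finsupp.linearCombination_single, one_smul, deleteDashes,
    if_pos (show (Dashed.ofLoops i E).dashes.card = i from card_evens i)]
  congr 1
  exact comp_rightMax_leftMax E

/-- Deleting and reinserting the dashed cups is the identity when there are `i` of them, since their
positions are forced. Hence the projection to fewer dashes has the form `1 - sf` required for the
reduction. -/
theorem addDashes_deleteDashes (x : Dashed i m) :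
    (if x.dashes.card = i then 0 else Finsupp.single x 1 : Dashed i m →₀ R) =
      Finsupp.single x 1 -
        Finsupp.linearCombination R (addDashes R i m) (deleteDashes R i m x) := by
  by_cases h : x.dashes.card = i
  · rw [if_pos h, deleteDashes, if_pos h, Finsupp.linearCombination_single, one_smul, addDashes,
      eq_comm, sub_eq_zero]
    congr 1
    exact Dashed.ext (comp_leftMax_rightMax h).symm (Dashed.dashes_eq_evens h)
  · rw [if_neg h, deleteDashes, if_neg h, map_zero, sub_zero]

theorem lowChain_eq (x : Chain (Dashed i) n →₀ R) :
    lowChain R n i x = x - barMap n (addDashes R i) (barMap n (deleteDashes R i) x) :=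
  linear_congr (f := lowChain R n i)
    (g := LinearMap.id - barMap n (addDashes R i) ∘ₗ barMap n (deleteDashes R i)) (fun b => by
    simp only [lowChain, LinearMap.sub_apply, LinearMap.comp_apply, barMap_single,
      LinearMap.id_apply]
    rcases b with y | ⟨hn, D, u, y⟩ <;>
    simp only [chainMap, barMap_mapDomain_base, barMap_mapDomain_bar] <;>
    rw [addDashes_deleteDashes, ← Finsupp.mapDomain_single] <;>
    exact map_sub (Finsupp.mapDomain.addMonoidHom _) _ _) x

/-- Splitting keeps the number of dashes and vanishes on elements with `i` of them. The second fact
yields the condition `f h = 0` of the reduction lemma. -/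
theorem barSplit_single_supported (a : R) (b : Chain (Dashed i) n) :
    barSplit R n i (Finsupp.single b 1) ∈ Finsupp.supported R R
      {c | chainLab (M := dashedData a i) (dashLab i) c =
        chainLab (M := dashedData a i) (dashLab i) b ∧
        chainLab (M := dashedData a i) (dashLab i) b ≠ i} := by
  rw [barSplit, Finsupp.linearCombination_single, one_smul]
  rcases b with y | ⟨hn, D, u, x⟩
  · change splitBase R n i y ∈ _
    rw [splitBase]
    split_ifs with h
    · exact Finsupp.single_mem_supported R 1 ⟨rfl, h.2.1.ne⟩
    · exact zero_mem _
  · change -chainCons R hn D (tailSplit R n i (Finsupp.single (u, x) 1)) ∈ _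
    rw [tailSplit, Finsupp.linearCombination_single, one_smul, splitTail, map_smul]
    refine neg_mem (Submodule.smul_mem _ _ ?_)
    split_ifs with h
    · rw [Finsupp.mapDomain_single, chainCons_single]
      exact Finsupp.single_mem_supported R 1 ⟨rfl, h.1.ne⟩
    · rw [Finsupp.mapDomain_zero, map_zero]
      exact zero_mem _

theorem barMap_deleteDashes_of_ne (a : R) {c : Chain (Dashed i) n}
    (hc : chainLab (M := dashedData a i) (dashLab i) c ≠ i) :
    barMap n (deleteDashes R i) (Finsupp.single c 1) = 0 := by
  rw [barMap_single]
  rcases c with y | ⟨hn, D, u, x⟩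
  · have hc : y.dashes.card ≠ i := hc
    rw [chainMap, deleteDashes, if_neg hc, Finsupp.mapDomain_zero]
  · have hc : x.dashes.card ≠ i := hc
    rw [chainMap, deleteDashes, if_neg hc, Finsupp.mapDomain_zero]

/-- The splitting operator with the signs that belong to the total differential. -/
noncomputable def signSplit (a : R) (n i : ℕ) :
    (Chain (Dashed i) n →₀ R) →ₗ[R] (Chain (Dashed i) n →₀ R) :=
  signMap R (chainLab (M := dashedData a i) (dashLab i)) 1 ∘ₗ barSplit R n i

theorem signSplit_single_supported (b : Chain (Dashed i) n) :
    signSplit a n i (Finsupp.single b 1) ∈ Finsupp.supported R R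
      {c | chainLab (M := dashedData a i) (dashLab i) c =
        chainLab (M := dashedData a i) (dashLab i) b ∧
        chainLab (M := dashedData a i) (dashLab i) b ≠ i} :=
  signMap_mem_supported 1 (barSplit_single_supported a b)

theorem barMap_deleteDashes_signSplit (x : Chain (Dashed i) n →₀ R) :
    barMap n (deleteDashes R i) (signSplit a n i x) = 0 :=
  linear_congr (f := barMap n (deleteDashes R i) ∘ₗ signSplit a n i) (g := 0) (fun b =>
    eq_of_mem_supported (f := barMap n (deleteDashes R i)) (g := 0)
      (fun _ hc => barMap_deleteDashes_of_ne a (ne_of_eq_of_ne hc.1 hc.2))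
      (signSplit_single_supported (a := a) b)) x

/-- With `D = δ + dσ`, `h = σk` and `k` the splitting operator, `σ² = 1` and the commutation of `σ`
with `d` and `k` turn the `d`-part of `Dh + hD` into `dk + kd`, which is the projection to fewer
than `i` dashes. What remains is `δh + hδ`. -/
theorem twistDiff_signSplit (hi : i ≤ n) (x : Chain (Dashed i) n →₀ R) :
    twistDiff (M := dashedData a i) a (dashLab i) (barUndash R n i) (signSplit a n i x) +
      signSplit a n i (twistDiff (M := dashedData a i) a (dashLab i) (barUndash R n i) x) =
    x - barMap n (addDashes R i) (barMap n (deleteDashes R i) x) -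
      (-(barUndash R n i ∘ₗ signSplit a n i + signSplit a n i ∘ₗ barUndash R n i)) x := by
  have hk : ∀ y, signMap R (chainLab (M := dashedData a i) (dashLab i)) 1 (barSplit R n i y) =
      barSplit R n i (signMap R (chainLab (M := dashedData a i) (dashLab i)) 1 y) := fun y =>
    (map_signMap (fun b => Finsupp.supported_mono (fun _ hc => hc.1)
      (barSplit_single_supported a b)) 1 y).symm
  have hs : ∀ y : Chain (Dashed i) n →₀ R,
      signMap R (chainLab (M := dashedData a i) (dashLab i)) 1
        (signMap R (chainLab (M := dashedData a i) (dashLab i)) 1 y) = y := fun y => by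
    rw [signMap_signMap, signMap_congr (j := 1 + 1) (k := 0) rfl, signMap_zero]
  rw [← lowChain_eq, ← barDiff_barSplit (a := a) hi, twistDiff_apply, twistDiff_apply, map_add]
  simp only [LinearMap.neg_apply, LinearMap.add_apply, LinearMap.comp_apply, signSplit]
  rw [hs, hk (barDiff a (dashedData a i) _), ← signMap_barDiff (dashedData_isWeighted i), hs]
  abel

/-- The splitting depends on the set of dashes and so need not commute with un-dashing. But `δ`
removes a dash while the homotopy keeps their number, so the error `-(δh + hδ)` strictly lowers the
number of dashes and the reduction lemma applies. -/
theorem toSusp_isHomologyIso (hi : i ≤ n) :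
    IsHomologyIso (M := innTwist a n i) (N := suspTwist a n i) (barMap n (deleteDashes R i)) := by
  have hM := twistDG_isDGModule (n := n) 0 (dashedData_isModule (a := a) i)
    (dashedData_isWeighted i) barUndash_isTwist
  have hd : ∀ x, barMap n (deleteDashes R i)
      (twistDiff (M := dashedData a i) a (dashLab i) (barUndash R n i) x) =
      twistDiff (M := loopData a) a (fun _ _ => i) 0 (barMap n (deleteDashes R i) x) :=
    barMap_twistDiff (M := dashedData a i) (M' := loopData a) deleteDashes_isNatural
      (fun b => homPart_le_supported (barMap_deleteDashes_mem (𝒜 := fun _ => ⊤) b))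
      (barMap_barUndash fun _ => deleteDashes_undash)
  have hg : ∀ b, (-(barUndash R n i ∘ₗ signSplit a n i + signSplit a n i ∘ₗ barUndash R n i))
      (Finsupp.single b 1) ∈ Finsupp.supported R R
        {c | chainLab (M := dashedData a i) (dashLab i) c <
          chainLab (M := dashedData a i) (dashLab i) b} := by
    intro b
    have h1 := fun c => homPart_le_supported (barUndash_single_mem (a := a)
      (𝒜 := fun _ => ⊤) (i := i) (n := n) c)
    refine neg_mem (add_mem ?_ ?_)
    · refine map_mem_supported (f := barUndash R n i) (fun c hc => ?_)
        (signSplit_single_supported (a := a) b)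
      refine Finsupp.supported_mono (fun c' hc' => ?_) (h1 c)
      exact (Nat.lt_of_succ_le hc'.2.le).trans_eq hc.1
    · refine map_mem_supported (f := signSplit a n i) (fun c hc => ?_) (h1 b)
      refine Finsupp.supported_mono (fun c' hc' => ?_) (signSplit_single_supported c)
      exact lt_of_eq_of_lt hc'.1 (Nat.lt_of_succ_le hc.2.le)
  constructor
  · intro x hx hx'
    exact exists_boundary hM.d_d hd (barMap_id_of deleteDashes_addDashes)
      barMap_deleteDashes_signSplit (twistDiff_signSplit hi) hg hx hx'
  · intro y hy
    exact exists_cycle hM.d_d hd (barMap_id_of deleteDashes_addDashes)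
      barMap_deleteDashes_signSplit (twistDiff_signSplit hi) hg hy

end Maximal

/-! ### The maps of the zig-zag are quasi-isomorphisms -/

section Main

variable {R : Type*} [CommRing R] {a : R} {n i : ℕ}

theorem toSusp_isQuasiIso_twist (hi : i ≤ n) :
    IsQuasiIso (M := innTwist a n i) (N := suspTwist a n i) (barMap n (deleteDashes R i)) :=
  (toSusp_isHomologyIso hi).isQuasiIso (a := a)
    (twistDG_isDGModule 0 (dashedData_isModule i) (dashedData_isWeighted i) barUndash_isTwist)
    (fun _ => DGData.map_mem_degPart (M := innTwist a n i) (N := suspTwist a n i) fun b hb =>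
      Finsupp.supported_mono (fun _ hc => (congrArg₂ (· + ·) hc.1 hc.2).trans hb)
        (homPart_le_supported (barMap_deleteDashes_mem (a := a) (𝒜 := fun _ => ⊤) b)))
    (barMap_twistDiff (M := dashedData a i) (M' := loopData a) deleteDashes_isNatural
      (fun b => homPart_le_supported (barMap_deleteDashes_mem (𝒜 := fun _ => ⊤) b))
      (barMap_barUndash fun _ => deleteDashes_undash))
    (barMap_twistAct (M := dashedData a i) (M' := loopData a) deleteDashes_isNatural
      (fun b => homPart_le_supported (barMap_deleteDashes_mem (𝒜 := fun _ => ⊤) b)))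

theorem toCell_isQuasiIso_twist :
    IsQuasiIso (M := innTwist a n i) (N := cellTwist a n i) (barMap n (cellClass R i)) :=
  toCell_isHomologyIso.isQuasiIso (a := a)
    (twistDG_isDGModule 0 (dashedData_isModule i) (dashedData_isWeighted i) barUndash_isTwist)
    (fun _ => DGData.map_mem_degPart (M := innTwist a n i) (N := cellTwist a n i) fun b hb =>
      Finsupp.supported_mono (fun _ hc => (congrArg₂ (· + ·) hc.1 hc.2).trans hb)
        (homPart_le_supported (barMap_cellClass_mem (a := a) (𝒜 := fun _ => ⊤) b)))
    (barMap_twistDiff (M := dashedData a i) (M' := quotientData a i) cellClass_isNatural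
      (fun b => homPart_le_supported (barMap_cellClass_mem (𝒜 := fun _ => ⊤) b))
      (barMap_barUndash fun _ => cellClass_undash))
    (barMap_twistAct (M := dashedData a i) (M' := quotientData a i) cellClass_isNatural
      (fun b => homPart_le_supported (barMap_cellClass_mem (𝒜 := fun _ => ⊤) b)))

theorem toSusp_isQuasiIso (hi : i ≤ n) : IsQuasiIso (toSusp a n i) :=
  innDG_of_innTwist (P := fun deg wt d act => IsQuasiIso (M := ⟨_, deg, wt, d, act⟩)
      (N := (loopDG a n).susp i) (toSusp a n i))
    (susp_of_suspTwist (P := fun deg wt d act => IsQuasiIso (M := innTwist a n i)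
      (N := ⟨_, deg, wt, d, act⟩) (toSusp a n i)) (toSusp_isQuasiIso_twist hi))

theorem toCell_isQuasiIso : IsQuasiIso (toCell a n i) :=
  innDG_of_innTwist (P := fun deg wt d act => IsQuasiIso (M := ⟨_, deg, wt, d, act⟩)
      (N := cellDG a n i) (toCell a n i))
    (cell_of_cellTwist (P := fun deg wt d act => IsQuasiIso (M := innTwist a n i)
      (N := ⟨_, deg, wt, d, act⟩) (toCell a n i)) toCell_isQuasiIso_twist)

variable {𝒜 : ℕ → AddSubgroup R} [GradedRing 𝒜] (ha : a ∈ 𝒜 1)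
include ha

theorem toSusp_isBigradedQuasiIso (hi : i ≤ n) : IsBigradedQuasiIso 𝒜 (toSusp a n i) :=
  innDG_of_innTwist (P := fun deg wt d act => IsBigradedQuasiIso 𝒜
      (M := ⟨_, deg, wt, d, act⟩) (N := (loopDG a n).susp i) (toSusp a n i))
    (susp_of_suspTwist (P := fun deg wt d act => IsBigradedQuasiIso 𝒜 (M := innTwist a n i)
      (N := ⟨_, deg, wt, d, act⟩) (toSusp a n i))
      ((toSusp_isHomologyIso hi).isBigradedQuasiIso (a := a)
        (twistDG_isBigradedDGModule 0 (dashedData_isModule i) (dashedData_isWeighted i)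
          barUndash_isTwist ha fun b => homPart_mono (Set.subset_univ _) (barUndash_single_mem b))
        (toSusp_isQuasiIso_twist hi)
        (DGData.map_mem_wtPart (M := innTwist a n i) (N := suspTwist a n i)
          fun b => ⟨_, barMap_deleteDashes_mem b⟩)))

theorem toCell_isBigradedQuasiIso : IsBigradedQuasiIso 𝒜 (toCell a n i) :=
  innDG_of_innTwist (P := fun deg wt d act => IsBigradedQuasiIso 𝒜
      (M := ⟨_, deg, wt, d, act⟩) (N := cellDG a n i) (toCell a n i))
    (cell_of_cellTwist (P := fun deg wt d act => IsBigradedQuasiIso 𝒜 (M := innTwist a n i)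
      (N := ⟨_, deg, wt, d, act⟩) (toCell a n i))
      (toCell_isHomologyIso.isBigradedQuasiIso (a := a)
        (twistDG_isBigradedDGModule 0 (dashedData_isModule i) (dashedData_isWeighted i)
          barUndash_isTwist ha fun b => homPart_mono (Set.subset_univ _) (barUndash_single_mem b))
        toCell_isQuasiIso_twist
        (DGData.map_mem_wtPart (M := innTwist a n i) (N := cellTwist a n i)
          fun b => ⟨_, barMap_cellClass_mem b⟩)))

end Main

end PlanarLoops

theorem mainTheorem6 {R : Type*} [CommRing R] (a : R) (n i : ℕ) (hi : i ≤ n) :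
    -- `Σ^i L(2n) ← [DInn_0(2n, 2i) ← ⋯ ← DInn_i(2n, 2i)] → DS(2n, 2i)` is a zig-zag of
    -- quasi-isomorphisms of differential graded `L(2n)`-modules
    ((IsDGModule a (loopDG a n) ∧ IsDGModule a ((loopDG a n).susp i) ∧
        IsDGModule a (innDG a n i) ∧ IsDGModule a (cellDG a n i)) ∧
      IsQuasiIso (toSusp a n i) ∧ IsQuasiIso (toCell a n i)) ∧
    -- it is bigraded, starting from `Σ^{i,i} L(2n)`, whenever the weight grading is defined
    (∀ (𝒜 : ℕ → AddSubgroup R) [GradedRing 𝒜], a ∈ 𝒜 1 →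
      (IsBigradedDGModule a 𝒜 (loopDG a n) ∧ IsBigradedDGModule a 𝒜 ((loopDG a n).susp i) ∧
        IsBigradedDGModule a 𝒜 (innDG a n i) ∧ IsBigradedDGModule a 𝒜 (cellDG a n i)) ∧
      (IsBigradedQuasiIso 𝒜 (toSusp a n i) ∧ IsBigradedQuasiIso 𝒜 (toCell a n i)) ∧
      (IsBigradedHookLinear a 𝒜 (suspHook a n i) ∧ IsBigradedHookLinear a 𝒜 (innHook a n i) ∧
        IsBigradedHookLinear a 𝒜 (cellHook a n i))) ∧
    -- it is compatible with the hook maps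
    ((IsHookLinear a (suspHook a n i) ∧ IsHookLinear a (innHook a n i) ∧
        IsHookLinear a (cellHook a n i)) ∧
      (∀ x, toSusp a (n + 1) i (innHook a n i x) = suspHook a n i (toSusp a n i x)) ∧
      (∀ x, toCell a (n + 1) i (innHook a n i x) = cellHook a n i (toCell a n i x))) := by
  refine ⟨⟨⟨loopDG_isDGModule, susp_isDGModule, innDG_isDGModule, cellDG_isDGModule⟩,
      toSusp_isQuasiIso hi, toCell_isQuasiIso⟩, fun 𝒜 _ ha =>
    ⟨⟨loopDG_isBigradedDGModule ha, susp_isBigradedDGModule ha, innDG_isBigradedDGModule ha,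
      cellDG_isBigradedDGModule ha⟩,
      ⟨toSusp_isBigradedQuasiIso ha hi, toCell_isBigradedQuasiIso ha⟩,
      suspHook_isBigradedHookLinear ha, innHook_isBigradedHookLinear ha,
      cellHook_isBigradedHookLinear ha⟩,
    ⟨suspHook_isHookLinear, innHook_isHookLinear, cellHook_isHookLinear⟩,
    toSusp_innHook, toCell_innHook⟩
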